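/- **Setting.** On a probability space $(\Omega,\mathcal A,\mathbb P)$ let $\Theta$ be the càdlàg Lévy process $$\Theta_t=\mu_1t+\sigma_1B_t+\int_0^t\!\int_{\mathbb R}x\,\bar M_1(ds,dx),\qquad \mu_1,\sigma_1\in\mathbb R\setminus\{0\},$$ where $B$ is a Brownian motion and $M_1$ is an independent Poisson random measure on $\mathbb R\times\mathbb R$ with mean measure $\mathrm{Leb}\times\nu_1$. Here $\nu_1$ is a Lévy measure ($\nu_1(\{0\})=0$, $\int\min(x^2,1)\,d\nu_1<\infty$), and $\bar M_1(ds,dx)=M_1(ds,dx)-\nu_1(dx)ds$ for $|x|<1$, $\bar M_1=M_1$ for $|x|\ge1$. Let $\xi=\xi^L+\xi^f$ with $\xi^L,\xi^f$ real-valued and càdlàg for all times $t\ge 0$ (no killing), where: * $\xi^L_t=x_0+\int_0^t\mu_2(\Theta_s)ds+\int_0^t\sigma_2(\Theta_s)dW_s+\int_0^t\!\int_{\mathbb R}x\,\bar M_2(ds,dx)$, with $x_0\in\mathbb R$ constant, $\mu_2,\sigma_2$ measurable real functions such that a.s. $\int_0^t|\mu_2(\Theta_s)|ds<\infty$ and $\int_0^t\sigma_2^2(\Theta_s)ds<\infty$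 for all $t$, $W$ a Brownian motion independent of $\Theta$, and $M_2$ a Poisson random measure on $\mathbb R\times\mathbb R$, independent of $(\Theta,W)$, with mean measure $\mathrm{Leb}\times\nu_2$ for a Lévy measure $\nu_2$ ($\bar M_2$ is defined from $M_2,\nu_2$ in the same way); * $\xi^f_t=\sum_jU_j(\Delta\Theta_{\tau_j})\mathbf 1_{\{\tau_j\le t\}}$ (absolutely convergent), where $(\tau_j)$ is an enumeration of the jump times of $\Theta$, measurable with respect to the completed $\sigma$-algebra of $\Theta$, and $U_1,U_2,\dots$ are i.i.d. random functions $x\mapsto U_j(x)$, each a measurable process with respect to the $\sigma$-algebra it generates, and independent of $(\Theta,W,M_2)$; $U$ denotes a generic copy. Let $\mathcal K_t=\sigma(\Theta_s:s\le t)$, $\mathcal F_t=\sigma(\Theta_s,\xi_s:s\le t)\vee\mathcal N$ with $\mathcal N$ the $\mathbb P$-null sets, $\mathcal F=\bigvee_{t\ge0}\mathcal F_t$, and $$\bar\Theta_t=\Theta_t-\mathbb E[\Theta_t],\qquad \bar\xi^L_t=\xi^L_t-\mathbb E[\xi^L_t\mid\mathcal K_t],\qquad \bar\xi^f_t=\xi^f_t-t\int_{\mathbb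 R}\int_{\mathbb R}y\,\mathbb P(U(x)\in dy)\,\nu_1(dx).$$ **Moment assumptions.** For some $\lambda>0$: $\int_{|x|\ge1}e^{\lambda|x|}\nu_i(dx)<\infty$ for $i=1,2$, and $\int_{|y|\ge1}e^{\lambda|y|}\,\mathbb P(U(x)\in dy)<\infty$ for all $x\in\mathbb R$. Moreover $\xi^L_t$ has moments of all orders for every $t\ge 0$, and $\int\int|y|^k\,\mathbb P(U(x)\in dy)\,\nu_1(dx)<\infty$ for every integer $k\ge1$. **Proposition.** (1) Let $t\ge0$ and $Z\in L^2(\Omega,\mathcal F_t)$. For every $\epsilon>0$ there are an integer $m$, times $0\le s_1\le\dots\le s_m\le t$ and a random variable $Z_\epsilon\in L^2\bigl(\Omega,\sigma(\bar\Theta_{s_1},\dots,\bar\Theta_{s_m},\bar\xi^L_{s_1},\dots,\bar\xi^L_{s_m},\bar\xi^f_{s_1},\dots,\bar\xi^f_{s_m})\bigr)$ such that $\mathbb E[(Z-Z_\epsilon)^2]<\epsilon$. (2) The set $$\mathcal P=\Bigl\{\prod_{i=1}^m\bar\Theta_{t_i}^{g_i}\,\prod_{i=1}^m(\bar\xi^L_{t_i})^{p_i}\,\prod_{i=1}^m(\bar\xi^f_{t_i})^{b_i}\;:\;m\ge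 0,\ 0\le t_1<\dots<t_m,\ g_i,p_i,b_i\in\mathbb Z_{\ge0}\Bigr\}$$ is a total family in $L^2(\Omega,\mathcal F)$: it is contained in $L^2(\Omega,\mathcal F)$ and its linear span is dense there. -/

import Mathlib

open MeasureTheory ProbabilityTheory Filter Topology
open scoped NNReal ENNReal

noncomputable section

namespace LevyMAP

/-- Right-continuous with left limits. -/
def IsCadlagPath (f : ℝ≥0 → ℝ) : Prop :=
  ∀ t, ContinuousWithinAt f (Set.Ici t) t ∧ ∃ l, Tendsto f (𝓝[<] t) (𝓝 l)

/-- The jump `f t - f (t-)` (it is `0` at `t = 0`). -/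
def jump (f : ℝ≥0 → ℝ) (t : ℝ≥0) : ℝ := f t - Function.leftLim f t

variable {Ω : Type*} [mΩ : MeasurableSpace Ω]

/-- The σ-algebra generated by a real process on its whole time axis. -/
def processSigma (X : ℝ≥0 → Ω → ℝ) : MeasurableSpace Ω :=
  ⨆ t, MeasurableSpace.comap (X t) inferInstance

/-- The σ-algebra generated by a real process up to time `t`. -/
def processSigmaUpTo (X : ℝ≥0 → Ω → ℝ) (t : ℝ≥0) : MeasurableSpace Ω :=
  ⨆ s : Set.Iic t, MeasurableSpace.comap (X s) inferInstance

/-- The σ-algebra generated by the measurable `P`-null sets. -/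
def nullSigma (P : Measure Ω) : MeasurableSpace Ω :=
  MeasurableSpace.generateFrom {A | MeasurableSet A ∧ P A = 0}

/-- Convergence in probability, uniformly on compact time intervals. -/
def TendstoUCP (P : Measure Ω) (Xn : ℕ → ℝ≥0 → Ω → ℝ) (X : ℝ≥0 → Ω → ℝ) : Prop :=
  ∀ T : ℝ≥0, ∀ ε > 0,
    Tendsto (fun n => P {ω | ∃ t ≤ T, ε ≤ |Xn n t ω - X t ω|}) atTop (𝓝 0)

/-- `M` is a Poisson random measure on `E` with (σ-finite) mean measure `m`. -/
structure IsPoissonRandomMeasure {E : Type*} [MeasurableSpace E]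
    (P : Measure Ω) (M : Ω → Measure E) (m : Measure E) : Prop where
  measurable : Measurable M
  law : ∀ A, MeasurableSet A → m A ≠ ∞ →
    HasLaw (fun ω => M ω A)
      ((poissonMeasure (m A).toNNReal).map (Nat.cast : ℕ → ℝ≥0∞)) P
  indep : ∀ (n : ℕ) (A : Fin n → Set E), (∀ i, MeasurableSet (A i)) →
    (Pairwise fun i j => Disjoint (A i) (A j)) → iIndepFun (fun i ω => M ω (A i)) P

/-- `ν` is a Lévy measure on `ℝ`. -/
structure IsLevyMeasure (ν : Measure ℝ) : Prop where
  zero : ν {0} = 0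
  integrable : ∫⁻ x, ENNReal.ofReal (min (x ^ 2) 1) ∂ν < ∞

/-- `J t = ∫₀ᵗ ∫ x M̄(ds,dx)`, where `M̄ = M - ds ν(dx)` on `|x| < 1` and `M̄ = M` on `|x| ≥ 1`:
the limit of the integrals over the jumps of size at least `1 / (n + 1)`, the compensator
being subtracted for the jumps of size less than `1`. -/
def IsCompensatedJumpIntegral (P : Measure Ω) (M : Ω → Measure (ℝ × ℝ)) (ν : Measure ℝ)
    (J : ℝ≥0 → Ω → ℝ) : Prop :=
  TendstoUCP P
    (fun n t ω =>
      (∫ p in Set.Ioc (0 : ℝ) t ×ˢ {x : ℝ | 1 / ((n : ℝ) + 1) ≤ |x|}, p.2 ∂(M ω))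
        - t * ∫ x in {x : ℝ | 1 / ((n : ℝ) + 1) ≤ |x| ∧ |x| < 1}, x ∂ν)
    J

/-- Simple integrands adapted to `G`:
`∑ i, val i · 1_{(time i, time (i + 1)]}` with `val i` bounded and `G (time i)`-measurable. -/
structure SimpleIntegrand (G : ℝ≥0 → MeasurableSpace Ω) where
  len : ℕ
  time : ℕ → ℝ≥0
  mono : Monotone time
  val : ℕ → Ω → ℝ
  meas : ∀ i, Measurable[G (time i)] (val i)
  bdd : ∀ i, ∃ C : ℝ, ∀ ω, |val i ω| ≤ C

namespace SimpleIntegrand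

variable {G : ℝ≥0 → MeasurableSpace Ω}

/-- The simple integrand as a process. -/
def eval (H : SimpleIntegrand G) (s : ℝ≥0) (ω : Ω) : ℝ :=
  ∑ i ∈ Finset.range H.len, (Set.Ioc (H.time i) (H.time (i + 1))).indicator (fun _ => H.val i ω) s

/-- The elementary stochastic integral `∫₀ᵗ H dW`. -/
def integral (H : SimpleIntegrand G) (W : ℝ≥0 → Ω → ℝ) (t : ℝ≥0) (ω : Ω) : ℝ :=
  ∑ i ∈ Finset.range H.len, H.val i ω * (W (min t (H.time (i + 1))) ω - W (min t (H.time i)) ω)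

end SimpleIntegrand

/-- `I` is the Itô integral process `∫₀ᵗ H dW` with respect to the filtration `G`: for some simple
integrands `Hₙ` with `∫₀ᵀ (Hₙ - H)² ds → 0` in probability for all `T`, the elementary integrals
of `Hₙ` converge to `I` uniformly on compacts in probability. -/
def IsItoIntegral (P : Measure Ω) (G : ℝ≥0 → MeasurableSpace Ω) (W H I : ℝ≥0 → Ω → ℝ) : Prop :=
  ∃ Hn : ℕ → SimpleIntegrand G,
    (∀ T : ℝ≥0, ∀ ε > 0, Tendsto
      (fun n => P {ω | ε ≤ ∫⁻ s in Set.Ioc (0 : ℝ) T,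
        ENNReal.ofReal (((Hn n).eval s.toNNReal ω - H s.toNNReal ω) ^ 2)}) atTop (𝓝 0)) ∧
    TendstoUCP P (fun n => (Hn n).integral W) I

/-- A (conservative) Markov additive process `(ξ, Θ)` whose modulator `Θ` is a Lévy process and
whose ordinate is `ξ = ξL + ξf`. -/
structure ModulatedProcess (P : Measure Ω) where
  /- The modulator: a Lévy process given by its Lévy-Itô representation
  `Θ t = μ₁ t + σ₁ B t + ∫₀ᵗ ∫ x M̄₁(ds,dx)`. -/
  μ₁ : ℝ
  σ₁ : ℝ
  μ₁_ne : μ₁ ≠ 0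
  σ₁_ne : σ₁ ≠ 0
  ν₁ : Measure ℝ
  levy₁ : IsLevyMeasure ν₁
  B : ℝ≥0 → Ω → ℝ
  B_meas : ∀ t, Measurable (B t)
  B_brownian : IsBrownianReal B P
  M₁ : Ω → Measure (ℝ × ℝ)
  M₁_poisson : IsPoissonRandomMeasure P M₁ (volume.prod ν₁)
  B_indep_M₁ : Indep (processSigma B) (MeasurableSpace.comap M₁ inferInstance) P
  J₁ : ℝ≥0 → Ω → ℝ
  J₁_spec : IsCompensatedJumpIntegral P M₁ ν₁ J₁
  Θ : ℝ≥0 → Ω → ℝ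
  Θ_meas : ∀ t, Measurable (Θ t)
  Θ_cadlag : ∀ ω, IsCadlagPath (fun t => Θ t ω)
  Θ_eq : ∀ᵐ ω ∂P, ∀ t, Θ t ω = μ₁ * t + σ₁ * B t ω + J₁ t ω
  /- The Lévy-like part of the ordinate:
  `ξL t = x₀ + ∫₀ᵗ μ₂(Θ s) ds + ∫₀ᵗ σ₂(Θ s) dW s + ∫₀ᵗ ∫ x M̄₂(ds,dx)`. -/
  x₀ : ℝ
  μ₂ : ℝ → ℝ
  μ₂_meas : Measurable μ₂
  σ₂ : ℝ → ℝ
  σ₂_meas : Measurable σ₂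
  μ₂_int : ∀ᵐ ω ∂P, ∀ t : ℝ≥0,
    IntervalIntegrable (fun s : ℝ => μ₂ (Θ s.toNNReal ω)) volume 0 t
  σ₂_int : ∀ᵐ ω ∂P, ∀ t : ℝ≥0,
    IntervalIntegrable (fun s : ℝ => σ₂ (Θ s.toNNReal ω) ^ 2) volume 0 t
  W : ℝ≥0 → Ω → ℝ
  W_meas : ∀ t, Measurable (W t)
  W_brownian : IsBrownianReal W P
  W_indep : Indep (processSigma W) (processSigma Θ) P
  ν₂ : Measure ℝ
  levy₂ : IsLevyMeasure ν₂
  M₂ : Ω → Measure (ℝ × ℝ)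
  M₂_poisson : IsPoissonRandomMeasure P M₂ (volume.prod ν₂)
  M₂_indep : Indep (MeasurableSpace.comap M₂ inferInstance) (processSigma Θ ⊔ processSigma W) P
  I₂ : ℝ≥0 → Ω → ℝ
  I₂_spec : IsItoIntegral P (fun t => processSigmaUpTo Θ t ⊔ processSigmaUpTo W t) W
    (fun s ω => σ₂ (Θ s ω)) I₂
  J₂ : ℝ≥0 → Ω → ℝ
  J₂_spec : IsCompensatedJumpIntegral P M₂ ν₂ J₂
  ξL : ℝ≥0 → Ω → ℝ
  ξL_meas : ∀ t, Measurable (ξL t)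
  ξL_cadlag : ∀ ω, IsCadlagPath (fun t => ξL t ω)
  ξL_eq : ∀ᵐ ω ∂P, ∀ t : ℝ≥0,
    ξL t ω = x₀ + (∫ s in (0 : ℝ)..t, μ₂ (Θ s.toNNReal ω)) + I₂ t ω + J₂ t ω
  /- An enumeration `τ` of the jump times of `Θ` (`τ j = ∞` if there are too few), determined by
  the modulator up to null sets. -/
  τ : ℕ → Ω → ℝ≥0∞
  τ_meas : ∀ j, Measurable[processSigma Θ ⊔ nullSigma P] (τ j)
  τ_inj : ∀ᵐ ω ∂P, ∀ i j, τ i ω = τ j ω → τ i ω ≠ ∞ → i = j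
  τ_range : ∀ᵐ ω ∂P, ∀ s : ℝ≥0, jump (fun t => Θ t ω) s ≠ 0 ↔ ∃ j, τ j ω = s
  /- The triggered jumps: i.i.d. random functions `x ↦ U j · x`, independent of `(Θ, W, M₂)`.
  Each is a measurable process in `x` with respect to the σ-algebra that it generates. -/
  U : ℕ → Ω → ℝ → ℝ
  U_meas : ∀ j, Measurable (U j)
  U_jointly : ∀ j, Measurable[(MeasurableSpace.comap (U j) inferInstance).prod inferInstance]
    (fun p : Ω × ℝ => U j p.1 p.2)
  U_iIndep : iIndepFun U P
  U_ident : ∀ j, IdentDistrib (U j) (U 0) P P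
  U_indep : Indep (⨆ j, MeasurableSpace.comap (U j) inferInstance)
    (processSigma Θ ⊔ processSigma W ⊔ MeasurableSpace.comap M₂ inferInstance) P
  /- `ξf t = ∑ j, U j (ΔΘ at τ j) · 1_{τ j ≤ t}`, an absolutely convergent sum. -/
  ξf : ℝ≥0 → Ω → ℝ
  ξf_meas : ∀ t, Measurable (ξf t)
  ξf_cadlag : ∀ ω, IsCadlagPath (fun t => ξf t ω)
  ξf_eq : ∀ᵐ ω ∂P, ∀ t : ℝ≥0, HasSum
    (fun j => {j | τ j ω ≤ t}.indicator
      (fun j => U j ω (jump (fun s => Θ s ω) (τ j ω).toNNReal)) j) (ξf t ω)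

namespace ModulatedProcess

variable {P : Measure Ω} (X : ModulatedProcess P)

/-- The ordinate. -/
def ξ (t : ℝ≥0) (ω : Ω) : ℝ := X.ξL t ω + X.ξf t ω

/-- `𝒦_t = σ(Θ_s : s ≤ t)`. -/
def K (t : ℝ≥0) : MeasurableSpace Ω := processSigmaUpTo X.Θ t

/-- The augmented filtration `ℱ_t = σ(Θ_s, ξ_s : s ≤ t) ∨ 𝒩`. -/
def F (t : ℝ≥0) : MeasurableSpace Ω :=
  processSigmaUpTo X.Θ t ⊔ processSigmaUpTo X.ξ t ⊔ nullSigma P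

/-- `ℱ = ℱ_∞ = ⋁_t ℱ_t`. -/
def Finf : MeasurableSpace Ω := ⨆ t, X.F t

/-- The law `ℙ(U(x) ∈ dy)` of a triggered jump, given the jump size `x` of the modulator. -/
def jumpLaw (x : ℝ) : Measure ℝ := P.map (fun ω => X.U 0 ω x)

/-- `Θ̄_t = Θ_t - 𝔼[Θ_t]`. -/
def Θbar (t : ℝ≥0) (ω : Ω) : ℝ := X.Θ t ω - ∫ ω', X.Θ t ω' ∂P

/-- `ξ̄^L_t = ξ^L_t - 𝔼[ξ^L_t | 𝒦_t]`. -/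
def ξLbar (t : ℝ≥0) (ω : Ω) : ℝ := X.ξL t ω - condExp (X.K t) P (X.ξL t) ω

/-- `ξ̄^f_t = ξ^f_t - ∫₀ᵗ ∫ ∫ y ℙ(U(x) ∈ dy) ν₁(dx) ds`. -/
def ξfbar (t : ℝ≥0) (ω : Ω) : ℝ := X.ξf t ω - t * ∫ x, ∫ y, y ∂(X.jumpLaw x) ∂X.ν₁

/-- The standing moment assumptions. -/
structure MomentAssumptions : Prop where
  /-- Exponential moments of the two Lévy measures and of the triggered jumps. -/
  exponential : ∃ c : ℝ, 0 < c ∧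
    (∫⁻ x in {x : ℝ | 1 ≤ |x|}, ENNReal.ofReal (Real.exp (c * |x|)) ∂X.ν₁ < ∞) ∧
    (∫⁻ x in {x : ℝ | 1 ≤ |x|}, ENNReal.ofReal (Real.exp (c * |x|)) ∂X.ν₂ < ∞) ∧
    ∀ x : ℝ, ∫⁻ y in {y : ℝ | 1 ≤ |y|}, ENNReal.ofReal (Real.exp (c * |y|)) ∂(X.jumpLaw x) < ∞
  /-- `ξ^L_t` has moments of all orders. -/
  moments_ξL : ∀ (t : ℝ≥0) (k : ℕ), MemLp (X.ξL t) k P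
  /-- The compensators `∫ ∫ y ^ k ℙ(U(x) ∈ dy) ν₁(dx)` of the power jump processes of `ξ^f`
  are absolutely convergent. -/
  moments_ξf : ∀ k : ℕ, 1 ≤ k → ∫⁻ x, ∫⁻ y, ENNReal.ofReal (|y| ^ k) ∂(X.jumpLaw x) ∂X.ν₁ < ∞

/-- `σ(Θ̄_{s_1}, …, Θ̄_{s_m}, ξ̄^L_{s_1}, …, ξ̄^L_{s_m}, ξ̄^f_{s_1}, …, ξ̄^f_{s_m})`. -/
def marginalSigma {m : ℕ} (s : Fin m → ℝ≥0) : MeasurableSpace Ω :=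
  (⨆ i, MeasurableSpace.comap (X.Θbar (s i)) inferInstance) ⊔
  (⨆ i, MeasurableSpace.comap (X.ξLbar (s i)) inferInstance) ⊔
  (⨆ i, MeasurableSpace.comap (X.ξfbar (s i)) inferInstance)

/-- The family `𝒫` of the products of powers of the marginals at finitely many times. -/
def monomials : Set (Ω → ℝ) :=
  {Y | ∃ (m : ℕ) (t : Fin m → ℝ≥0) (g p b : Fin m → ℕ), StrictMono t ∧
    Y = fun ω => (∏ i, X.Θbar (t i) ω ^ g i) * (∏ i, X.ξLbar (t i) ω ^ p i) *
      ∏ i, X.ξfbar (t i) ω ^ b i}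

end ModulatedProcess

end LevyMAP

end

/-! Both density claims are proved by duality: a closed subspace of the square integrable functions
of a σ-algebra is everything once only 0 is orthogonal to it.

Claim (1). The conditional mean of ξ^L_s given 𝒦_s is a function of Θ and the other centrings are
constants, so the centred processes up to time t generate ℱ_t up to null sets. Finite intersections
of events, each depending on one centred process at one time, form a generating π-system. A function
orthogonal to all their indicators therefore vanishes.

Claim (2). Let Z be orthogonal to 𝒫. If a vector V had an exponential moment, moment determinacy
applied to the positive and negative parts of Z would make Z integrate to 0 over every event of σ(V)
(`setIntegral_preimage_eq_zero_of_moments`). Only Θ_t is known to have such a moment outright. The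
centred ξ^L is controlled only given the modulator, since σ₂(Θ) may be unbounded, and for ξ^f the
hypotheses give only power moments. Three steps get around this. (a) Determinacy in Θ alone upgrades
orthogonality to polynomials into orthogonality to polynomials times indicators of events of σ(Θ)
(`killed_one`). (b) With such indicators, increments of ξ^f over a deterministic grid can be
selected around the random time τ_j. As the mesh shrinks they converge to the single triggered jump
U_j(ΔΘ), so products with single triggered jumps are orthogonal to Z as well (`killed_mul_trigger`).
Dominated convergence rests on the moments of the total size of the triggered jumps
(`lintegral_totalTrigger_pow_lt_top`). (c) Θ, the centred ξ^L and the single triggered jumps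
generate ℱ up to null sets, and each has an exponential moment on events of σ(Θ) that exhaust Ω.
Determinacy applies on each such event, and the events increase (`setIntegral_gen_eq_zero`).

The exponential moments come from the exponential formula for Poisson random measures
(`IsCompensatedJumpIntegral.hasExpMoment`) and from the exponential martingale
(`IsItoIntegral.hasExpMoment`). That 𝒫 consists of ℱ-measurable variables needs ξ^f to be readable
from (Θ, ξ): M₂ is independent of Θ, hence ξ^L does not jump at the τ_j (`jump_ξL_tau`), and the
jump of ξ there is the triggered one. -/

noncomputable section

/-! ### Moment determinacy under exponential moments -/

namespace LevyMAP

/-- An exponential moment makes the complex moment generating function analytic on a vertical strip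
around 0, and its derivatives at 0 are the moments. The identity theorem propagates equality from 0
to the imaginary axis, where the function is the characteristic function. -/
theorem ext_of_moments_eq {μ ν : Measure ℝ} [IsFiniteMeasure μ] [IsFiniteMeasure ν] {c : ℝ}
    (hc : 0 < c) (hμ : Integrable (fun x => Real.exp (c * |x|)) μ)
    (hν : Integrable (fun x => Real.exp (c * |x|)) ν)
    (h : ∀ n : ℕ, ∫ x, x ^ n ∂μ = ∫ x, x ^ n ∂ν) : μ = ν := by
  have key : ∀ ρ : Measure ℝ, IsFiniteMeasure ρ → Integrable (fun x => Real.exp (c * |x|)) ρ →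
      Set.Ioo (-c) c ⊆ interior (integrableExpSet id ρ) := by
    intro ρ _ hρ
    refine interior_maximal ?_ isOpen_Ioo
    intro s hs
    refine Integrable.mono' hρ (by fun_prop) (Eventually.of_forall fun x => ?_)
    rw [Real.norm_eq_abs, abs_of_pos (Real.exp_pos _)]
    refine Real.exp_le_exp.2 ?_
    calc s * id x ≤ |s * x| := le_abs_self _
      _ = |s| * |x| := abs_mul _ _
      _ ≤ c * |x| := by gcongr; exact (abs_lt.2 hs).le
  have hm := key μ inferInstance hμ
  have hn := key ν inferInstance hν
  set S : Set ℂ := {z | z.re ∈ Set.Ioo (-c) c} with hS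
  have hSconv : Convex ℝ S := (convex_Ioo (-c) c).is_linear_preimage Complex.reLm.isLinear
  have h0 : (0 : ℂ) ∈ S := by simp [hS, hc]
  set f : ℂ → ℂ := complexMGF id μ - complexMGF id ν with hf
  have hfa : AnalyticOnNhd ℂ f S := fun z hz =>
    (analyticAt_complexMGF (hm hz)).sub (analyticAt_complexMGF (hn hz))
  have hder : ∀ n, iteratedDeriv n f 0 = 0 := by
    intro n
    have e1 : ∀ (ρ : Measure ℝ), (∫ x, (id x : ℂ) ^ n * Complex.exp (0 * (id x : ℂ)) ∂ρ)
        = ((∫ x, x ^ n ∂ρ : ℝ) : ℂ) := by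
      intro ρ
      rw [← integral_complex_ofReal]
      simp
    rw [hf, iteratedDeriv_sub (analyticAt_complexMGF (hm h0)).contDiffAt
      (analyticAt_complexMGF (hn h0)).contDiffAt, iteratedDeriv_complexMGF (hm h0),
      iteratedDeriv_complexMGF (hn h0)]
    simp only [id] at e1 ⊢
    rw [e1, e1, h n, sub_self]
  have hev : f =ᶠ[𝓝 0] 0 := by
    refine analyticOrderAt_eq_top.1 (ENat.eq_top_iff_forall_ge.2 ?_)
    intro n
    rw [natCast_le_analyticOrderAt_iff_iteratedDeriv_eq_zero (hfa 0 h0)]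
    exact fun i _ => hder i
  have hEq : Set.EqOn f 0 S := hfa.eqOn_of_preconnected_of_eventuallyEq
    (fun _ _ => analyticAt_const) hSconv.isPreconnected h0 hev
  refine Measure.ext_of_charFun (funext fun t => ?_)
  have := hEq (show (t * Complex.I : ℂ) ∈ S by simp [hS, hc])
  rw [← complexMGF_id_mul_I, ← complexMGF_id_mul_I]
  simpa [hf, sub_eq_zero] using this

section MultiD
variable {ι : Type*} [Fintype ι]

theorem prod_pow_le_exp {c : ℝ} (hc : 0 < c) (k : ι → ℕ) :
    ∃ C : ℝ, ∀ x : ι → ℝ, |∏ i, x i ^ k i| ≤ C * Real.exp (c * ∑ i, |x i|) := by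
  refine ⟨∏ i, ((k i).factorial / c ^ k i), fun x => ?_⟩
  rw [Finset.mul_sum, Real.exp_sum, Finset.abs_prod, ← Finset.prod_mul_distrib]
  refine Finset.prod_le_prod (fun _ _ => abs_nonneg _) fun i _ => ?_
  have := Real.pow_div_factorial_le_exp (c * |x i|) (by positivity) (k i)
  rw [abs_pow]
  rw [mul_pow, div_le_iff₀ (by positivity)] at this
  rw [div_mul_eq_mul_div, le_div_iff₀ (by positivity)]
  linarith

theorem integral_eval_eq_of_moments {μ ν : Measure (ι → ℝ)} {c : ℝ} (hc : 0 < c)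
    (hμ : Integrable (fun x => Real.exp (c * ∑ i, |x i|)) μ)
    (hν : Integrable (fun x => Real.exp (c * ∑ i, |x i|)) ν)
    (h : ∀ k : ι → ℕ, ∫ x, ∏ i, x i ^ k i ∂μ = ∫ x, ∏ i, x i ^ k i ∂ν) (q : MvPolynomial ι ℝ) :
    Integrable (fun x => MvPolynomial.eval x q) μ ∧ Integrable (fun x => MvPolynomial.eval x q) ν ∧
    ∫ x, MvPolynomial.eval x q ∂μ = ∫ x, MvPolynomial.eval x q ∂ν := by
  have hint : ∀ ρ : Measure (ι → ℝ), Integrable (fun x => Real.exp (c * ∑ i, |x i|)) ρ →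
      ∀ k : ι → ℕ, Integrable (fun x => ∏ i, x i ^ k i) ρ := by
    intro ρ hρ k
    obtain ⟨C, hC⟩ := prod_pow_le_exp hc k
    refine (hρ.const_mul C).mono' (Measurable.aestronglyMeasurable (by fun_prop)) (Eventually.of_forall hC)
  have hmon : ∀ (d : ι →₀ ℕ) (a : ℝ) (x : ι → ℝ),
      MvPolynomial.eval x (MvPolynomial.monomial d a) = a * ∏ i, x i ^ d i := by
    intro d a x
    rw [MvPolynomial.eval_monomial, Finsupp.prod_fintype _ _ (by simp)]
  induction q using MvPolynomial.induction_on' with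
  | monomial d a =>
    simp_rw [hmon]
    refine ⟨(hint μ hμ _).const_mul a, (hint ν hν _).const_mul a, ?_⟩
    rw [integral_const_mul, integral_const_mul, h]
  | add p q hp hq =>
    simp only [map_add]
    refine ⟨hp.1.add hq.1, hp.2.1.add hq.2.1, ?_⟩
    rw [integral_add hp.1 hq.1, integral_add hp.2.1 hq.2.1, hp.2.2, hq.2.2]

/-- Cramér–Wold reduction: the law of each linear functional has an exponential moment, and its
moments are polynomials in the mixed moments, so the one-dimensional case applies. -/
theorem ext_of_mixed_moments_eq {μ ν : Measure (ι → ℝ)} [IsFiniteMeasure μ] [IsFiniteMeasure ν]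
    {c : ℝ} (hc : 0 < c) (hμ : Integrable (fun x => Real.exp (c * ∑ i, |x i|)) μ)
    (hν : Integrable (fun x => Real.exp (c * ∑ i, |x i|)) ν)
    (h : ∀ k : ι → ℕ, ∫ x, ∏ i, x i ^ k i ∂μ = ∫ x, ∏ i, x i ^ k i ∂ν) : μ = ν := by
  classical
  refine Measure.ext_of_charFunDual (funext fun L => ?_)
  rw [charFunDual_eq_charFun_map_one, charFunDual_eq_charFun_map_one]
  congr 1
  obtain ⟨a, ha⟩ : ∃ a : ι → ℝ, ∀ x, L x = ∑ i, a i * x i := by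
    refine ⟨fun i => L (Pi.single i 1), fun x => ?_⟩
    conv_lhs => rw [pi_eq_sum_univ' x, map_sum]
    simp [mul_comm]
  obtain ⟨R, hR, haR⟩ : ∃ R : ℝ, 0 < R ∧ ∀ i, |a i| ≤ R := by
    -- The added 1 keeps `R` positive when the functional is zero.
    refine ⟨∑ i, |a i| + 1, by positivity, fun i => ?_⟩
    have := Finset.single_le_sum (f := fun i => |a i|) (fun _ _ => abs_nonneg _) (Finset.mem_univ i)
    linarith
  have hexp : ∀ ρ : Measure (ι → ℝ), Integrable (fun x => Real.exp (c * ∑ i, |x i|)) ρ →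
      Integrable (fun y => Real.exp (c / R * |y|)) (ρ.map L) := by
    intro ρ hρ
    rw [integrable_map_measure (by fun_prop) (by fun_prop)]
    refine hρ.mono' (by fun_prop) (Eventually.of_forall fun x => ?_)
    rw [Function.comp, Real.norm_eq_abs, abs_of_pos (Real.exp_pos _)]
    refine Real.exp_le_exp.2 ?_
    have : |L x| ≤ R * ∑ i, |x i| := by
      rw [ha, Finset.mul_sum]
      refine (Finset.abs_sum_le_sum_abs _ _).trans (Finset.sum_le_sum fun i _ => ?_)
      rw [abs_mul]
      gcongr
      exact haR i
    calc c / R * |L x| ≤ c / R * (R * ∑ i, |x i|) := by gcongr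
      _ = _ := by field_simp
  refine ext_of_moments_eq (div_pos hc hR) (hexp μ hμ) (hexp ν hν) fun n => ?_
  rw [integral_map (by fun_prop) (by fun_prop), integral_map (by fun_prop) (by fun_prop)]
  have := (integral_eval_eq_of_moments hc hμ hν h
    ((∑ i, MvPolynomial.C (a i) * MvPolynomial.X i) ^ n)).2.2
  simpa [ha] using this

/-- The images under V of the finite measures Y⁺Q and Y⁻Q have the same mixed moments, because Y is
orthogonal to all monomials in V. The weighted exponential bound makes both determinate, so they
agree, in particular on D. -/
theorem setIntegral_preimage_eq_zero_of_moments {Ω : Type*} [MeasurableSpace Ω] {Q : Measure Ω}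
    [IsFiniteMeasure Q] {Y : Ω → ℝ} (hYm : AEStronglyMeasurable Y Q) {V : ι → Ω → ℝ}
    (hV : ∀ i, Measurable (V i)) {c : ℝ} (hc : 0 < c)
    (hexp : Integrable (fun ω => |Y ω| * Real.exp (c * ∑ i, |V i ω|)) Q)
    (h : ∀ k : ι → ℕ, ∫ ω, Y ω * ∏ i, V i ω ^ k i ∂Q = 0) {D : Set (ι → ℝ)}
    (hD : MeasurableSet D) : ∫ ω in {ω | (fun i => V i ω) ∈ D}, Y ω ∂Q = 0 := by
  have hY : Integrable Y Q := by
    refine hexp.mono' hYm (Eventually.of_forall fun ω => ?_)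
    rw [Real.norm_eq_abs]
    exact le_mul_of_one_le_right (abs_nonneg _) (Real.one_le_exp (by positivity))
  have hVm : Measurable fun ω i => V i ω := measurable_pi_lambda _ hV
  have hfin : ∀ Y : Ω → ℝ, Integrable Y Q →
      IsFiniteMeasure (Q.withDensity fun ω => ENNReal.ofReal (Y ω)) := fun Y hY =>
    isFiniteMeasure_withDensity_ofReal hY.2
  have key : ∀ Y : Ω → ℝ, Integrable Y Q → ∀ g : (ι → ℝ) → ℝ, Measurable g →
      ∫ x, g x ∂((Q.withDensity fun ω => ENNReal.ofReal (Y ω)).map fun ω i => V i ω) =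
      ∫ ω, max (Y ω) 0 * g (fun i => V i ω) ∂Q := by
    intro Y hY g hg
    rw [integral_map hVm.aemeasurable hg.aestronglyMeasurable,
      integral_withDensity_eq_integral_toReal_smul₀ (by fun_prop) (by simp)]
    rfl
  have keyI : ∀ Z : Ω → ℝ, Integrable Z Q → (∀ ω, |Z ω| ≤ |Y ω|) →
      Integrable (fun x => Real.exp (c * ∑ i, |x i|))
      ((Q.withDensity fun ω => ENNReal.ofReal (Z ω)).map fun ω i => V i ω) := by
    intro Z hZ hZY
    rw [integrable_map_measure (Measurable.aestronglyMeasurable (by fun_prop)) hVm.aemeasurable,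
      integrable_withDensity_iff_integrable_smul₀' (by fun_prop) (by simp)]
    have hZm := hZ.aestronglyMeasurable.aemeasurable
    refine hexp.mono' (AEMeasurable.aestronglyMeasurable (by fun_prop)) (Eventually.of_forall fun ω => ?_)
    simp only [Function.comp, smul_eq_mul, norm_mul]
    rw [Real.norm_eq_abs, Real.norm_eq_abs, abs_of_pos (Real.exp_pos _),
      abs_of_nonneg ENNReal.toReal_nonneg, ENNReal.toReal_ofReal']
    gcongr
    exact max_le ((le_abs_self _).trans (hZY ω)) (abs_nonneg _)
  have := hfin Y hY
  have := hfin (fun ω => - Y ω) hY.neg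
  have hI : ∀ g : (ι → ℝ) → ℝ, Measurable g → Integrable (fun ω => Y ω * g (fun i => V i ω)) Q →
      (∫ x, g x ∂((Q.withDensity fun ω => ENNReal.ofReal (Y ω)).map fun ω i => V i ω)) -
      (∫ x, g x ∂((Q.withDensity fun ω => ENNReal.ofReal (- Y ω)).map fun ω i => V i ω)) =
      ∫ ω, Y ω * g (fun i => V i ω) ∂Q := by
    intro g hg hi
    rw [key Y hY g hg, key (fun ω => - Y ω) hY.neg g hg, ← integral_sub]
    · refine integral_congr_ae (Eventually.of_forall fun ω => ?_)
      dsimp only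
      rcases le_total 0 (Y ω) with h | h
      · rw [max_eq_left h, max_eq_right (by linarith)]; ring
      · rw [max_eq_right h, max_eq_left (by linarith)]; ring
    all_goals
      have hYm' := hYm.aemeasurable
      refine hi.mono (AEMeasurable.aestronglyMeasurable (by fun_prop)) (Eventually.of_forall fun ω => ?_)
      rw [norm_mul, norm_mul]
      gcongr
      rw [Real.norm_eq_abs, Real.norm_eq_abs, abs_of_nonneg (le_max_right _ _)]
    · exact max_le (le_abs_self _) (abs_nonneg _)
    · exact max_le (neg_le_abs _) (abs_nonneg _)
  have hmeas := ext_of_mixed_moments_eq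
    (μ := (Q.withDensity fun ω => ENNReal.ofReal (Y ω)).map fun ω i => V i ω)
    (ν := (Q.withDensity fun ω => ENNReal.ofReal (- Y ω)).map fun ω i => V i ω) hc
    (keyI Y hY fun _ => le_rfl) (keyI _ hY.neg fun _ => by simp) (fun k => by
      rw [← sub_eq_zero, hI (fun x => ∏ i, x i ^ k i) (by fun_prop), h]
      obtain ⟨C, hC⟩ := prod_pow_le_exp hc k
      have hYm' := hYm.aemeasurable
      refine (hexp.const_mul C).mono' (AEMeasurable.aestronglyMeasurable (by fun_prop))
        (Eventually.of_forall fun ω => ?_)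
      rw [norm_mul, Real.norm_eq_abs, Real.norm_eq_abs]
      calc _ ≤ |Y ω| * (C * Real.exp (c * ∑ i, |V i ω|)) := by
            gcongr; exact hC _
        _ = _ := by ring)
  have hVD : MeasurableSet {ω | (fun i => V i ω) ∈ D} := hVm hD
  have e : ∀ ω, Y ω * D.indicator (fun _ => (1 : ℝ)) (fun i => V i ω) =
      {ω | (fun i => V i ω) ∈ D}.indicator Y ω := by
    intro ω
    by_cases hω : (fun i => V i ω) ∈ D
    · simp [hω]
    · simp [hω]
  have h2 := hI (D.indicator fun _ => 1) (measurable_const.indicator hD) (by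
    simp_rw [e]; exact hY.indicator hVD)
  rw [hmeas, sub_self] at h2
  simp_rw [e] at h2
  rw [integral_indicator hVD] at h2
  exact h2.symm

end MultiD
end LevyMAP
end

noncomputable section

namespace LevyMAP

/-! ### Exponential moments -/

section Exp
variable {Ω : Type*} {mΩ : MeasurableSpace Ω} {Q : Measure Ω}

/-- Some exponential moment of `|V|` is finite. -/
def HasExpMoment (V : Ω → ℝ) (Q : Measure Ω) : Prop :=
  ∃ c : ℝ, 0 < c ∧ Integrable (fun ω => Real.exp (c * |V ω|)) Q

theorem integrable_exp_of_le {V : Ω → ℝ} (hV : AEMeasurable V Q) {c d : ℝ} (hcd : c ≤ d)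
    (h : Integrable (fun ω => Real.exp (d * |V ω|)) Q) :
    Integrable (fun ω => Real.exp (c * |V ω|)) Q := by
  refine h.mono' (AEMeasurable.aestronglyMeasurable (by fun_prop)) (Eventually.of_forall fun ω => ?_)
  rw [Real.norm_eq_abs, abs_of_pos (Real.exp_pos _)]
  gcongr

theorem HasExpMoment.mono {V V' : Ω → ℝ} (h : HasExpMoment V' Q) (hV : AEMeasurable V Q)
    (hle : ∀ᵐ ω ∂Q, |V ω| ≤ |V' ω|) : HasExpMoment V Q := by
  obtain ⟨c, hc, h⟩ := h
  refine ⟨c, hc, h.mono' (AEMeasurable.aestronglyMeasurable (by fun_prop)) ?_⟩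
  filter_upwards [hle] with ω hω
  rw [Real.norm_eq_abs, abs_of_pos (Real.exp_pos _)]
  gcongr

theorem HasExpMoment.mono_measure {V : Ω → ℝ} {Q' : Measure Ω} (h : HasExpMoment V Q)
    (hQ : Q' ≤ Q) : HasExpMoment V Q' := by
  obtain ⟨c, hc, h⟩ := h
  exact ⟨c, hc, h.mono_measure hQ⟩

theorem HasExpMoment.add {V V' : Ω → ℝ} (h : HasExpMoment V Q) (h' : HasExpMoment V' Q)
    (hV : AEMeasurable V Q) (hV' : AEMeasurable V' Q) :
    HasExpMoment (fun ω => V ω + V' ω) Q := by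
  obtain ⟨c, hc, h⟩ := h
  obtain ⟨d, hd, h'⟩ := h'
  -- Half of the smaller rate suffices: |V + V'| is at most twice the larger of |V| and |V'|, so the
  -- exponential is bounded by one of the two given ones.
  refine ⟨min c d / 2, by positivity, ((integrable_exp_of_le hV (min_le_left c d) h).add
    (integrable_exp_of_le hV' (min_le_right c d) h')).mono'
    (AEMeasurable.aestronglyMeasurable (by fun_prop)) (Eventually.of_forall fun ω => ?_)⟩
  rw [Real.norm_eq_abs, abs_of_pos (Real.exp_pos _)]
  have hm : 0 < min c d := lt_min hc hd
  rcases le_total |V ω| |V' ω| with hle | hle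
  · refine le_add_of_nonneg_of_le (Real.exp_pos _).le (Real.exp_le_exp.2 ?_)
    have := abs_add_le (V ω) (V' ω)
    nlinarith
  · refine le_add_of_le_of_nonneg (Real.exp_le_exp.2 ?_) (Real.exp_pos _).le
    have := abs_add_le (V ω) (V' ω)
    nlinarith

theorem hasExpMoment_const [IsFiniteMeasure Q] (a : ℝ) : HasExpMoment (fun _ : Ω => a) Q :=
  ⟨1, one_pos, integrable_const _⟩

theorem hasExpMoment_sum [IsFiniteMeasure Q] {ι : Type*} (s : Finset ι) {V : ι → Ω → ℝ}
    (hV : ∀ i, Measurable (V i)) (h : ∀ i ∈ s, HasExpMoment (V i) Q) :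
    HasExpMoment (fun ω => ∑ i ∈ s, |V i ω|) Q := by
  classical
  induction s using Finset.induction_on with
  | empty => simpa using hasExpMoment_const (Q := Q) 0
  | insert i s hi ih =>
    simp_rw [Finset.sum_insert hi]
    refine HasExpMoment.add ?_ (ih fun j hj => h j (Finset.mem_insert_of_mem hj)) (by fun_prop)
      (by fun_prop)
    refine (h i (Finset.mem_insert_self _ _)).mono (by fun_prop) ?_
    simp

/-- Exponential moments from two one-sided bounds. -/
theorem hasExpMoment_of_lintegral {V : Ω → ℝ} (hV : AEMeasurable V Q) {c : ℝ} (hc : 0 < c)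
    (h1 : ∫⁻ ω, ENNReal.ofReal (Real.exp (c * V ω)) ∂Q < ∞)
    (h2 : ∫⁻ ω, ENNReal.ofReal (Real.exp (-c * V ω)) ∂Q < ∞) : HasExpMoment V Q := by
  have hi : ∀ a : ℝ, ∫⁻ ω, ENNReal.ofReal (Real.exp (a * V ω)) ∂Q < ∞ →
      Integrable (fun ω => Real.exp (a * V ω)) Q := by
    intro a ha
    refine ⟨AEMeasurable.aestronglyMeasurable (by fun_prop), ?_⟩
    rw [hasFiniteIntegral_iff_ofReal (Eventually.of_forall fun _ => (Real.exp_pos _).le)]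
    exact ha
  refine ⟨c, hc, ((hi c h1).add (hi (-c) h2)).mono'
    (AEMeasurable.aestronglyMeasurable (by fun_prop)) (Eventually.of_forall fun ω => ?_)⟩
  rw [Real.norm_eq_abs, abs_of_pos (Real.exp_pos _)]
  rcases abs_cases (V ω) with ⟨h, _⟩ | ⟨h, _⟩ <;> rw [h]
  · exact le_add_of_nonneg_right (Real.exp_pos _).le
  · refine le_add_of_nonneg_of_le (Real.exp_pos _).le (Real.exp_le_exp.2 ?_)
    linarith

theorem HasExpMoment.memLp [IsFiniteMeasure Q] {V : Ω → ℝ} (h : HasExpMoment V Q)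
    (hV : AEMeasurable V Q) (k : ℕ) : MemLp V k Q := by
  obtain ⟨c, hc, h⟩ := h
  rcases Nat.eq_zero_or_pos k with rfl | hk
  · simpa [memLp_zero_iff_aestronglyMeasurable] using hV.aestronglyMeasurable
  rw [← integrable_norm_rpow_iff hV.aestronglyMeasurable (by simp [hk.ne']) (by simp)]
  refine (h.const_mul (k.factorial / c ^ k)).mono' (AEMeasurable.aestronglyMeasurable (by fun_prop))
    (Eventually.of_forall fun ω => ?_)
  have := Real.pow_div_factorial_le_exp (c * |V ω|) (by positivity) k
  simp only [ENNReal.toReal_natCast, Real.rpow_natCast, Real.norm_eq_abs, abs_pow, abs_abs]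
  rw [mul_pow, div_le_iff₀ (by positivity)] at this
  rw [div_mul_eq_mul_div, le_div_iff₀ (by positivity)]
  linarith

/-- With e = exp(c|V|/4), two uses of Young's inequality give |ZG|e ≤ Z² + G⁴ + e⁴. This dictates
the exponents 2 and 4 and the quarter of the rate. -/
theorem integrable_mul_exp [IsFiniteMeasure Q] {Z G V : Ω → ℝ} (hZ : MemLp Z 2 Q)
    (hG : MemLp G 4 Q) (hVm : AEMeasurable V Q) (hV : HasExpMoment V Q) :
    ∃ c : ℝ, 0 < c ∧ Integrable (fun ω => |Z ω * G ω| * Real.exp (c * |V ω|)) Q := by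
  obtain ⟨c, hc, h⟩ := hV
  have hZi : Integrable (fun ω => Z ω ^ 2) Q := hZ.integrable_sq
  have hGi : Integrable (fun ω => ‖G ω‖ ^ 4) Q := by
    have := hG.integrable_norm_pow (p := 4) (by norm_num)
    simpa using this
  refine ⟨c / 4, by positivity, ((hZi.add hGi).add h).mono' ?_ (Eventually.of_forall fun ω => ?_)⟩
  · have := hZ.1.aemeasurable
    have := hG.1.aemeasurable
    exact AEMeasurable.aestronglyMeasurable (by fun_prop)
  · rw [norm_mul, Real.norm_eq_abs, Real.norm_eq_abs, abs_abs, abs_of_pos (Real.exp_pos _), abs_mul]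
    set e := Real.exp (c / 4 * |V ω|) with he
    have he4 : Real.exp (c * |V ω|) = e ^ 4 := by
      rw [he, ← Real.exp_nat_mul]; congr 1; push_cast; ring
    simp only [Pi.add_apply]
    rw [he4, Real.norm_eq_abs, ← sq_abs (Z ω)]
    have h1 : 0 ≤ |Z ω| := abs_nonneg _
    nlinarith [sq_nonneg (|Z ω| - |G ω| * e), sq_nonneg (|G ω| ^ 2 - e ^ 2), sq_nonneg (|G ω| ^ 2),
      sq_nonneg (e ^ 2), sq_nonneg (|Z ω|)]

end Exp

/-! ### Orthogonality to polynomials of processes -/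

section Orth
variable {Ω : Type*} {mΩ : MeasurableSpace Ω} {Q : Measure Ω} {ι : Type*}

theorem setIntegral_biInter_eq_zero_of_moments [IsFiniteMeasure Q] {Z G : Ω → ℝ}
    (hZ : MemLp Z 2 Q) (hG : MemLp G 4 Q) {V : ι → Ω → ℝ} (hV : ∀ i, Measurable (V i))
    (s : Finset ι) (hexp : ∀ i ∈ s, HasExpMoment (V i) Q)
    (h : ∀ k : ι → ℕ, ∫ ω, Z ω * G ω * ∏ i ∈ s, V i ω ^ k i ∂Q = 0) {D : ι → Set ℝ}
    (hD : ∀ i ∈ s, MeasurableSet (D i)) : ∫ ω in ⋂ i ∈ s, V i ⁻¹' D i, Z ω * G ω ∂Q = 0 := by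
  classical
  have hsum := hasExpMoment_sum s hV hexp
  obtain ⟨c, hc, hi⟩ := integrable_mul_exp hZ hG (by fun_prop) hsum
  have h1 := setIntegral_preimage_eq_zero_of_moments (ι := s) (Q := Q) (Y := fun ω => Z ω * G ω)
    (V := fun i => V i) (hZ.1.mul hG.1) (fun i => hV i) hc (by
      convert hi using 4 with ω
      rw [Finset.sum_coe_sort s (fun i => |V i ω|), abs_of_nonneg]
      exact Finset.sum_nonneg fun _ _ => abs_nonneg _) (fun k => by
      convert h (fun i => if hi : i ∈ s then k ⟨i, hi⟩ else 0) using 4 with ω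
      rw [← Finset.prod_coe_sort s]
      simp)
    (D := Set.univ.pi fun i => D i) (MeasurableSet.univ_pi fun i => hD i i.2)
  convert h1 using 3
  ext ω
  simp

/-- The sets with vanishing integral form a Dynkin system, so it is enough to test finite
intersections, which form a π-system generating the supremum. -/
theorem setIntegral_eq_zero_of_iSup {Y : Ω → ℝ} (hY : Integrable Y Q) (m : ι → MeasurableSpace Ω)
    (hm : ∀ i, m i ≤ mΩ)
    (h : ∀ (s : Finset ι) (f : ι → Set Ω), (∀ i ∈ s, MeasurableSet[m i] (f i)) →
      ∫ ω in ⋂ i ∈ s, f i, Y ω ∂Q = 0) {D : Set Ω} (hD : MeasurableSet[⨆ i, m i] D) :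
    ∫ ω in D, Y ω ∂Q = 0 := by
  have hle : (⨆ i, m i) ≤ mΩ := iSup_le hm
  have huniv : ∫ ω, Y ω ∂Q = 0 := by simpa using h ∅ (fun _ => Set.univ) (by simp)
  have hgen : (⨆ i, m i) =
      MeasurableSpace.generateFrom (piiUnionInter (fun n => {s | MeasurableSet[m n] s}) Set.univ) := by
    simpa using (generateFrom_piiUnionInter_measurableSet m Set.univ).symm
  refine MeasurableSpace.induction_on_inter (m := ⨆ i, m i)
    (C := fun D _ => ∫ ω in D, Y ω ∂Q = 0) hgen
    (isPiSystem_piiUnionInter _ (fun i => @MeasurableSpace.isPiSystem_measurableSet Ω (m i)) _)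
    (by simp) ?_ ?_ ?_ D hD
  · rintro t ⟨s, -, f, hf, rfl⟩
    exact h s f hf
  · intro t ht ih
    have := setIntegral_compl (hle _ ht) hY
    rw [this, ih, huniv, sub_zero]
  · intro f hd hf ih
    rw [integral_iUnion (fun i => hle _ (hf i)) hd hY.integrableOn]
    simp [ih]

end Orth

/-! ### Null sets -/

section Null
variable {Ω : Type*} {m : MeasurableSpace Ω} {mΩ : MeasurableSpace Ω} {P : Measure Ω}

/-- The sets that agree almost everywhere with a set of `m` already form a σ-algebra, and it
contains both `m` and the null sets. -/
theorem sup_nullSigma_le_eventually :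
    m ⊔ nullSigma P ≤ eventuallyMeasurableSpace m (ae P) := by
  refine sup_le le_eventuallyMeasurableSpace (MeasurableSpace.generateFrom_le fun A hA => ?_)
  exact ⟨∅, @MeasurableSet.empty Ω m, ae_eq_empty.2 hA.2⟩

theorem exists_measurable_ae_eq_ennreal {f : Ω → ℝ≥0∞}
    (hf : Measurable[eventuallyMeasurableSpace m (ae P)] f) : ∃ g, Measurable[m] g ∧ f =ᵐ[P] g := by
  refine @Measurable.ennreal_induction Ω (eventuallyMeasurableSpace m (ae P))
    (fun f => ∃ g, Measurable[m] g ∧ f =ᵐ[P] g) ?_ ?_ ?_ f hf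
  · rintro c s ⟨t, ht, hst⟩
    exact ⟨t.indicator fun _ => c, measurable_const.indicator ht,
      indicator_ae_eq_of_ae_eq_set hst⟩
  · rintro f g - - - ⟨f', hf', hff'⟩ ⟨g', hg', hgg'⟩
    exact ⟨f' + g', hf'.add hg', hff'.add hgg'⟩
  · rintro f - - ih
    choose g hg hfg using ih
    refine ⟨fun ω => ⨆ n, g n ω, Measurable.iSup hg, ?_⟩
    filter_upwards [ae_all_iff.2 hfg] with ω hω
    simp [hω]

theorem exists_measurable_ae_eq_real {f : Ω → ℝ}
    (hf : Measurable[eventuallyMeasurableSpace m (ae P)] f) : ∃ g, Measurable[m] g ∧ f =ᵐ[P] g := by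
  obtain ⟨g₁, h₁, e₁⟩ := exists_measurable_ae_eq_ennreal (P := P) (m := m)
    (f := fun ω => ENNReal.ofReal (f ω)) (ENNReal.measurable_ofReal.comp hf)
  obtain ⟨g₂, h₂, e₂⟩ := exists_measurable_ae_eq_ennreal (P := P) (m := m)
    (f := fun ω => ENNReal.ofReal (-f ω)) (ENNReal.measurable_ofReal.comp hf.neg)
  refine ⟨fun ω => (g₁ ω).toReal - (g₂ ω).toReal, h₁.ennreal_toReal.sub h₂.ennreal_toReal, ?_⟩
  filter_upwards [e₁, e₂] with ω h1 h2
  rw [← h1, ← h2, ENNReal.toReal_ofReal', ENNReal.toReal_ofReal']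
  rcases le_total 0 (f ω) with h | h
  · rw [max_eq_left h, max_eq_right (by linarith)]; ring
  · rw [max_eq_right h, max_eq_left (by linarith)]; ring

theorem measurable_eventually_of_ae_eq {f g : Ω → ℝ}
    (hg : Measurable[m] g) (hfg : f =ᵐ[P] g) :
    Measurable[eventuallyMeasurableSpace m (ae P)] f :=
  hg.eventuallyMeasurable_of_eventuallyEq hfg

end Null

/-! ### Independence -/

section Indep
variable {Ω : Type*} {mΩ : MeasurableSpace Ω} {P : Measure Ω} [IsProbabilityMeasure P]

theorem lintegral_of_indepFun {α β : Type*} [MeasurableSpace α] [MeasurableSpace β] {f : Ω → α}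
    {g : Ω → β} (hf : Measurable f) (hg : Measurable g) (h : IndepFun f g P) {F : α × β → ℝ≥0∞}
    (hF : Measurable F) : ∫⁻ ω, F (f ω, g ω) ∂P = ∫⁻ ω', ∫⁻ ω, F (f ω, g ω') ∂P ∂P := by
  have h1 := (indepFun_iff_map_prod_eq_prod_map_map hf.aemeasurable hg.aemeasurable).1 h
  have : IsProbabilityMeasure (P.map f) := Measure.isProbabilityMeasure_map hf.aemeasurable
  have : IsProbabilityMeasure (P.map g) := Measure.isProbabilityMeasure_map hg.aemeasurable
  rw [← lintegral_map (f := F) hF (hf.prodMk hg), h1, lintegral_prod_symm _ hF.aemeasurable,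
    lintegral_map (by fun_prop) hg]
  refine lintegral_congr fun ω' => ?_
  rw [lintegral_map (by fun_prop) hf]

/-- The identity of Ω, viewed as a map into (Ω, m₁) and into (Ω, m₂), yields two independent random
elements. This permits freezing everything in m₂ while integrating over m₁, without naming the
variables involved. -/
theorem lintegral_diag_of_indep {m₁ m₂ : MeasurableSpace Ω} (h₁ : m₁ ≤ mΩ) (h₂ : m₂ ≤ mΩ)
    (h : Indep m₁ m₂ P) {F : Ω × Ω → ℝ≥0∞} (hF : Measurable[m₁.prod m₂] F) :
    ∫⁻ ω, F (ω, ω) ∂P = ∫⁻ ω', ∫⁻ ω, F (ω, ω') ∂P ∂P := by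
  refine @lintegral_of_indepFun Ω mΩ P _ Ω Ω m₁ m₂ id id (measurable_id'' h₁) (measurable_id'' h₂)
    ?_ F hF
  rw [@IndepFun_iff_Indep Ω Ω Ω mΩ m₁ m₂ id id P]
  simpa using h

end Indep

end LevyMAP
end

noncomputable section

namespace LevyMAP

/-! ### Càdlàg paths and time grids -/

/-- The least multiple of `1 / (n + 1)` that is at least `t`. -/
def gridUp (n : ℕ) (t : ℝ≥0) : ℝ≥0 := ⌈t * (n + 1)⌉₊ / (n + 1)

/-- The multiple of `1 / (n + 1)` preceding `gridUp n t`. -/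
def gridDown (n : ℕ) (t : ℝ≥0) : ℝ≥0 := (⌈t * (n + 1)⌉₊ - 1 : ℕ) / (n + 1)

theorem le_gridUp (n : ℕ) (t : ℝ≥0) : t ≤ gridUp n t := by
  rw [gridUp, le_div_iff₀ (by positivity)]
  exact Nat.le_ceil _

theorem gridUp_le (n : ℕ) (t : ℝ≥0) : gridUp n t ≤ t + 1 / (n + 1) := by
  rw [gridUp, div_le_iff₀ (by positivity), add_mul, one_div, inv_mul_cancel₀ (by positivity)]
  exact (Nat.ceil_lt_add_one zero_le).le

/-- Integers belong to every grid, so rounding up never leaves [0, T] for an integer horizon. A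
bound valid up to T then covers the approximating increments. -/
theorem gridUp_le_natCast (n : ℕ) {t : ℝ≥0} {T : ℕ} (h : t ≤ T) : gridUp n t ≤ T := by
  rw [gridUp, div_le_iff₀ (by positivity)]
  have : ⌈t * ((n : ℝ≥0) + 1)⌉₊ ≤ T * (n + 1) := by
    rw [Nat.ceil_le]; push_cast; gcongr
  exact_mod_cast this

theorem gridDown_lt (n : ℕ) {t : ℝ≥0} (ht : 0 < t) : gridDown n t < t := by
  rw [gridDown, div_lt_iff₀ (by positivity)]
  have hpos : 0 < t * ((n : ℝ≥0) + 1) := by positivity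
  exact Nat.lt_ceil.1 (Nat.sub_lt (Nat.ceil_pos.2 hpos) one_pos)

theorem le_gridDown_add (n : ℕ) (t : ℝ≥0) : t ≤ gridDown n t + 1 / (n + 1) := by
  rw [gridDown, ← add_div, le_div_iff₀ (by positivity)]
  refine (Nat.le_ceil _).trans ?_
  have : ⌈t * ((n : ℝ≥0) + 1)⌉₊ ≤ (⌈t * ((n : ℝ≥0) + 1)⌉₊ - 1) + 1 := by omega
  exact_mod_cast this

theorem gridDown_zero (n : ℕ) : gridDown n 0 = 0 := by simp [gridDown]

theorem gridDown_le (n : ℕ) (t : ℝ≥0) : gridDown n t ≤ t := by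
  rcases eq_or_ne t 0 with rfl | h
  · simp [gridDown_zero]
  · exact (gridDown_lt n (pos_iff_ne_zero.2 h)).le

theorem tendsto_one_div_nnreal : Tendsto (fun n : ℕ => 1 / ((n : ℝ≥0) + 1)) atTop (𝓝 0) :=
  tendsto_one_div_add_atTop_nhds_zero_nat

theorem tendsto_gridUp (t : ℝ≥0) : Tendsto (fun n => gridUp n t) atTop (𝓝 t) := by
  refine tendsto_of_tendsto_of_tendsto_of_le_of_le tendsto_const_nhds ?_ (fun n => le_gridUp n t)
    (fun n => gridUp_le n t)
  simpa using tendsto_const_nhds.add tendsto_one_div_nnreal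

theorem tendsto_gridDown (t : ℝ≥0) : Tendsto (fun n => gridDown n t) atTop (𝓝 t) := by
  have h : Tendsto (fun n : ℕ => t - 1 / ((n : ℝ≥0) + 1)) atTop (𝓝 t) := by
    simpa using tendsto_const_nhds.sub tendsto_one_div_nnreal
  exact tendsto_of_tendsto_of_tendsto_of_le_of_le h tendsto_const_nhds
    (fun n => tsub_le_iff_right.2 (le_gridDown_add n t)) (fun n => gridDown_le n t)

theorem tendsto_gridUp_within (t : ℝ≥0) : Tendsto (fun n => gridUp n t) atTop (𝓝[≥] t) :=
  tendsto_nhdsWithin_iff.2 ⟨tendsto_gridUp t, Eventually.of_forall fun n => le_gridUp n t⟩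

theorem tendsto_gridDown_within {t : ℝ≥0} (ht : 0 < t) :
    Tendsto (fun n => gridDown n t) atTop (𝓝[<] t) :=
  tendsto_nhdsWithin_iff.2 ⟨tendsto_gridDown t, Eventually.of_forall fun n => gridDown_lt n ht⟩

theorem nhdsLT_zero_nnreal : 𝓝[<] (0 : ℝ≥0) = ⊥ := by
  rw [show Set.Iio (0 : ℝ≥0) = ∅ from Set.Iio_bot]; simp

theorem jump_zero (f : ℝ≥0 → ℝ) : jump f 0 = 0 := by
  rw [jump, leftLim_eq_of_eq_bot f nhdsLT_zero_nnreal, sub_self]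

theorem nhdsLT_neBot {t : ℝ≥0} (ht : 0 < t) : (𝓝[<] t).NeBot := nhdsLT_neBot_of_exists_lt ⟨0, ht⟩

theorem IsCadlagPath.tendsto_sub {f : ℝ≥0 → ℝ} (hf : IsCadlagPath f) (t : ℝ≥0) :
    Tendsto (fun s => f t - f s) (𝓝[<] t) (𝓝 (jump f t)) := by
  obtain ⟨l, hl⟩ := (hf t).2
  exact tendsto_const_nhds.sub (tendsto_leftLim_of_tendsto ⟨l, hl⟩)

/-- The two grid points approach t from the right (weakly) and strictly from the left. At t = 0 the
truncated subtraction puts the lower grid point at 0, in agreement with the convention that there is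
no jump at 0. -/
theorem IsCadlagPath.tendsto_grid {f : ℝ≥0 → ℝ} (hf : IsCadlagPath f) (t : ℝ≥0) :
    Tendsto (fun n => f (gridUp n t) - f (gridDown n t)) atTop (𝓝 (jump f t)) := by
  have h1 : Tendsto (fun n => f (gridUp n t)) atTop (𝓝 (f t)) :=
    (hf t).1.tendsto.comp (tendsto_gridUp_within t)
  rcases eq_or_ne t 0 with rfl | h
  · simp_rw [gridDown_zero, jump_zero]
    simpa using h1.sub_const (f 0)
  · have h2 := (hf.tendsto_sub t).comp (tendsto_gridDown_within (pos_iff_ne_zero.2 h))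
    have := (h1.sub_const (f t)).add h2
    simpa using this

section Meas
variable {Ω : Type*} {m : MeasurableSpace Ω}

/-- A process read at a grid time only uses countably many deterministic times, so joint
measurability reduces to that of each marginal. -/
theorem measurable_grid_comp (d : ℕ → ℝ≥0) (n : ℕ) {X : ℝ≥0 → Ω → ℝ}
    (hX : ∀ t, Measurable (X t)) :
    Measurable fun p : ℝ≥0 × Ω => X (d ⌈p.1 * (n + 1)⌉₊) p.2 := by
  have h1 : Measurable fun p : ℕ × Ω => X (d p.1) p.2 :=
    measurable_from_prod_countable_right fun k => hX (d k)
  have h2 : Measurable fun p : ℝ≥0 × Ω => (⌈p.1 * ((n : ℝ≥0) + 1)⌉₊, p.2) :=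
    (Nat.measurable_ceil.comp (by fun_prop)).prodMk measurable_snd
  exact h1.comp h2

theorem measurable_gridUp {X : ℝ≥0 → Ω → ℝ} (hX : ∀ t, Measurable (X t)) (n : ℕ) :
    Measurable fun p : ℝ≥0 × Ω => X (gridUp n p.1) p.2 :=
  measurable_grid_comp (fun k => k / (n + 1)) n hX

theorem measurable_gridDown {X : ℝ≥0 → Ω → ℝ} (hX : ∀ t, Measurable (X t)) (n : ℕ) :
    Measurable fun p : ℝ≥0 × Ω => X (gridDown n p.1) p.2 :=
  measurable_grid_comp (fun k => (k - 1 : ℕ) / (n + 1)) n hX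

theorem measurable_uncurry_of_cadlag {X : ℝ≥0 → Ω → ℝ} (hX : ∀ t, Measurable (X t))
    (hc : ∀ ω, IsCadlagPath (fun t => X t ω)) : Measurable fun p : ℝ≥0 × Ω => X p.1 p.2 := by
  refine measurable_of_tendsto_metrizable (fun n => measurable_gridUp hX n)
    (tendsto_pi_nhds.2 fun p => ?_)
  exact (hc p.2 p.1).1.tendsto.comp (tendsto_gridUp_within p.1)

theorem measurable_jump_of_cadlag {X : ℝ≥0 → Ω → ℝ} (hX : ∀ t, Measurable (X t))
    (hc : ∀ ω, IsCadlagPath (fun t => X t ω)) :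
    Measurable fun p : ℝ≥0 × Ω => jump (fun t => X t p.2) p.1 :=
  measurable_of_tendsto_metrizable
    (fun n => (measurable_gridUp hX n).sub (measurable_gridDown hX n))
    (tendsto_pi_nhds.2 fun p => (hc p.2).tendsto_grid p.1)

end Meas

/-! ### Convergence uniformly on compacts in probability -/

section UCP
variable {Ω : Type*} {mΩ : MeasurableSpace Ω} {P : Measure Ω}

/-- Borel–Cantelli: along the subsequence, the horizon is k while tolerance and failure probability
are both 2⁻ᵏ. -/
theorem TendstoUCP.exists_seq_tendstoUniformlyOn {Xn : ℕ → ℝ≥0 → Ω → ℝ} {X : ℝ≥0 → Ω → ℝ}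
    (h : TendstoUCP P Xn X) : ∃ ns : ℕ → ℕ, StrictMono ns ∧ ∀ᵐ ω ∂P, ∀ T : ℝ≥0,
      TendstoUniformlyOn (fun k t => Xn (ns k) t ω) (fun t => X t ω) atTop (Set.Iic T) := by
  have hev : ∀ k : ℕ, ∀ᶠ n in atTop,
      P {ω | ∃ t ≤ (k : ℝ≥0), (1 / 2 : ℝ) ^ k ≤ |Xn n t ω - X t ω|} ≤ (1 / 2 : ℝ≥0∞) ^ k := by
    intro k
    refine (h k ((1 / 2) ^ k) (by positivity)).eventually_le_const ?_
    exact ENNReal.pow_pos (by simp) _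
  obtain ⟨ns, hns, hP⟩ := extraction_forall_of_eventually hev
  refine ⟨ns, hns, ?_⟩
  have hsum : ∑' k : ℕ, P {ω | ∃ t ≤ (k : ℝ≥0), (1 / 2 : ℝ) ^ k ≤ |Xn (ns k) t ω - X t ω|} ≠ ∞ := by
    refine ne_top_of_le_ne_top ?_ (ENNReal.tsum_le_tsum hP)
    rw [ENNReal.tsum_geometric]
    norm_num
  have hae := ae_eventually_notMem hsum
  filter_upwards [hae] with ω hω T
  rw [Metric.tendstoUniformlyOn_iff]
  intro ε hε
  obtain ⟨K, hK⟩ := exists_nat_ge T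
  have hlim : ∀ᶠ k : ℕ in atTop, (1 / 2 : ℝ) ^ k < ε :=
    (tendsto_pow_atTop_nhds_zero_of_lt_one (by norm_num) (by norm_num)).eventually_lt_const hε
  filter_upwards [hω, hlim, eventually_ge_atTop K] with k h1 h2 h3 t ht
  simp only [not_exists, not_and, not_le] at h1
  have htk : t ≤ (k : ℝ≥0) := (Set.mem_Iic.1 ht).trans (hK.trans (by exact_mod_cast h3))
  rw [Real.dist_eq, abs_sub_comm]
  exact (h1 t htk).trans h2

theorem tendsto_of_tendstoUniformlyOn_Iic {f : ℕ → ℝ≥0 → ℝ} {g : ℝ≥0 → ℝ}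
    (h : ∀ T, TendstoUniformlyOn f g atTop (Set.Iic T)) (t : ℝ≥0) :
    Tendsto (fun n => f n t) atTop (𝓝 (g t)) :=
  (h t).tendsto_at (Set.mem_Iic.2 le_rfl)

theorem continuous_of_tendstoUniformlyOn_Iic {f : ℕ → ℝ≥0 → ℝ} {g : ℝ≥0 → ℝ}
    (hf : ∀ n, Continuous (f n)) (h : ∀ T, TendstoUniformlyOn f g atTop (Set.Iic T)) :
    Continuous g := by
  have : TendstoLocallyUniformly f g atTop :=
    tendstoLocallyUniformly_iff_forall_isCompact.2 fun K hK => by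
      obtain ⟨T, hT⟩ := hK.bddAbove
      exact (h T).mono fun t ht => hT ht
  exact this.continuous (Frequently.of_forall hf)

/-- Jumps of a locally uniform limit are limits of the jumps. -/
theorem tendsto_jump_of_tendstoUniformlyOn {f : ℕ → ℝ≥0 → ℝ} {g : ℝ≥0 → ℝ} {t : ℝ≥0} (ht : 0 < t)
    (h : TendstoUniformlyOn f g atTop (Set.Iic t)) {d : ℕ → ℝ} {e : ℝ}
    (hd : ∀ n, Tendsto (fun s => f n t - f n s) (𝓝[<] t) (𝓝 (d n)))
    (he : Tendsto (fun s => g t - g s) (𝓝[<] t) (𝓝 e)) : Tendsto d atTop (𝓝 e) := by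
  have := nhdsLT_neBot ht
  rw [Metric.tendsto_atTop]
  intro ε hε
  rw [Metric.tendstoUniformlyOn_iff] at h
  obtain ⟨N, hN⟩ := eventually_atTop.1 (h (ε / 4) (by positivity))
  refine ⟨N, fun n hn => ?_⟩
  have h1 : Tendsto (fun s => dist (f n t - f n s) (g t - g s)) (𝓝[<] t) (𝓝 (dist (d n) e)) :=
    (hd n).dist he
  have h2 : ∀ᶠ s in 𝓝[<] t, dist (f n t - f n s) (g t - g s) ≤ ε / 2 := by
    filter_upwards [self_mem_nhdsWithin] with s hs
    have h3 := hN n hn t (Set.mem_Iic.2 le_rfl)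
    have h4 := hN n hn s (Set.mem_Iic.2 (le_of_lt hs))
    rw [dist_comm] at h3 h4
    calc _ ≤ dist (f n t) (g t) + dist (f n s) (g s) := dist_sub_sub_le _ _ _ _
      _ ≤ ε / 2 := by linarith
  have := le_of_tendsto h1 h2
  linarith

end UCP
end LevyMAP
end

noncomputable section

namespace LevyMAP

/-! ### The Poisson distribution -/

theorem lintegral_poissonMeasure (r : ℝ≥0) (h : ℕ → ℝ≥0∞) :
    ∫⁻ n, h n ∂(poissonMeasure r) =
      ∑' n : ℕ, ENNReal.ofReal (Real.exp (-r) * r ^ n / n.factorial) * h n := by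
  rw [poissonMeasure, lintegral_sum_measure]
  simp [lintegral_smul_measure]

/-- The Mecke identity 𝔼[N h(N)] = r 𝔼[h(N + 1)], from n/n! = 1/(n - 1)!. It drives the moment
recursions for Poisson integrals. -/
theorem lintegral_natCast_mul_poissonMeasure (r : ℝ≥0) (h : ℕ → ℝ≥0∞) :
    ∫⁻ n, n * h n ∂(poissonMeasure r) = r * ∫⁻ n, h (n + 1) ∂(poissonMeasure r) := by
  rw [lintegral_poissonMeasure, lintegral_poissonMeasure, tsum_eq_zero_add' ENNReal.summable,
    ← ENNReal.tsum_mul_left]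
  simp only [CharP.cast_eq_zero, zero_mul, mul_zero, zero_add]
  refine tsum_congr fun n => ?_
  rw [← mul_assoc, ← mul_assoc]
  congr 1
  rw [← ENNReal.ofReal_natCast, ← ENNReal.ofReal_mul (by positivity), ← ENNReal.ofReal_coe_nnreal,
    ← ENNReal.ofReal_mul (by positivity)]
  congr 1
  rw [Nat.factorial_succ]
  push_cast
  field_simp
  rw [pow_succ']

theorem lintegral_exp_poissonMeasure (r : ℝ≥0) (v : ℝ) :
    ∫⁻ n, ENNReal.ofReal (Real.exp (v * n)) ∂(poissonMeasure r) =
      ENNReal.ofReal (Real.exp (r * (Real.exp v - 1))) := by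
  rw [lintegral_poissonMeasure]
  have h1 : ∀ n : ℕ, ENNReal.ofReal (Real.exp (-r) * r ^ n / n.factorial) *
      ENNReal.ofReal (Real.exp (v * n)) =
      ENNReal.ofReal (Real.exp (-r) * ((r * Real.exp v) ^ n / n.factorial)) := by
    intro n
    rw [← ENNReal.ofReal_mul (by positivity)]
    congr 1
    rw [mul_pow, ← Real.exp_nat_mul, mul_comm v]
    ring
  have hs : HasSum (fun n : ℕ => Real.exp (-r) * ((r * Real.exp v) ^ n / n.factorial))
      (Real.exp (-r) * Real.exp (r * Real.exp v)) := by
    rw [Real.exp_eq_exp_ℝ]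
    exact (NormedSpace.expSeries_div_hasSum_exp ((r : ℝ) * NormedSpace.exp v)).mul_left _
  simp_rw [h1]
  rw [← ENNReal.ofReal_tsum_of_nonneg (fun n => by positivity) hs.summable, hs.tsum_eq,
    ← Real.exp_add]
  congr 2
  ring

/-- The law of a Poisson random variable with values in `ℝ≥0∞`. -/
abbrev poissonENNReal (r : ℝ≥0) : Measure ℝ≥0∞ := (poissonMeasure r).map (Nat.cast : ℕ → ℝ≥0∞)

theorem add_pow_le_two_pow (a b : ℝ≥0∞) (p : ℕ) : (a + b) ^ p ≤ 2 ^ p * (a ^ p + b ^ p) := by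
  rcases le_total a b with h | h
  · calc (a + b) ^ p ≤ (2 * b) ^ p := by rw [two_mul]; gcongr
      _ ≤ _ := by rw [mul_pow]; gcongr; exact le_add_self
  · calc (a + b) ^ p ≤ (2 * a) ^ p := by rw [two_mul]; gcongr
      _ ≤ _ := by rw [mul_pow]; gcongr; exact le_self_add

section Law
variable {Ω : Type*} {mΩ : MeasurableSpace Ω} {P : Measure Ω}

theorem lintegral_of_poisson {N : Ω → ℝ≥0∞} {r : ℝ≥0}
    (hN : HasLaw N (poissonENNReal r) P) {h : ℝ≥0∞ → ℝ≥0∞} (hh : Measurable h) :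
    ∫⁻ ω, h (N ω) ∂P = ∫⁻ n : ℕ, h n ∂(poissonMeasure r) := by
  rw [← lintegral_map' hh.aemeasurable hN.aemeasurable, hN.map_eq, lintegral_map hh (by fun_prop)]

theorem lintegral_mul_of_poisson {N : Ω → ℝ≥0∞} {r : ℝ≥0}
    (hN : HasLaw N (poissonENNReal r) P) {h : ℝ≥0∞ → ℝ≥0∞} (hh : Measurable h) :
    ∫⁻ ω, N ω * h (N ω) ∂P = r * ∫⁻ ω, h (N ω + 1) ∂P := by
  rw [lintegral_of_poisson hN (h := fun x => x * h x) (by fun_prop),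
    lintegral_of_poisson hN (h := fun x => h (x + 1)) (by fun_prop)]
  simpa using lintegral_natCast_mul_poissonMeasure r fun n => h n

theorem lintegral_poisson [IsProbabilityMeasure P] {N : Ω → ℝ≥0∞} {r : ℝ≥0}
    (hN : HasLaw N (poissonENNReal r) P) : ∫⁻ ω, N ω ∂P = r := by
  simpa using lintegral_mul_of_poisson hN (h := fun _ => 1) measurable_const

theorem ae_natCast_of_poisson {N : Ω → ℝ≥0∞} {r : ℝ≥0}
    (hN : HasLaw N (poissonENNReal r) P) : ∀ᵐ ω ∂P, ∃ n : ℕ, N ω = n := by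
  have hS : MeasurableSet (Set.range (Nat.cast : ℕ → ℝ≥0∞)) := (Set.countable_range _).measurableSet
  have h1 : ∀ᵐ x ∂(poissonENNReal r), x ∈ Set.range (Nat.cast : ℕ → ℝ≥0∞) := by
    refine (ae_map_iff (measurable_of_countable _).aemeasurable hS).2 ?_
    exact Eventually.of_forall fun n => ⟨n, rfl⟩
  rw [← hN.map_eq] at h1
  filter_upwards [ae_of_ae_map hN.aemeasurable h1] with ω ⟨n, hn⟩
  exact ⟨n, hn.symm⟩

/-- The indicator of N ≥ 2 is at most N(N - 1), whose mean is r² by the Mecke identity. The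
truncated subtraction is harmless at N = 0 because of the factor N. -/
theorem measure_two_le_of_poisson [IsProbabilityMeasure P] {N : Ω → ℝ≥0∞} (hNm : Measurable N)
    {r : ℝ≥0} (hN : HasLaw N (poissonENNReal r) P) : P {ω | ¬ N ω ≤ 1} ≤ r * r := by
  have hm : MeasurableSet {ω | ¬ N ω ≤ 1} := (measurableSet_le hNm measurable_const).compl
  calc P {ω | ¬ N ω ≤ 1} = ∫⁻ ω, {ω | ¬ N ω ≤ 1}.indicator 1 ω ∂P := (lintegral_indicator_one hm).symm
    _ ≤ ∫⁻ ω, N ω * (N ω - 1) ∂P := by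
      refine lintegral_mono_ae ?_
      filter_upwards [ae_natCast_of_poisson hN] with ω ⟨n, hn⟩
      by_cases h : N ω ≤ 1
      · simp [h]
      · rw [Set.indicator_of_mem (by exact h), hn]
        rw [hn] at h
        have h2 : 2 ≤ n := by
          by_contra h3
          exact h (by exact_mod_cast (by omega : n ≤ 1))
        have : 1 ≤ n * (n - 1) := Nat.mul_pos (by omega) (by omega)
        calc (1 : ℝ≥0∞) ≤ ((n * (n - 1) : ℕ) : ℝ≥0∞) := by exact_mod_cast this
          _ = _ := by push_cast; rfl
    _ = r * r := by
      rw [lintegral_mul_of_poisson hN (h := fun x => x - 1) (by fun_prop)]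
      simp [lintegral_poisson hN]

/-- Moment recursion for weighted sums of independent Poisson variables. -/
theorem lintegral_pow_succ_poisson_le [IsProbabilityMeasure P] {ι : Type*} [Fintype ι]
    {N : ι → Ω → ℝ≥0∞} (hNm : ∀ i, Measurable (N i)) (hind : iIndepFun N P) {r : ι → ℝ≥0}
    (hN : ∀ i, HasLaw (N i) (poissonENNReal (r i)) P) (v : ι → ℝ≥0∞) (p : ℕ) :
    ∫⁻ ω, (∑ i, v i * N i ω) ^ (p + 1) ∂P ≤
      2 ^ p * (∑ i, r i * v i ^ (p + 1) + (∑ i, r i * v i) * ∫⁻ ω, (∑ i, v i * N i ω) ^ p ∂P) := by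
  classical
  -- With the other summands frozen by independence, the Mecke identity in `N i` trades the factor
  -- `N i` for the intensity `r i` and a shift of the total by `v i`.
  have hterm : ∀ i, ∫⁻ ω, N i ω * (∑ j, v j * N j ω) ^ p ∂P =
      r i * ∫⁻ ω, (v i + ∑ j, v j * N j ω) ^ p ∂P := by
    intro i
    set S : Ω → ℝ≥0∞ := fun ω => ∑ j ∈ Finset.univ.erase i, v j * N j ω with hS
    have hsplit : ∀ ω, ∑ j, v j * N j ω = v i * N i ω + S ω := fun ω => by
      rw [hS, Finset.add_sum_erase _ (fun j => v j * N j ω) (Finset.mem_univ i)]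
    have hSm : Measurable S := by fun_prop
    have hI : IndepFun (N i) S P := by
      have := hind.indepFun_finset {i} (Finset.univ.erase i) (by simp) hNm
      exact this.comp (φ := fun x : ({i} : Finset ι) → ℝ≥0∞ => x ⟨i, by simp⟩)
        (ψ := fun x => ∑ j : (Finset.univ.erase i : Finset ι), v j * x j) (by fun_prop)
        (by fun_prop) |>.congr (by rfl) (by
          refine Eventually.of_forall fun ω => ?_
          simp only [hS, Function.comp]
          exact Finset.sum_coe_sort (Finset.univ.erase i) (fun j => v j * N j ω))
    simp_rw [hsplit]
    rw [lintegral_of_indepFun (hNm i) hSm hI (F := fun q => q.1 * (v i * q.1 + q.2) ^ p)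
      (by fun_prop)]
    have h2 : ∀ ω', ∫⁻ ω, N i ω * (v i * N i ω + S ω') ^ p ∂P =
        r i * ∫⁻ ω, (v i + (v i * N i ω + S ω')) ^ p ∂P := by
      intro ω'
      rw [lintegral_mul_of_poisson (hN i) (h := fun x => (v i * x + S ω') ^ p) (by fun_prop)]
      congr 1
      refine lintegral_congr fun ω => ?_
      ring
    simp_rw [h2]
    rw [lintegral_const_mul _ (by fun_prop)]
    congr 1
    rw [lintegral_of_indepFun (hNm i) hSm hI (F := fun q => (v i + (v i * q.1 + q.2)) ^ p)
      (by fun_prop)]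
  calc ∫⁻ ω, (∑ i, v i * N i ω) ^ (p + 1) ∂P
      = ∫⁻ ω, ∑ i, v i * (N i ω * (∑ j, v j * N j ω) ^ p) ∂P := by
        refine lintegral_congr fun ω => ?_
        rw [pow_succ', Finset.sum_mul]
        exact Finset.sum_congr rfl fun i _ => by ring
    _ = ∑ i, v i * (r i * ∫⁻ ω, (v i + ∑ j, v j * N j ω) ^ p ∂P) := by
        rw [lintegral_finsetSum _ fun i _ => by fun_prop]
        refine Finset.sum_congr rfl fun i _ => ?_
        rw [lintegral_const_mul _ (by fun_prop), hterm]
    _ ≤ ∑ i, v i * (r i * (2 ^ p * (v i ^ p + ∫⁻ ω, (∑ j, v j * N j ω) ^ p ∂P))) := by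
        gcongr with i
        calc ∫⁻ ω, (v i + ∑ j, v j * N j ω) ^ p ∂P
            ≤ ∫⁻ ω, 2 ^ p * (v i ^ p + (∑ j, v j * N j ω) ^ p) ∂P :=
              lintegral_mono fun ω => add_pow_le_two_pow _ _ _
          _ = _ := by
              rw [lintegral_const_mul _ (by fun_prop), lintegral_add_left (by fun_prop)]
              simp
    _ = _ := by
        rw [Finset.sum_mul, ← Finset.sum_add_distrib, Finset.mul_sum]
        exact Finset.sum_congr rfl fun i _ => by ring

end Law

/-! ### Poisson random measures -/

namespace IsPoissonRandomMeasure

variable {Ω : Type*} {mΩ : MeasurableSpace Ω} {P : Measure Ω}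
  {E : Type*} [MeasurableSpace E] {M : Ω → Measure E} {m : Measure E}

theorem measurable_apply (h : IsPoissonRandomMeasure P M m) {A : Set E} (hA : MeasurableSet A) :
    Measurable fun ω => M ω A := (Measure.measurable_coe hA).comp h.measurable

theorem ae_lt_top (h : IsPoissonRandomMeasure P M m) {A : Set E} (hA : MeasurableSet A)
    (hm : m A ≠ ∞) : ∀ᵐ ω ∂P, M ω A < ∞ := by
  filter_upwards [ae_natCast_of_poisson (h.law A hA hm)] with ω ⟨n, hn⟩
  rw [hn]
  exact ENNReal.natCast_lt_top n

theorem iIndepFun_fintype (h : IsPoissonRandomMeasure P M m) {ι : Type*} [Fintype ι]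
    {A : ι → Set E} (hA : ∀ i, MeasurableSet (A i)) (hd : Pairwise fun i j => Disjoint (A i) (A j)) :
    iIndepFun (fun i ω => M ω (A i)) P := by
  have e := (Fintype.equivFin ι)
  have := h.indep (Fintype.card ι) (fun i => A (e.symm i)) (fun i => hA _)
    (fun i j hij => hd (fun he => hij (e.symm.injective he)))
  have h2 := this.precomp e.injective
  simpa using h2

variable [IsProbabilityMeasure P]

theorem lintegral_apply (h : IsPoissonRandomMeasure P M m) {A : Set E} (hA : MeasurableSet A)
    (hm : m A ≠ ∞) : ∫⁻ ω, M ω A ∂P = m A := by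
  rw [lintegral_poisson (h.law A hA hm), ENNReal.coe_toNNReal hm]

/-- Campbell's formula: the averaged measure agrees with the mean measure on subsets of the finite
spanning sets, hence everywhere. -/
theorem bind_eq [SigmaFinite m] (h : IsPoissonRandomMeasure P M m) : P.bind M = m := by
  rw [← Measure.restrict_univ (μ := m), ← Measure.restrict_univ (μ := P.bind M),
    ← iUnion_spanningSets m, Measure.restrict_iUnion_congr]
  intro i
  ext s hs
  have hsi : MeasurableSet (s ∩ spanningSets m i) := hs.inter (measurableSet_spanningSets m i)
  rw [Measure.restrict_apply hs, Measure.restrict_apply hs,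
    Measure.bind_apply hsi h.measurable.aemeasurable, h.lintegral_apply hsi]
  exact (measure_mono Set.inter_subset_right |>.trans_lt (measure_spanningSets_lt_top m i)).ne

theorem lintegral_lintegral [SigmaFinite m] (h : IsPoissonRandomMeasure P M m) {f : E → ℝ≥0∞}
    (hf : Measurable f) : ∫⁻ ω, ∫⁻ x, f x ∂(M ω) ∂P = ∫⁻ x, f x ∂m := by
  rw [← Measure.lintegral_bind h.measurable.aemeasurable hf.aemeasurable, h.bind_eq]

/-- Moments of the integral of a simple function. -/
theorem lintegral_pow_succ_simple_le [SigmaFinite m] (h : IsPoissonRandomMeasure P M m)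
    (f : SimpleFunc E ℝ≥0∞) (hf : ∫⁻ x, f x ∂m ≠ ∞) (p : ℕ) :
    ∫⁻ ω, (∫⁻ x, f x ∂(M ω)) ^ (p + 1) ∂P ≤
      2 ^ p * (∫⁻ x, f x ^ (p + 1) ∂m + (∫⁻ x, f x ∂m) * ∫⁻ ω, (∫⁻ x, f x ∂(M ω)) ^ p ∂P) := by
  classical
  -- The value 0 is dropped: its level set may have infinite mean measure, where no Poisson law is
  -- available. The other level sets are finite because `f` is integrable.
  set R := f.range.filter (· ≠ 0) with hR
  have hne : ∀ v ∈ R, v ≠ 0 := fun v hv => (Finset.mem_filter.1 hv).2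
  have hfin : ∀ v ∈ R, m (f ⁻¹' {v}) ≠ ∞ := by
    intro v hv htop
    apply hf
    rw [f.lintegral_eq_lintegral, SimpleFunc.lintegral, ENNReal.sum_eq_top]
    exact ⟨v, (Finset.mem_filter.1 hv).1, by rw [htop, ENNReal.mul_top (hne v hv)]⟩
  have hsum : ∀ (ρ : Measure E) (q : ℕ), ∫⁻ x, f x ^ (q + 1) ∂ρ =
      ∑ v : R, v.1 ^ (q + 1) * ρ (f ⁻¹' {v.1}) := by
    intro ρ q
    have : ∀ x, f x ^ (q + 1) = (f.map (· ^ (q + 1))) x := fun x => rfl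
    simp_rw [this]
    rw [SimpleFunc.lintegral_eq_lintegral, SimpleFunc.map_lintegral,
      Finset.sum_coe_sort R (fun v => v ^ (q + 1) * ρ (f ⁻¹' {v})), hR, Finset.sum_filter]
    refine Finset.sum_congr rfl fun v _ => ?_
    by_cases hv : v = 0 <;> simp [hv]
  have hsum1 : ∀ ρ : Measure E, ∫⁻ x, f x ∂ρ = ∑ v : R, v.1 * ρ (f ⁻¹' {v.1}) := by
    intro ρ; simpa using hsum ρ 0
  have key := lintegral_pow_succ_poisson_le (P := P)
    (N := fun (v : R) ω => M ω (f ⁻¹' {v.1})) (r := fun v => (m (f ⁻¹' {v.1})).toNNReal)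
    (fun v => h.measurable_apply (f.measurableSet_preimage _))
    (h.iIndepFun_fintype (fun v => f.measurableSet_preimage _) fun v w hvw => by
      refine Disjoint.preimage _ ?_
      simpa using fun he => hvw (Subtype.ext he))
    (fun v => h.law _ (f.measurableSet_preimage _) (hfin v v.2)) (fun v => v.1) p
  have hr : ∀ v : R, ((m (f ⁻¹' {v.1})).toNNReal : ℝ≥0∞) = m (f ⁻¹' {v.1}) := fun v =>
    ENNReal.coe_toNNReal (hfin v v.2)
  simp_rw [hr] at key
  simp_rw [hsum, hsum1]
  simpa [mul_comm] using key

/-- The recursion for simple functions bounds every power by constants that involve only the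
integrals of powers of f. Being uniform over the simple functions increasing to f, these bounds
survive the passage to the limit by Fatou. -/
theorem lintegral_pow_lt_top [SigmaFinite m] (h : IsPoissonRandomMeasure P M m) {f : E → ℝ≥0∞}
    (hf : Measurable f) (hfin : ∀ k : ℕ, 1 ≤ k → ∫⁻ x, f x ^ k ∂m < ∞) (p : ℕ) :
    ∫⁻ ω, (∫⁻ x, f x ∂(M ω)) ^ p ∂P < ∞ := by
  have hbound : ∀ p : ℕ, ∃ C : ℝ≥0∞, C < ∞ ∧ ∀ k,
      ∫⁻ ω, (∫⁻ x, SimpleFunc.eapprox f k x ∂(M ω)) ^ p ∂P ≤ C := by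
    intro p
    have hle : ∀ k x, SimpleFunc.eapprox f k x ≤ f x := fun k x => by
      rw [← SimpleFunc.iSup_eapprox_apply hf x]
      exact le_iSup (fun k => SimpleFunc.eapprox f k x) k
    induction p with
    | zero => exact ⟨1, ENNReal.one_lt_top, fun k => by simp⟩
    | succ p ih =>
      obtain ⟨C, hC, hk⟩ := ih
      have h1 := hfin 1 le_rfl
      simp only [pow_one] at h1
      refine ⟨2 ^ p * (∫⁻ x, f x ^ (p + 1) ∂m + (∫⁻ x, f x ∂m) * C), ?_, fun k => ?_⟩
      · exact ENNReal.mul_lt_top (by finiteness)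
          (ENNReal.add_lt_top.2 ⟨hfin _ (by omega), ENNReal.mul_lt_top h1 hC⟩)
      · refine (h.lintegral_pow_succ_simple_le _ ?_ p).trans ?_
        · exact ((lintegral_mono fun x => hle k x).trans_lt h1).ne
        · gcongr with x x
          · exact hle k x
          · exact hle k x
          · exact hk k
  obtain ⟨C, hC, hk⟩ := hbound p
  refine lt_of_le_of_lt ?_ hC
  have hm : ∀ k, Measurable fun ω => ∫⁻ x, SimpleFunc.eapprox f k x ∂(M ω) := fun k =>
    (Measure.measurable_lintegral (SimpleFunc.measurable _)).comp h.measurable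
  have hlim : ∀ ω, Tendsto (fun k => (∫⁻ x, SimpleFunc.eapprox f k x ∂(M ω)) ^ p) atTop
      (𝓝 ((∫⁻ x, f x ∂(M ω)) ^ p)) := by
    intro ω
    refine ENNReal.Tendsto.pow ?_
    refine lintegral_tendsto_of_tendsto_of_monotone (fun n => (SimpleFunc.measurable _).aemeasurable)
      (Eventually.of_forall fun x => fun i j hij => SimpleFunc.monotone_eapprox f hij x)
      (Eventually.of_forall fun x => SimpleFunc.tendsto_eapprox hf x)
  calc ∫⁻ ω, (∫⁻ x, f x ∂(M ω)) ^ p ∂P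
      = ∫⁻ ω, liminf (fun k => (∫⁻ x, SimpleFunc.eapprox f k x ∂(M ω)) ^ p) atTop ∂P :=
        lintegral_congr fun ω => (hlim ω).liminf_eq.symm
    _ ≤ liminf (fun k => ∫⁻ ω, (∫⁻ x, SimpleFunc.eapprox f k x ∂(M ω)) ^ p ∂P) atTop :=
        lintegral_liminf_le fun k => (hm k).pow_const p
    _ ≤ C := liminf_le_of_le (by isBoundedDefault) fun b hb => by
        obtain ⟨k, hk'⟩ := hb.exists
        exact hk'.trans (hk k)

end IsPoissonRandomMeasure
end LevyMAP
end

/-! ### The exponential formula and the atoms of a Poisson random measure -/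

noncomputable section

namespace LevyMAP

namespace IsPoissonRandomMeasure

variable {Ω : Type*} {mΩ : MeasurableSpace Ω} {P : Measure Ω}
  {E : Type*} [MeasurableSpace E] {M : Ω → Measure E} {m : Measure E}

/-- On the level sets of g inside S the masses are independent Poisson variables, so the expectation
factors into Poisson exponential moments. -/
theorem lintegral_exp_simple (h : IsPoissonRandomMeasure P M m) {S : Set E}
    (hS : MeasurableSet S) (hmS : m S ≠ ∞) (g : SimpleFunc E ℝ) :
    ∫⁻ ω, ENNReal.ofReal (Real.exp (∫ x in S, g x ∂(M ω))) ∂P =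
      ENNReal.ofReal (Real.exp (∫ x in S, (Real.exp (g x) - 1) ∂m)) := by
  classical
  set A : g.range → Set E := fun v => g ⁻¹' {v.1} ∩ S with hA
  have hAm : ∀ v, MeasurableSet (A v) := fun v => (g.measurableSet_preimage _).inter hS
  have hAf : ∀ v, m (A v) ≠ ∞ := fun v =>
    ((measure_mono Set.inter_subset_right).trans_lt hmS.lt_top).ne
  have hsum : ∀ (ρ : Measure E), ρ S < ∞ → ∀ φ : ℝ → ℝ, φ 0 = 0 →
      ∫ x in S, φ (g x) ∂ρ = ∑ v : g.range, ρ.real (A v) * φ v.1 := by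
    intro ρ hρ φ hφ
    have : IsFiniteMeasure (ρ.restrict S) := ⟨by simpa using hρ⟩
    have h1 : ∀ x, φ (g x) = (g.map φ) x := fun x => rfl
    simp_rw [h1]
    rw [← SimpleFunc.integral_eq_integral _ (SimpleFunc.integrable_of_isFiniteMeasure _),
      SimpleFunc.map_integral _ _ (SimpleFunc.integrable_of_isFiniteMeasure _) hφ, ← Finset.sum_coe_sort]
    refine Finset.sum_congr rfl fun v _ => ?_
    rw [measureReal_restrict_apply (g.measurableSet_preimage _), smul_eq_mul]
  have hind : iIndepFun (fun (v : g.range) ω => ENNReal.ofReal (Real.exp (v * (M ω (A v)).toReal)))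
      P := by
    refine (h.iIndepFun_fintype hAm fun v w hvw => ?_).comp
      (fun v x => ENNReal.ofReal (Real.exp (v * x.toReal))) (fun v => by fun_prop)
    refine Disjoint.mono Set.inter_subset_left Set.inter_subset_left (Disjoint.preimage _ ?_)
    simpa using fun he => hvw (Subtype.ext he)
  have hmeas : ∀ v : g.range, Measurable fun ω =>
      ENNReal.ofReal (Real.exp (v * (M ω (A v)).toReal)) := fun v => by
    have := h.measurable_apply (hAm v)
    fun_prop
  calc ∫⁻ ω, ENNReal.ofReal (Real.exp (∫ x in S, g x ∂(M ω))) ∂P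
      = ∫⁻ ω, ∏ v : g.range, ENNReal.ofReal (Real.exp (v * (M ω (A v)).toReal)) ∂P := by
        refine lintegral_congr_ae ?_
        filter_upwards [h.ae_lt_top hS hmS] with ω hω
        rw [← ENNReal.ofReal_prod_of_nonneg (fun _ _ => (Real.exp_pos _).le), ← Real.exp_sum]
        congr 2
        rw [hsum (M ω) hω (fun x => x) rfl]
        exact Finset.sum_congr rfl fun v _ => mul_comm _ _
    _ = ∏ v : g.range, ENNReal.ofReal (Real.exp ((m (A v)).toReal * (Real.exp v - 1))) := by
        rw [lintegral_prod_eq_prod_lintegral_of_indepFun _ _ hind hmeas]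
        refine Finset.prod_congr rfl fun v _ => ?_
        rw [lintegral_of_poisson (h.law _ (hAm v) (hAf v))
          (h := fun x => ENNReal.ofReal (Real.exp (v * x.toReal))) (by fun_prop)]
        simp only [ENNReal.toReal_natCast]
        rw [lintegral_exp_poissonMeasure]
        rfl
    _ = _ := by
        rw [← ENNReal.ofReal_prod_of_nonneg (fun _ _ => (Real.exp_pos _).le), ← Real.exp_sum,
          hsum m hmS.lt_top (fun x => Real.exp x - 1) (by simp)]
        rfl

/-- Locally, a Poisson random measure with small enough cells consists of single atoms. -/
theorem ae_restrict_eq_dirac {M : Ω → Measure (ℝ × ℝ)} {m : Measure (ℝ × ℝ)}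
    (h : IsPoissonRandomMeasure P M m) {S : Set (ℝ × ℝ)} (hS : MeasurableSet S) (hmS : m S ≠ ∞) :
    ∀ᵐ ω ∂P, M ω S ≤ 1 → (M ω).restrict S = 0 ∨ ∃ q, (M ω).restrict S = Measure.dirac q := by
  -- Integrality of the mass holds only almost surely for each given set, hence a countable
  -- generating π-system. If the total mass is 1, integrality spreads to a zero-one law on all Borel
  -- sets, and a zero-one probability measure here is a Dirac mass.
  set C : Set (Set (ℝ × ℝ)) := Set.image2 (fun s t => s ×ˢ t) (⋃ a : ℚ, {Set.Iic (a : ℝ)})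
    (⋃ a : ℚ, {Set.Iic (a : ℝ)}) with hC
  have hCc : C.Countable := Set.Countable.image2 (Set.countable_iUnion fun _ => Set.countable_singleton _)
    (Set.countable_iUnion fun _ => Set.countable_singleton _) _
  have hspan : IsCountablySpanning (⋃ a : ℚ, {Set.Iic (a : ℝ)}) := by
    refine ⟨fun n => Set.Iic ((n : ℚ) : ℝ), fun n => Set.mem_iUnion.2 ⟨n, rfl⟩, ?_⟩
    refine Set.eq_univ_of_forall fun x => ?_
    obtain ⟨n, hn⟩ := exists_nat_ge x
    exact Set.mem_iUnion.2 ⟨n, by simpa using hn⟩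
  have hCg : (inferInstance : MeasurableSpace (ℝ × ℝ)) = MeasurableSpace.generateFrom C := by
    refine (generateFrom_eq_prod ?_ ?_ hspan hspan).symm
    all_goals
      rw [← Real.borel_eq_generateFrom_Iic_rat]
      exact (BorelSpace.measurable_eq (α := ℝ)).symm
  have hCp : IsPiSystem C := Real.isPiSystem_Iic_rat.prod Real.isPiSystem_Iic_rat
  have hCm : ∀ D ∈ C, MeasurableSet D := by
    intro D hD
    have := MeasurableSpace.measurableSet_generateFrom hD
    rwa [← hCg] at this
  have hint : ∀ D ∈ C, ∀ᵐ ω ∂P, ∃ n : ℕ, M ω (D ∩ S) = n := fun D hD =>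
    ae_natCast_of_poisson (h.law _ ((hCm D hD).inter hS)
      ((measure_mono Set.inter_subset_right).trans_lt hmS.lt_top).ne)
  filter_upwards [(ae_ball_iff hCc).2 hint, ae_natCast_of_poisson (h.law S hS hmS)] with ω hω hωS h1
  obtain ⟨n, hn⟩ := hωS
  have hn1 : n ≤ 1 := by rw [hn] at h1; exact_mod_cast h1
  obtain rfl | rfl : n = 0 ∨ n = 1 := by omega
  · left
    rw [Measure.restrict_eq_zero, hn]; simp
  · right
    set ρ := (M ω).restrict S with hρ
    have hρu : ρ Set.univ = 1 := by rw [hρ, Measure.restrict_apply_univ, hn]; simp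
    have : IsProbabilityMeasure ρ := ⟨hρu⟩
    have h01 : ∀ D, MeasurableSet D → ρ D = 0 ∨ ρ D = 1 := by
      intro D hD
      refine MeasurableSpace.induction_on_inter (C := fun D _ => ρ D = 0 ∨ ρ D = 1) hCg hCp
        (Or.inl measure_empty) ?_ ?_ ?_ D hD
      · intro t ht
        obtain ⟨k, hk⟩ := hω t ht
        have hle : ρ t ≤ 1 := prob_le_one
        rw [hρ, Measure.restrict_apply (hCm t ht), hk] at hle ⊢
        have : k ≤ 1 := by exact_mod_cast hle
        obtain rfl | rfl : k = 0 ∨ k = 1 := by omega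
        · simp
        · simp
      · intro t ht ih
        rw [prob_compl_eq_one_sub ht]
        rcases ih with ih | ih <;> simp [ih]
      · intro f hd hf ih
        by_cases hex : ∃ i, ρ (f i) = 1
        · obtain ⟨i, hi⟩ := hex
          right
          exact le_antisymm prob_le_one (hi ▸ measure_mono (Set.subset_iUnion f i))
        · left
          rw [measure_iUnion_null_iff]
          intro i
          exact (ih i).resolve_right fun hi => hex ⟨i, hi⟩
    have : IsZeroOneMeasure ρ := ⟨fun s hs => h01 s hs⟩
    have : NeZero ρ := ⟨IsProbabilityMeasure.ne_zero ρ⟩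
    exact IsZeroOneMeasure.exists_eq_dirac

variable [IsProbabilityMeasure P]

theorem ae_integrableOn [SigmaFinite m] (h : IsPoissonRandomMeasure P M m) {S : Set E}
    (hS : MeasurableSet S) {f : E → ℝ} (hf : Measurable f) (hi : IntegrableOn f S m) :
    ∀ᵐ ω ∂P, IntegrableOn f S (M ω) := by
  have h1 := h.lintegral_lintegral (f := S.indicator fun x => ‖f x‖ₑ) (hf.enorm.indicator hS)
  have h2 : ∫⁻ x, S.indicator (fun x => ‖f x‖ₑ) x ∂m < ∞ := by
    rw [lintegral_indicator hS]; exact hi.2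
  rw [← h1] at h2
  have h3 := MeasureTheory.ae_lt_top ((Measure.measurable_lintegral (hf.enorm.indicator hS)).comp h.measurable)
    h2.ne
  filter_upwards [h3] with ω hω
  refine ⟨hf.aestronglyMeasurable, ?_⟩
  rw [HasFiniteIntegral, ← lintegral_indicator hS]
  exact hω

theorem aemeasurable_setIntegral [SigmaFinite m] (h : IsPoissonRandomMeasure P M m) {S : Set E}
    (hS : MeasurableSet S) {f : E → ℝ} (hf : Measurable f) (hi : IntegrableOn f S m) :
    AEMeasurable (fun ω => ∫ x in S, f x ∂(M ω)) P := by
  have hm : ∀ g : E → ℝ, Measurable g →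
      Measurable fun ω => (∫⁻ x in S, ENNReal.ofReal (g x) ∂(M ω)).toReal := by
    intro g hg
    simp_rw [← lintegral_indicator hS]
    exact ((Measure.measurable_lintegral (hg.ennreal_ofReal.indicator hS)).comp
      h.measurable).ennreal_toReal
  refine ((hm f hf).sub (hm (fun x => - f x) hf.neg)).aemeasurable.congr ?_
  filter_upwards [h.ae_integrableOn hS hf hi] with ω hω
  exact (integral_eq_lintegral_pos_part_sub_lintegral_neg_part hω).symm

/-- Exponential formula (upper bound) for the integral over a set of finite mean measure. -/
theorem lintegral_exp_setIntegral_le [SigmaFinite m] (h : IsPoissonRandomMeasure P M m) {S : Set E}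
    (hS : MeasurableSet S) (hmS : m S ≠ ∞) {f : E → ℝ} (hf : Measurable f)
    (hi : IntegrableOn (fun x => Real.exp (2 * |f x|)) S m) :
    ∫⁻ ω, ENNReal.ofReal (Real.exp (∫ x in S, f x ∂(M ω))) ∂P ≤
      ENNReal.ofReal (Real.exp (∫ x in S, (Real.exp (f x) - 1) ∂m)) := by
  set g : ℕ → SimpleFunc E ℝ := SimpleFunc.approxOn f hf Set.univ 0 (Set.mem_univ _) with hg
  -- The simple approximations are controlled only by 2|f|, whence the doubled exponent in the
  -- integrability hypothesis.
  have hle : ∀ k x, |g k x| ≤ 2 * |f x| := fun k x => by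
    have := SimpleFunc.norm_approxOn_zero_le hf (Set.mem_univ (0 : ℝ)) x k
    rw [two_mul]; exact this
  have hlim : ∀ x, Tendsto (fun k => g k x) atTop (𝓝 (f x)) := fun x =>
    SimpleFunc.tendsto_approxOn hf _ (by simp)
  have hfi : IntegrableOn (fun x => 2 * |f x|) S m := by
    refine hi.mono' (by fun_prop) (Eventually.of_forall fun x => ?_)
    rw [Real.norm_eq_abs, abs_of_nonneg (by positivity)]
    linarith [Real.add_one_le_exp (2 * |f x|)]
  have hfin : IsFiniteMeasure (m.restrict S) := ⟨by simpa using hmS.lt_top⟩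
  have hlimM : ∀ᵐ ω ∂P, Tendsto (fun k => ENNReal.ofReal (Real.exp (∫ x in S, g k x ∂(M ω)))) atTop
      (𝓝 (ENNReal.ofReal (Real.exp (∫ x in S, f x ∂(M ω))))) := by
    filter_upwards [h.ae_integrableOn hS (by fun_prop) hfi] with ω hω
    refine ENNReal.tendsto_ofReal ((Real.continuous_exp.tendsto _).comp ?_)
    exact tendsto_integral_of_dominated_convergence _
      (fun k => (g k).measurable.aestronglyMeasurable) hω
      (fun k => Eventually.of_forall fun x => hle k x) (Eventually.of_forall hlim)
  have hlimm : Tendsto (fun k => ENNReal.ofReal (Real.exp (∫ x in S, (Real.exp (g k x) - 1) ∂m)))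
      atTop (𝓝 (ENNReal.ofReal (Real.exp (∫ x in S, (Real.exp (f x) - 1) ∂m)))) := by
    refine ENNReal.tendsto_ofReal ((Real.continuous_exp.tendsto _).comp ?_)
    refine tendsto_integral_of_dominated_convergence (fun x => Real.exp (2 * |f x|) + 1)
      (fun k => Measurable.aestronglyMeasurable ((Real.measurable_exp.comp (g k).measurable).sub_const 1))
      (hi.add (integrable_const _)) (fun k => Eventually.of_forall fun x => ?_)
      (Eventually.of_forall fun x => (((Real.continuous_exp.tendsto _).comp (hlim x)).sub_const 1))
    rw [Real.norm_eq_abs]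
    refine (abs_sub _ _).trans ?_
    rw [abs_of_pos (Real.exp_pos _), abs_one]
    gcongr
    exact (le_abs_self _).trans (hle k x)
  have hgi : ∀ k, IntegrableOn (g k) S m := fun k =>
    hfi.mono' (g k).measurable.aestronglyMeasurable (Eventually.of_forall fun x => hle k x)
  calc ∫⁻ ω, ENNReal.ofReal (Real.exp (∫ x in S, f x ∂(M ω))) ∂P
      = ∫⁻ ω, liminf (fun k => ENNReal.ofReal (Real.exp (∫ x in S, g k x ∂(M ω)))) atTop ∂P := by
        refine lintegral_congr_ae ?_
        filter_upwards [hlimM] with ω hω using hω.liminf_eq.symm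
    _ ≤ liminf (fun k => ∫⁻ ω, ENNReal.ofReal (Real.exp (∫ x in S, g k x ∂(M ω))) ∂P) atTop :=
        lintegral_liminf_le' fun k => by
          have := h.aemeasurable_setIntegral hS (g k).measurable (hgi k)
          fun_prop
    _ = _ := by
        simp_rw [h.lintegral_exp_simple hS hmS]
        exact hlimm.liminf_eq

end IsPoissonRandomMeasure
end LevyMAP
end

/-! ### Lévy measures and exponential moments of compensated jump integrals -/

noncomputable section

namespace LevyMAP

/-- The jump sizes of absolute value at least `1 / (n + 1)`. -/
abbrev bigJumps (n : ℕ) : Set ℝ := {x : ℝ | 1 / ((n : ℝ) + 1) ≤ |x|}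

theorem measurableSet_bigJumps (n : ℕ) : MeasurableSet (bigJumps n) :=
  measurableSet_le measurable_const (by fun_prop)

theorem bigJumps_mono {n k : ℕ} (h : n ≤ k) : bigJumps n ⊆ bigJumps k := fun x hx => by
  have hx' : 1 / ((n : ℝ) + 1) ≤ |x| := hx
  have : 1 / ((k : ℝ) + 1) ≤ 1 / ((n : ℝ) + 1) := by gcongr
  exact this.trans hx'

theorem iUnion_bigJumps : ⋃ n, bigJumps n = {0}ᶜ := by
  ext x
  simp only [Set.mem_iUnion, Set.mem_compl_iff, Set.mem_singleton_iff]
  constructor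
  · rintro ⟨n, hn⟩ rfl
    have hn' : 1 / ((n : ℝ) + 1) ≤ |0| := hn
    rw [abs_zero] at hn'
    have : 0 < 1 / ((n : ℝ) + 1) := by positivity
    linarith
  · intro hx
    obtain ⟨n, hn⟩ := exists_nat_one_div_lt (abs_pos.2 hx)
    exact ⟨n, hn.le⟩

namespace IsLevyMeasure

variable {ν : Measure ℝ}

theorem integrable_min (h : IsLevyMeasure ν) : Integrable (fun x => min (x ^ 2) 1) ν := by
  refine ⟨Measurable.aestronglyMeasurable (by fun_prop), ?_⟩
  rw [hasFiniteIntegral_iff_ofReal (Eventually.of_forall fun x => le_min (sq_nonneg _) zero_le_one)]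
  exact h.integrable

theorem measure_bigJumps_lt_top (h : IsLevyMeasure ν) (n : ℕ) : ν (bigJumps n) < ∞ := by
  have hpos : 0 < (1 / ((n : ℝ) + 1)) ^ 2 := by positivity
  refine (measure_mono ?_).trans_lt (h.integrable_min.measure_ge_lt_top hpos)
  intro x hx
  have hx' : 1 / ((n : ℝ) + 1) ≤ |x| := hx
  change (1 / ((n : ℝ) + 1)) ^ 2 ≤ min (x ^ 2) 1
  refine le_min ?_ ?_
  · rw [← sq_abs x]
    gcongr
  · refine pow_le_one₀ (by positivity) ?_
    rw [div_le_one (by positivity)]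
    linarith [(Nat.cast_nonneg n : (0 : ℝ) ≤ n)]

theorem sigmaFinite (h : IsLevyMeasure ν) : SigmaFinite ν := by
  refine ⟨⟨{ set := fun n => bigJumps n ∪ {0}, set_mem := fun _ => trivial, finite := fun n => ?_,
             spanning := ?_ }⟩⟩
  · exact measure_union_lt_top (h.measure_bigJumps_lt_top n) (by simp [h.zero])
  · rw [← Set.iUnion_union, iUnion_bigJumps, Set.compl_union_self]

theorem prod_Ioc_bigJumps (h : IsLevyMeasure ν) (a b : ℝ) (n : ℕ) :
    (volume.prod ν) (Set.Ioc a b ×ˢ bigJumps n) ≠ ∞ := by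
  have := h.sigmaFinite
  rw [Measure.prod_prod]
  exact ENNReal.mul_ne_top (by simp) (h.measure_bigJumps_lt_top n).ne

end IsLevyMeasure

/-- An exponential moment of the large jumps. -/
def ExpTail (ν : Measure ℝ) (c : ℝ) : Prop :=
  ∫⁻ x in {x : ℝ | 1 ≤ |x|}, ENNReal.ofReal (Real.exp (c * |x|)) ∂ν < ∞

section Levy

variable {Ω : Type*} {mΩ : MeasurableSpace Ω} {P : Measure Ω} {M : Ω → Measure (ℝ × ℝ)}
  {ν : Measure ℝ} {J : ℝ≥0 → Ω → ℝ}

/-- A `ν`-integrable dominating function. -/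
def levyBound (c : ℝ) (x : ℝ) : ℝ :=
  min (x ^ 2) 1 + {x : ℝ | 1 ≤ |x|}.indicator (fun x => Real.exp (c * |x|)) x

theorem measurableSet_one_le_abs : MeasurableSet {x : ℝ | 1 ≤ |x|} :=
  measurableSet_le measurable_const (by fun_prop)

theorem integrable_levyBound (hν : IsLevyMeasure ν) {c : ℝ} (hc : ExpTail ν c) :
    Integrable (levyBound c) ν := by
  refine hν.integrable_min.add ?_
  rw [integrable_indicator_iff measurableSet_one_le_abs]
  refine ⟨Measurable.aestronglyMeasurable (by fun_prop), ?_⟩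
  rw [hasFiniteIntegral_iff_ofReal (Eventually.of_forall fun x => (Real.exp_pos _).le)]
  exact hc

theorem integrableOn_exp_bigJumps (hν : IsLevyMeasure ν) {c : ℝ} (hc0 : 0 ≤ c) (hc : ExpTail ν c)
    (n : ℕ) : IntegrableOn (fun x => Real.exp (c * |x|)) (bigJumps n) ν := by
  have : IsFiniteMeasure (ν.restrict (bigJumps n)) :=
    ⟨by simpa using hν.measure_bigJumps_lt_top n⟩
  refine ((integrable_levyBound hν hc).integrableOn.add (integrable_const (Real.exp c))).mono'
    (Measurable.aestronglyMeasurable (by fun_prop)) (Eventually.of_forall fun x => ?_)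
  rw [Real.norm_eq_abs, abs_of_pos (Real.exp_pos _)]
  simp only [Pi.add_apply, levyBound]
  have h0 : 0 ≤ min (x ^ 2) (1 : ℝ) := le_min (sq_nonneg _) zero_le_one
  by_cases hx : 1 ≤ |x|
  · rw [Set.indicator_of_mem (by exact hx)]
    linarith [Real.exp_pos c]
  · rw [Set.indicator_of_notMem (by exact hx)]
    have : Real.exp (c * |x|) ≤ Real.exp c := by
      refine Real.exp_le_exp.2 ?_
      exact mul_le_of_le_one_right hc0 (not_le.1 hx).le
    linarith

theorem integrableOn_prod_snd [SFinite ν] {S : Set ℝ} {f : ℝ → ℝ} (hf : IntegrableOn f S ν)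
    (a b : ℝ) : IntegrableOn (fun p : ℝ × ℝ => f p.2) (Set.Ioc a b ×ˢ S) (volume.prod ν) := by
  rw [IntegrableOn, ← Measure.prod_restrict]
  exact Integrable.comp_snd hf _

theorem setIntegral_prod_snd [SFinite ν] {S : Set ℝ} (f : ℝ → ℝ) {t : ℝ} (ht : 0 ≤ t) :
    ∫ p in Set.Ioc 0 t ×ˢ S, f p.2 ∂(volume.prod ν) = t * ∫ x in S, f x ∂ν := by
  rw [← Measure.prod_restrict, integral_fun_snd]
  simp [ht]

/-- Second-order Taylor bound for small jumps, crude exponential bound for large ones. The right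
side does not depend on d, nor on any truncation level. -/
theorem exp_sub_le_levyBound {c d x : ℝ} (hd : |d| ≤ 1) (hdc : |d| ≤ c) :
    Real.exp (d * x) - 1 - (if |x| < 1 then d * x else 0) ≤ levyBound c x := by
  unfold levyBound
  split_ifs with hx
  · rw [Set.indicator_of_notMem (by simpa using hx), add_zero]
    have h1 : |d * x| ≤ 1 := by
      rw [abs_mul]; exact mul_le_one₀ hd (abs_nonneg _) hx.le
    have h2 := Real.abs_exp_sub_one_sub_id_le h1
    have h3 : (d * x) ^ 2 ≤ x ^ 2 := by
      rw [mul_pow]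
      exact mul_le_of_le_one_left (sq_nonneg _) ((sq_le_one_iff_abs_le_one d).2 hd)
    have h4 : x ^ 2 ≤ 1 := (sq_le_one_iff_abs_le_one x).2 hx.le
    rw [min_eq_left h4]
    exact (le_abs_self _).trans (h2.trans h3)
  · rw [Set.indicator_of_mem (by exact not_lt.1 hx)]
    have h0 : 0 ≤ min (x ^ 2) (1 : ℝ) := le_min (sq_nonneg _) zero_le_one
    have h1 : Real.exp (d * x) ≤ Real.exp (c * |x|) := by
      refine Real.exp_le_exp.2 ((le_abs_self _).trans ?_)
      rw [abs_mul]
      gcongr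
    linarith

theorem levyBound_nonneg (c x : ℝ) : 0 ≤ levyBound c x :=
  add_nonneg (le_min (sq_nonneg _) zero_le_one)
    (Set.indicator_nonneg (fun _ _ => (Real.exp_pos _).le) _)

/-- The compensated sum of the jumps of size at least `1 / (n + 1)`. -/
def truncatedJumps (M : Ω → Measure (ℝ × ℝ)) (ν : Measure ℝ) (n : ℕ) (t : ℝ≥0) (ω : Ω) : ℝ :=
  (∫ p in Set.Ioc (0 : ℝ) t ×ˢ bigJumps n, p.2 ∂(M ω))
    - t * ∫ x in {x : ℝ | 1 / ((n : ℝ) + 1) ≤ |x| ∧ |x| < 1}, x ∂ν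

variable [IsProbabilityMeasure P]

theorem integrableOn_id_bigJumps (hν : IsLevyMeasure ν) {c : ℝ} (hc0 : 0 < c) (hc : ExpTail ν c)
    (n : ℕ) : IntegrableOn (fun x => x) (bigJumps n) ν := by
  refine ((integrableOn_exp_bigJumps hν hc0.le hc n).const_mul c⁻¹).mono' (by fun_prop)
    (Eventually.of_forall fun x => ?_)
  rw [Real.norm_eq_abs, inv_mul_eq_div, le_div_iff₀ hc0]
  linarith [Real.add_one_le_exp (c * |x|)]

theorem aemeasurable_truncatedJumps (hν : IsLevyMeasure ν)
    (hM : IsPoissonRandomMeasure P M (volume.prod ν)) {c : ℝ} (hc0 : 0 < c) (hc : ExpTail ν c)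
    (n : ℕ) (t : ℝ≥0) : AEMeasurable (truncatedJumps M ν n t) P := by
  have := hν.sigmaFinite
  exact (hM.aemeasurable_setIntegral (measurableSet_Ioc.prod (measurableSet_bigJumps n))
    measurable_snd (integrableOn_prod_snd (integrableOn_id_bigJumps hν hc0 hc n) _ _)).sub_const _

/-- After compensation the exponent in the exponential formula is the ν-integral of e^{dx} - 1 -
dx·1_{|x|<1} over the retained jumps, so `levyBound` controls it uniformly in n. The condition 2|d|
≤ c supplies the doubled exponent demanded by `lintegral_exp_setIntegral_le`. -/
theorem lintegral_exp_truncatedJumps_le (hν : IsLevyMeasure ν)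
    (hM : IsPoissonRandomMeasure P M (volume.prod ν)) {c : ℝ} (hc0 : 0 < c) (hc : ExpTail ν c)
    {d : ℝ} (hd : |d| ≤ 1) (hdc : 2 * |d| ≤ c) (n : ℕ) (t : ℝ≥0) :
    ∫⁻ ω, ENNReal.ofReal (Real.exp (d * truncatedJumps M ν n t ω)) ∂P ≤
      ENNReal.ofReal (Real.exp (t * ∫ x, levyBound c x ∂ν)) := by
  have := hν.sigmaFinite
  have : IsFiniteMeasure (ν.restrict (bigJumps n)) :=
    ⟨by simpa using hν.measure_bigJumps_lt_top n⟩
  have hdc' : |d| ≤ c := by linarith [abs_nonneg d]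
  set b := ∫ x in {x : ℝ | 1 / ((n : ℝ) + 1) ≤ |x| ∧ |x| < 1}, x ∂ν with hb
  have hS : MeasurableSet (Set.Ioc (0 : ℝ) t ×ˢ bigJumps n) :=
    measurableSet_Ioc.prod (measurableSet_bigJumps n)
  have hexp := integrableOn_exp_bigJumps hν hc0.le hc n
  have hexp2 : IntegrableOn (fun x => Real.exp (2 * |d * x|)) (bigJumps n) ν := by
    refine hexp.mono' (Measurable.aestronglyMeasurable (by fun_prop))
      (Eventually.of_forall fun x => ?_)
    rw [Real.norm_eq_abs, abs_of_pos (Real.exp_pos _)]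
    refine Real.exp_le_exp.2 ?_
    rw [abs_mul, ← mul_assoc]
    gcongr
  have hexp1 : IntegrableOn (fun x => Real.exp (d * x)) (bigJumps n) ν := by
    refine hexp2.mono' (Measurable.aestronglyMeasurable (by fun_prop))
      (Eventually.of_forall fun x => ?_)
    rw [Real.norm_eq_abs, abs_of_pos (Real.exp_pos _)]
    exact Real.exp_le_exp.2 (by linarith [le_abs_self (d * x), abs_nonneg (d * x)])
  have h1 := hM.lintegral_exp_setIntegral_le hS (hν.prod_Ioc_bigJumps _ _ n)
    (f := fun p : ℝ × ℝ => d * p.2) (by fun_prop)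
    (integrableOn_prod_snd (f := fun x => Real.exp (2 * |d * x|)) hexp2 _ _)
  rw [setIntegral_prod_snd (S := bigJumps n) (ν := ν) (fun x => Real.exp (d * x) - 1)
    t.coe_nonneg] at h1
  have hsplit : ∀ ω, ENNReal.ofReal (Real.exp (d * truncatedJumps M ν n t ω)) =
      ENNReal.ofReal (Real.exp (∫ p in Set.Ioc (0 : ℝ) t ×ˢ bigJumps n, d * p.2 ∂(M ω))) *
        ENNReal.ofReal (Real.exp (-(d * t * b))) := by
    intro ω
    rw [← ENNReal.ofReal_mul (Real.exp_pos _).le, ← Real.exp_add, integral_const_mul]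
    congr 2
    rw [truncatedJumps]
    ring
  simp_rw [hsplit]
  rw [lintegral_mul_const' _ _ ENNReal.ofReal_ne_top]
  refine (mul_le_mul_left h1 _).trans ?_
  rw [← ENNReal.ofReal_mul (Real.exp_pos _).le, ← Real.exp_add]
  refine ENNReal.ofReal_le_ofReal (Real.exp_le_exp.2 ?_)
  have hbeq : d * b = ∫ x in bigJumps n, (if |x| < 1 then d * x else 0) ∂ν := by
    rw [hb, ← integral_const_mul]
    have hs : {x : ℝ | 1 / ((n : ℝ) + 1) ≤ |x| ∧ |x| < 1} = {x : ℝ | |x| < 1} ∩ bigJumps n := by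
      ext x; simp [and_comm]
    have hms : MeasurableSet {x : ℝ | |x| < 1} := measurableSet_lt (by fun_prop) measurable_const
    rw [hs, ← Measure.restrict_restrict hms, ← integral_indicator hms]
    rfl
  have hidI : IntegrableOn (fun x => if |x| < 1 then d * x else 0) (bigJumps n) ν := by
    have hms : MeasurableSet {x : ℝ | |x| < 1} := measurableSet_lt (by fun_prop) measurable_const
    have := ((integrableOn_id_bigJumps hν hc0 hc n).const_mul d).indicator hms
    exact this
  calc (t : ℝ) * ∫ x in bigJumps n, (Real.exp (d * x) - 1) ∂ν + -(d * t * b)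
      = t * (∫ x in bigJumps n, (Real.exp (d * x) - 1) ∂ν - d * b) := by ring
    _ = t * ∫ x in bigJumps n, (Real.exp (d * x) - 1 - (if |x| < 1 then d * x else 0)) ∂ν := by
        have hexp1' : IntegrableOn (fun x => Real.exp (d * x) - 1) (bigJumps n) ν :=
          hexp1.sub (integrable_const _)
        rw [hbeq, ← integral_sub hexp1' hidI]
    _ ≤ t * ∫ x in bigJumps n, levyBound c x ∂ν := by
        refine mul_le_mul_of_nonneg_left ?_ t.coe_nonneg
        refine integral_mono ((hexp1.sub (integrable_const _)).sub hidI)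
          (integrable_levyBound hν hc).integrableOn fun x => ?_
        exact exp_sub_le_levyBound hd hdc'
    _ ≤ _ := by
        refine mul_le_mul_of_nonneg_left ?_ t.coe_nonneg
        exact setIntegral_le_integral (integrable_levyBound hν hc)
          (Eventually.of_forall fun x => levyBound_nonneg c x)

/-- The bound for truncated jumps is uniform in the truncation, so Fatou carries it to the limit
along an almost surely convergent subsequence. Applying it with both signs of the rate controls |J|.
-/
theorem IsCompensatedJumpIntegral.hasExpMoment (hν : IsLevyMeasure ν)
    (hM : IsPoissonRandomMeasure P M (volume.prod ν)) (hJ : IsCompensatedJumpIntegral P M ν J)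
    {c : ℝ} (hc0 : 0 < c) (hc : ExpTail ν c) (t : ℝ≥0) :
    AEMeasurable (J t) P ∧ HasExpMoment (J t) P := by
  obtain ⟨ns, -, hns⟩ := TendstoUCP.exists_seq_tendstoUniformlyOn hJ
  have hlim : ∀ᵐ ω ∂P, Tendsto (fun k => truncatedJumps M ν (ns k) t ω) atTop (𝓝 (J t ω)) := by
    filter_upwards [hns] with ω hω
    exact tendsto_of_tendstoUniformlyOn_Iic hω t
  have hmeas : AEMeasurable (J t) P := aemeasurable_of_tendsto_metrizable_ae atTop
    (fun k => aemeasurable_truncatedJumps hν hM hc0 hc (ns k) t) hlim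
  refine ⟨hmeas, ?_⟩
  set d : ℝ := min 1 (c / 2) with hd
  have hd0 : 0 < d := lt_min one_pos (by positivity)
  have hbound : ∀ e : ℝ, |e| = d → ∫⁻ ω, ENNReal.ofReal (Real.exp (e * J t ω)) ∂P < ∞ := by
    intro e he
    have h1 : |e| ≤ 1 := he ▸ min_le_left _ _
    have h2 : 2 * |e| ≤ c := by
      rw [he]; linarith [min_le_right (1 : ℝ) (c / 2)]
    calc ∫⁻ ω, ENNReal.ofReal (Real.exp (e * J t ω)) ∂P
        = ∫⁻ ω, liminf (fun k => ENNReal.ofReal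
            (Real.exp (e * truncatedJumps M ν (ns k) t ω))) atTop ∂P := by
          refine lintegral_congr_ae ?_
          filter_upwards [hlim] with ω hω
          refine (Tendsto.liminf_eq ?_).symm
          exact ENNReal.tendsto_ofReal ((Real.continuous_exp.tendsto _).comp (hω.const_mul e))
      _ ≤ liminf (fun k => ∫⁻ ω, ENNReal.ofReal
            (Real.exp (e * truncatedJumps M ν (ns k) t ω)) ∂P) atTop :=
          lintegral_liminf_le' fun k => by
            have := aemeasurable_truncatedJumps hν hM hc0 hc (ns k) t
            fun_prop
      _ ≤ ENNReal.ofReal (Real.exp (t * ∫ x, levyBound c x ∂ν)) :=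
          liminf_le_of_le (by isBoundedDefault) fun b hb => by
            obtain ⟨k, hk⟩ := hb.exists
            exact hk.trans (lintegral_exp_truncatedJumps_le hν hM hc0 hc h1 h2 _ t)
      _ < ∞ := ENNReal.ofReal_lt_top
  exact hasExpMoment_of_lintegral hmeas hd0 (hbound d (abs_of_pos hd0))
    (hbound (-d) (by rw [abs_neg, abs_of_pos hd0]))

end Levy
end LevyMAP
end

/-! ### Jumps of a compensated integral and atoms of the random measure -/

noncomputable section

namespace LevyMAP

section Jumps

variable {Ω : Type*} {mΩ : MeasurableSpace Ω} {P : Measure Ω} {M : Ω → Measure (ℝ × ℝ)}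
  {ν : Measure ℝ} {J : ℝ≥0 → Ω → ℝ}

/-- As s increases to t, the sets (0, s] × C increase to (0, t) × C, so the missing slice {t} × C
carries the jump. The integrand itself dominates. -/
theorem tendsto_setIntegral_Ioc_prod {ρ : Measure (ℝ × ℝ)} {C : Set ℝ} (hC : MeasurableSet C)
    {f : ℝ × ℝ → ℝ} (hf : Measurable f) {t : ℝ≥0} (ht : 0 < t)
    (hi : IntegrableOn f (Set.Ioc (0 : ℝ) t ×ˢ C) ρ) :
    Tendsto (fun s : ℝ≥0 => ∫ p in Set.Ioc (0 : ℝ) t ×ˢ C, f p ∂ρ - ∫ p in Set.Ioc (0 : ℝ) s ×ˢ C, f p ∂ρ)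
      (𝓝[<] t) (𝓝 (∫ p in {(t : ℝ)} ×ˢ C, f p ∂ρ)) := by
  set S := Set.Ioc (0 : ℝ) t ×ˢ C with hS
  have hSm : MeasurableSet S := measurableSet_Ioc.prod hC
  have hsub : ∀ D : Set (ℝ × ℝ), MeasurableSet D → D ⊆ S →
      ∫ p in D, f p ∂ρ = ∫ p in S, D.indicator f p ∂ρ := by
    intro D hD hDS
    rw [integral_indicator hD, Measure.restrict_restrict hD, Set.inter_eq_left.2 hDS]
  have hDm : ∀ s : ℝ≥0, MeasurableSet (Set.Ioc (0 : ℝ) s ×ˢ C) := fun s => measurableSet_Ioc.prod hC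
  have hsing : MeasurableSet ({(t : ℝ)} ×ˢ C) := (measurableSet_singleton _).prod hC
  have hsingS : {(t : ℝ)} ×ˢ C ⊆ S := Set.prod_mono_left (by simpa using ht)
  have hmeas : ∀ D : Set (ℝ × ℝ), MeasurableSet D → Measurable (D.indicator f) := fun D hD =>
    hf.indicator hD
  have key : Tendsto (fun s : ℝ≥0 => ∫ p in S, (Set.Ioc (0 : ℝ) s ×ˢ C).indicator f p ∂ρ) (𝓝[<] t)
      (𝓝 (∫ p in S, (f p - ({(t : ℝ)} ×ˢ C).indicator f p) ∂ρ)) := by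
    refine tendsto_integral_filter_of_dominated_convergence (fun p => ‖f p‖)
      (Eventually.of_forall fun s => (hmeas _ (hDm s)).aestronglyMeasurable)
      (Eventually.of_forall fun s => Eventually.of_forall fun p => norm_indicator_le_norm_self _ _)
      hi.norm ((ae_restrict_iff' hSm).2 (Eventually.of_forall fun p hp => ?_))
    have hp1 : p.1 ∈ Set.Ioc (0 : ℝ) t := hp.1
    have hp2 : p.2 ∈ C := hp.2
    by_cases hpt : p.1 = t
    · have h1 : p ∈ {(t : ℝ)} ×ˢ C := ⟨hpt, hp2⟩
      rw [Set.indicator_of_mem h1, sub_self]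
      refine tendsto_const_nhds.congr' ?_
      filter_upwards [self_mem_nhdsWithin] with s hs
      rw [Set.indicator_of_notMem]
      rintro ⟨h2, -⟩
      have h3 : p.1 ≤ s := h2.2
      rw [hpt] at h3
      exact absurd hs (not_lt.2 (by exact_mod_cast h3))
    · have h1 : p ∉ {(t : ℝ)} ×ˢ C := fun h => hpt h.1
      rw [Set.indicator_of_notMem h1, sub_zero]
      refine tendsto_const_nhds.congr' ?_
      have hlt : p.1.toNNReal < t := by
        rw [Real.toNNReal_lt_iff_lt_coe hp1.1.le]
        exact lt_of_le_of_ne hp1.2 hpt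
      filter_upwards [Ioo_mem_nhdsLT hlt] with s hs
      rw [Set.indicator_of_mem]
      refine ⟨⟨hp1.1, ?_⟩, hp2⟩
      have := hs.1.le
      exact Real.toNNReal_le_iff_le_coe.1 this
  have hfin : ∫ p in S, f p ∂ρ - ∫ p in S, (f p - ({(t : ℝ)} ×ˢ C).indicator f p) ∂ρ =
      ∫ p in {(t : ℝ)} ×ˢ C, f p ∂ρ := by
    rw [integral_sub hi (hi.indicator hsing), hsub _ hsing hsingS]
    ring
  rw [← hfin]
  refine (key.congr' ?_).const_sub _
  filter_upwards [self_mem_nhdsWithin] with s hs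
  refine (hsub _ (hDm s) (Set.prod_mono_left (Set.Ioc_subset_Ioc_right ?_))).symm
  exact_mod_cast (le_of_lt hs)

variable [IsProbabilityMeasure P]

/-- Almost surely, the atoms of a Poisson random measure with mean measure `ds ν(dx)` occur at
distinct times. -/
theorem ae_restrict_singleton_prod_eq_dirac (hν : IsLevyMeasure ν)
    (hM : IsPoissonRandomMeasure P M (volume.prod ν)) :
    ∀ᵐ ω ∂P, ∀ (t : ℝ≥0), 0 < t → ∀ n : ℕ,
      (M ω).restrict ({(t : ℝ)} ×ˢ bigJumps n) = 0 ∨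
      ∃ x ∈ bigJumps n, (M ω).restrict ({(t : ℝ)} ×ˢ bigJumps n) = Measure.dirac ((t : ℝ), x) := by
  have := hν.sigmaFinite
  let cell : ℕ → ℕ → ℕ → Set (ℝ × ℝ) := fun n k i =>
    Set.Ioc ((i : ℝ) / (k + 1)) ((i + 1 : ℝ) / (k + 1)) ×ˢ bigJumps n
  have hcm : ∀ n k i, MeasurableSet (cell n k i) := fun n k i =>
    measurableSet_Ioc.prod (measurableSet_bigJumps n)
  have hcf : ∀ n k i, (volume.prod ν) (cell n k i) ≠ ∞ := fun n k i => hν.prod_Ioc_bigJumps _ _ _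
  have hcv : ∀ n k i, (volume.prod ν) (cell n k i) =
      ENNReal.ofReal (1 / ((k : ℝ) + 1)) * ν (bigJumps n) := by
    intro n k i
    rw [Measure.prod_prod, Real.volume_Ioc]
    congr 2
    field_simp
    ring
  -- Union bound: [0, T] is cut into T(k + 1) cells, each holding two or more atoms with probability
  -- at most (ν(bigJumps n)/(k + 1))². The sum is of order 1/k, so almost surely some mesh separates
  -- all atoms.
  have hgood : ∀ n T : ℕ, ∀ᵐ ω ∂P, ∃ k : ℕ, ∀ i < T * (k + 1), M ω (cell n k i) ≤ 1 := by
    intro n T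
    have hb : ∀ k : ℕ, P {ω | ¬ ∃ k : ℕ, ∀ i < T * (k + 1), M ω (cell n k i) ≤ 1} ≤
        ENNReal.ofReal (1 / ((k : ℝ) + 1)) * (T * (ν (bigJumps n) * ν (bigJumps n))) := by
      intro k
      calc P {ω | ¬ ∃ k : ℕ, ∀ i < T * (k + 1), M ω (cell n k i) ≤ 1}
          ≤ P (⋃ i ∈ Finset.range (T * (k + 1)), {ω | ¬ M ω (cell n k i) ≤ 1}) := by
            refine measure_mono fun ω hω => ?_
            have hω' : ¬ ∃ k : ℕ, ∀ i < T * (k + 1), M ω (cell n k i) ≤ 1 := hω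
            push Not at hω'
            obtain ⟨i, hi, h⟩ := hω' k
            exact Set.mem_iUnion₂.2 ⟨i, Finset.mem_range.2 hi, not_le.2 h⟩
        _ ≤ ∑ i ∈ Finset.range (T * (k + 1)), P {ω | ¬ M ω (cell n k i) ≤ 1} :=
            measure_biUnion_finset_le _ _
        _ ≤ ∑ i ∈ Finset.range (T * (k + 1)), (ENNReal.ofReal (1 / ((k : ℝ) + 1)) * ν (bigJumps n)) *
              (ENNReal.ofReal (1 / ((k : ℝ) + 1)) * ν (bigJumps n)) := by
            refine Finset.sum_le_sum fun i _ => ?_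
            have := measure_two_le_of_poisson (hM.measurable_apply (hcm n k i))
              (hM.law _ (hcm n k i) (hcf n k i))
            rwa [ENNReal.coe_toNNReal (hcf n k i), hcv] at this
        _ = _ := by
            rw [Finset.sum_const, Finset.card_range, nsmul_eq_mul]
            have h1 : ((k + 1 : ℕ) : ℝ≥0∞) * ENNReal.ofReal (1 / ((k : ℝ) + 1)) = 1 := by
              rw [← ENNReal.ofReal_natCast, ← ENNReal.ofReal_mul (by positivity)]
              push_cast
              rw [mul_one_div_cancel (by positivity), ENNReal.ofReal_one]
            rw [Nat.cast_mul]
            calc _ = (T : ℝ≥0∞) * (((k + 1 : ℕ) : ℝ≥0∞) * ENNReal.ofReal (1 / ((k : ℝ) + 1))) *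
                  ν (bigJumps n) * (ENNReal.ofReal (1 / ((k : ℝ) + 1)) * ν (bigJumps n)) := by ring
              _ = _ := by rw [h1]; ring
    have hlim : Tendsto (fun k : ℕ => ENNReal.ofReal (1 / ((k : ℝ) + 1)) *
        (T * (ν (bigJumps n) * ν (bigJumps n)))) atTop (𝓝 0) := by
      have h1 : Tendsto (fun k : ℕ => ENNReal.ofReal (1 / ((k : ℝ) + 1))) atTop (𝓝 0) := by
        simpa using ENNReal.tendsto_ofReal (tendsto_one_div_add_atTop_nhds_zero_nat (𝕜 := ℝ))
      have hne : (T : ℝ≥0∞) * (ν (bigJumps n) * ν (bigJumps n)) ≠ ∞ :=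
        ENNReal.mul_ne_top (by simp) (ENNReal.mul_ne_top (hν.measure_bigJumps_lt_top n).ne
          (hν.measure_bigJumps_lt_top n).ne)
      simpa using ENNReal.Tendsto.mul_const h1 (Or.inr hne)
    exact le_antisymm (ge_of_tendsto' hlim hb) zero_le
  have hdir : ∀ n k i, ∀ᵐ ω ∂P, M ω (cell n k i) ≤ 1 →
      (M ω).restrict (cell n k i) = 0 ∨ ∃ q, (M ω).restrict (cell n k i) = Measure.dirac q :=
    fun n k i => hM.ae_restrict_eq_dirac (hcm n k i) (hcf n k i)
  simp_rw [← ae_all_iff] at hgood hdir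
  filter_upwards [hgood, hdir] with ω hg hd t ht n
  obtain ⟨T, hT⟩ := exists_nat_ge t
  obtain ⟨k, hk⟩ := hg n T
  have hk0 : (0 : ℝ) < (k : ℝ) + 1 := by positivity
  have hceil : 0 < ⌈(t : ℝ) * (k + 1)⌉₊ := Nat.ceil_pos.2 (by positivity)
  obtain ⟨i, hi⟩ : ∃ i, ⌈(t : ℝ) * (k + 1)⌉₊ = i + 1 := ⟨_, (Nat.succ_pred_eq_of_pos hceil).symm⟩
  have hlow : (i : ℝ) < t * (k + 1) := Nat.lt_ceil.1 (by omega)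
  have hup : (t : ℝ) * (k + 1) ≤ i + 1 := by
    have := Nat.le_ceil ((t : ℝ) * (k + 1))
    rw [hi] at this
    exact_mod_cast this
  have hiT : i < T * (k + 1) := by
    have h1 : (t : ℝ) ≤ T := by exact_mod_cast hT
    have : (i : ℝ) < T * (k + 1) := hlow.trans_le (by gcongr)
    exact_mod_cast this
  have htcell : {(t : ℝ)} ×ˢ bigJumps n ⊆ cell n k i := by
    refine Set.prod_mono_left ?_
    rw [Set.singleton_subset_iff]
    exact ⟨by rwa [div_lt_iff₀ hk0], by rwa [le_div_iff₀ hk0]⟩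
  have hsm : MeasurableSet ({(t : ℝ)} ×ˢ bigJumps n) :=
    (measurableSet_singleton _).prod (measurableSet_bigJumps n)
  have hrr : (M ω).restrict ({(t : ℝ)} ×ˢ bigJumps n) =
      ((M ω).restrict (cell n k i)).restrict ({(t : ℝ)} ×ˢ bigJumps n) := by
    rw [Measure.restrict_restrict hsm, Set.inter_eq_left.2 htcell]
  rcases hd n k i (hk i hiT) with h0 | ⟨q, hq⟩
  · left
    rw [hrr, h0, Measure.restrict_zero]
  · by_cases hqm : q ∈ {(t : ℝ)} ×ˢ bigJumps n
    · right
      obtain ⟨hq1, hq2⟩ := hqm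
      have hq1' : q.1 = t := hq1
      refine ⟨q.2, hq2, ?_⟩
      classical
      rw [hrr, hq, restrict_dirac' hsm, if_pos ⟨hq1, hq2⟩, ← hq1']
    · left
      classical
      rw [hrr, hq, restrict_dirac' hsm, if_neg hqm]

/-- The jumps of a compensated integral are limits of the jumps of the truncated integrals. -/
theorem IsCompensatedJumpIntegral.exists_seq_tendsto_jump (hν : IsLevyMeasure ν)
    (hM : IsPoissonRandomMeasure P M (volume.prod ν)) (hJ : IsCompensatedJumpIntegral P M ν J)
    {c : ℝ} (hc0 : 0 < c) (hc : ExpTail ν c) :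
    ∃ ns : ℕ → ℕ, StrictMono ns ∧ ∀ᵐ ω ∂P, ∀ t : ℝ≥0, 0 < t → ∀ e : ℝ,
      Tendsto (fun s => J t ω - J s ω) (𝓝[<] t) (𝓝 e) →
      Tendsto (fun k => ∫ p in {(t : ℝ)} ×ˢ bigJumps (ns k), p.2 ∂(M ω)) atTop (𝓝 e) := by
  have := hν.sigmaFinite
  obtain ⟨ns, hmono, hns⟩ := TendstoUCP.exists_seq_tendstoUniformlyOn hJ
  refine ⟨ns, hmono, ?_⟩
  have hint : ∀ n T : ℕ, ∀ᵐ ω ∂P,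
      IntegrableOn (fun p : ℝ × ℝ => p.2) (Set.Ioc (0 : ℝ) T ×ˢ bigJumps n) (M ω) := fun n T =>
    hM.ae_integrableOn (measurableSet_Ioc.prod (measurableSet_bigJumps n)) measurable_snd
      (integrableOn_prod_snd (integrableOn_id_bigJumps hν hc0 hc n) _ _)
  simp_rw [← ae_all_iff] at hint
  filter_upwards [hns, hint] with ω hω hiω t ht e he
  refine tendsto_jump_of_tendstoUniformlyOn ht (hω t) (fun k => ?_) he
  obtain ⟨T, hT⟩ := exists_nat_ge t
  have h1 := tendsto_setIntegral_Ioc_prod (ρ := M ω) (measurableSet_bigJumps (ns k))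
    measurable_snd ht ((hiω (ns k) T).mono_set (Set.prod_mono_left
      (Set.Ioc_subset_Ioc_right (by exact_mod_cast hT))))
  -- The compensator is linear in time and contributes no jump.
  have h2 : Tendsto (fun s : ℝ≥0 => ((t : ℝ) - s) *
      ∫ x in {x : ℝ | 1 / ((ns k : ℝ) + 1) ≤ |x| ∧ |x| < 1}, x ∂ν) (𝓝[<] t) (𝓝 0) := by
    have : Tendsto (fun s : ℝ≥0 => (t : ℝ) - s) (𝓝[<] t) (𝓝 ((t : ℝ) - t)) :=
      (NNReal.continuous_coe.tendsto t).mono_left nhdsWithin_le_nhds |>.const_sub _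
    simpa using this.mul_const (∫ x in {x : ℝ | 1 / ((ns k : ℝ) + 1) ≤ |x| ∧ |x| < 1}, x ∂ν)
  have h3 := h1.sub h2
  rw [sub_zero] at h3
  refine h3.congr fun s => ?_
  ring

theorem IsCompensatedJumpIntegral.jump_eq_zero (hν : IsLevyMeasure ν)
    (hM : IsPoissonRandomMeasure P M (volume.prod ν)) (hJ : IsCompensatedJumpIntegral P M ν J)
    {c : ℝ} (hc0 : 0 < c) (hc : ExpTail ν c) :
    ∀ᵐ ω ∂P, ∀ t : ℝ≥0, 0 < t → ∀ e : ℝ, (∀ n, M ω ({(t : ℝ)} ×ˢ bigJumps n) = 0) →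
      Tendsto (fun s => J t ω - J s ω) (𝓝[<] t) (𝓝 e) → e = 0 := by
  obtain ⟨ns, -, hns⟩ := hJ.exists_seq_tendsto_jump hν hM hc0 hc
  filter_upwards [hns] with ω hω t ht e h0 he
  have h1 := hω t ht e he
  have h2 : ∀ k, ∫ p in {(t : ℝ)} ×ˢ bigJumps (ns k), p.2 ∂(M ω) = 0 := fun k => by
    rw [Measure.restrict_eq_zero.2 (h0 _), integral_zero_measure]
  simp_rw [h2] at h1
  exact (tendsto_nhds_unique h1 tendsto_const_nhds)

/-- A time slice carries at most one atom at each truncation level. Once that atom is large enough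
to be retained, the truncated jump equals its size, so a nonzero jump e comes from an atom at (t,
e). The exceptional null set is chosen before g and t, which allows random jump times later. -/
theorem IsCompensatedJumpIntegral.comp_jump_le (hν : IsLevyMeasure ν)
    (hM : IsPoissonRandomMeasure P M (volume.prod ν)) (hJ : IsCompensatedJumpIntegral P M ν J)
    {c : ℝ} (hc0 : 0 < c) (hc : ExpTail ν c) :
    ∀ᵐ ω ∂P, ∀ g : ℝ → ℝ≥0∞, Measurable g → ∀ t : ℝ≥0, 0 < t → ∀ e : ℝ, e ≠ 0 →
      Tendsto (fun s => J t ω - J s ω) (𝓝[<] t) (𝓝 e) →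
      g e ≤ ∫⁻ p in {(t : ℝ)} ×ˢ Set.univ, g p.2 ∂(M ω) := by
  obtain ⟨ns, hmono, hns⟩ := hJ.exists_seq_tendsto_jump hν hM hc0 hc
  filter_upwards [hns, ae_restrict_singleton_prod_eq_dirac hν hM] with ω hω hdir g hg t ht e he0 he
  have h1 := hω t ht e he
  have hsm : ∀ n, MeasurableSet ({(t : ℝ)} ×ˢ bigJumps n) := fun n =>
    (measurableSet_singleton _).prod (measurableSet_bigJumps n)
  by_cases hall : ∀ n, (M ω).restrict ({(t : ℝ)} ×ˢ bigJumps n) = 0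
  · simp_rw [hall, integral_zero_measure] at h1
    exact absurd (tendsto_nhds_unique h1 tendsto_const_nhds) he0
  · push Not at hall
    obtain ⟨n₀, hn₀⟩ := hall
    obtain ⟨x₀, hx₀, hd₀⟩ := (hdir t ht n₀).resolve_left hn₀
    have hev : ∀ n ≥ n₀, ∫ p in {(t : ℝ)} ×ˢ bigJumps n, p.2 ∂(M ω) = x₀ := by
      intro n hn
      have hsub : {(t : ℝ)} ×ˢ bigJumps n₀ ⊆ {(t : ℝ)} ×ˢ bigJumps n :=
        Set.prod_mono_right (bigJumps_mono hn)
      have hrr : (M ω).restrict ({(t : ℝ)} ×ˢ bigJumps n₀) =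
          ((M ω).restrict ({(t : ℝ)} ×ˢ bigJumps n)).restrict ({(t : ℝ)} ×ˢ bigJumps n₀) := by
        rw [Measure.restrict_restrict (hsm n₀), Set.inter_eq_left.2 hsub]
      rcases hdir t ht n with h0 | ⟨x, hx, hd⟩
      · rw [h0, Measure.restrict_zero] at hrr
        exact absurd hrr hn₀
      · classical
        rw [hd, restrict_dirac' (hsm n₀)] at hrr
        split_ifs at hrr with hmem
        · rw [hd₀, dirac_eq_dirac_iff] at hrr
          rw [hd, integral_dirac]
          exact (congrArg Prod.snd hrr).symm
        · exact absurd hrr hn₀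
    have hex : e = x₀ := by
      refine tendsto_nhds_unique h1 (tendsto_const_nhds.congr' ?_)
      filter_upwards [eventually_ge_atTop n₀] with k hk
      exact (hev _ (hk.trans (hmono.le_apply))).symm
    calc g e = ∫⁻ p in {(t : ℝ)} ×ˢ bigJumps n₀, g p.2 ∂(M ω) := by
          rw [hd₀, lintegral_dirac' _ (by fun_prop), hex]
      _ ≤ _ := lintegral_mono_set (Set.prod_mono_right (Set.subset_univ _))

/-- Sums over distinct jump times are bounded by the integral against the random measure. -/
theorem tsum_jump_le {ρ : Measure (ℝ × ℝ)} {g : ℝ → ℝ≥0∞} (T : ℝ≥0) (τ : ℕ → ℝ≥0∞) (x : ℕ → ℝ)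
    (hτ : ∀ i j, τ i = τ j → τ i ≠ ∞ → i = j)
    (h : ∀ j, τ j ≤ T → 0 < τ j ∧ g (x j) ≤ ∫⁻ p in {((τ j).toReal)} ×ˢ Set.univ, g p.2 ∂ρ) :
    ∑' j, (if τ j ≤ T then g (x j) else 0) ≤
      ∫⁻ p in Set.Ioc (0 : ℝ) T ×ˢ Set.univ, g p.2 ∂ρ := by
  set D : ℕ → Set (ℝ × ℝ) := fun j => if τ j ≤ T then {((τ j).toReal)} ×ˢ Set.univ else ∅ with hD
  have hDm : ∀ j, MeasurableSet (D j) := fun j => by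
    simp only [hD]
    split_ifs
    · exact (measurableSet_singleton _).prod MeasurableSet.univ
    · exact MeasurableSet.empty
  have hdisj : Pairwise (Function.onFun Disjoint D) := by
    intro i j hij
    simp only [Function.onFun, hD]
    split_ifs with hi hj
    · refine Set.disjoint_left.2 fun p hp hq => hij ?_
      have hti : τ i ≠ ∞ := (hi.trans_lt ENNReal.coe_lt_top).ne
      have htj : τ j ≠ ∞ := (hj.trans_lt ENNReal.coe_lt_top).ne
      have hp1 : p.1 = (τ i).toReal := hp.1
      have hq1 : p.1 = (τ j).toReal := hq.1
      exact hτ i j ((ENNReal.toReal_eq_toReal_iff' hti htj).1 (hp1.symm.trans hq1)) hti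
    all_goals simp
  calc ∑' j, (if τ j ≤ T then g (x j) else 0)
      ≤ ∑' j, ∫⁻ p in D j, g p.2 ∂ρ := by
        refine ENNReal.tsum_le_tsum fun j => ?_
        simp only [hD]
        split_ifs with hj
        · exact (h j hj).2
        · exact zero_le
    _ = ∫⁻ p in ⋃ j, D j, g p.2 ∂ρ := (lintegral_iUnion hDm hdisj _).symm
    _ ≤ _ := by
        refine lintegral_mono_set (Set.iUnion_subset fun j => ?_)
        simp only [hD]
        split_ifs with hj
        · refine Set.prod_mono_left ?_
          rw [Set.singleton_subset_iff]
          have htj : τ j ≠ ∞ := (hj.trans_lt ENNReal.coe_lt_top).ne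
          refine ⟨ENNReal.toReal_pos (h j hj).1.ne' htj, ?_⟩
          exact ENNReal.toReal_mono ENNReal.coe_ne_top hj
        · exact Set.empty_subset _

end Jumps
end LevyMAP
end

/-! ### Exponential moments of Itô integrals -/

noncomputable section

namespace LevyMAP

section Ito

variable {Ω : Type*}

theorem generateFrom_inter_eq_sup (m₁ m₂ : MeasurableSpace Ω) :
    m₁ ⊔ m₂ = MeasurableSpace.generateFrom
      {s | ∃ u v, MeasurableSet[m₁] u ∧ MeasurableSet[m₂] v ∧ s = u ∩ v} := by
  refine le_antisymm (sup_le ?_ ?_) (MeasurableSpace.generateFrom_le ?_)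
  · intro u hu
    exact MeasurableSpace.measurableSet_generateFrom
      ⟨u, Set.univ, hu, @MeasurableSet.univ _ m₂, (Set.inter_univ u).symm⟩
  · intro v hv
    exact MeasurableSpace.measurableSet_generateFrom
      ⟨Set.univ, v, @MeasurableSet.univ _ m₁, hv, (Set.univ_inter v).symm⟩
  · rintro _ ⟨u, v, hu, hv, rfl⟩
    exact MeasurableSet.inter ((le_sup_left : m₁ ≤ m₁ ⊔ m₂) u hu)
      ((le_sup_right : m₂ ≤ m₁ ⊔ m₂) v hv)

theorem isPiSystem_inter (m₁ m₂ : MeasurableSpace Ω) :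
    IsPiSystem {s | ∃ u v, MeasurableSet[m₁] u ∧ MeasurableSet[m₂] v ∧ s = u ∩ v} := by
  rintro _ ⟨u, v, hu, hv, rfl⟩ _ ⟨u', v', hu', hv', rfl⟩ -
  exact ⟨u ∩ u', v ∩ v', hu.inter hu', hv.inter hv', Set.inter_inter_inter_comm _ _ _ _⟩

variable {𝒢 : MeasurableSpace Ω} {mΩ : MeasurableSpace Ω} {P : Measure Ω}

/-- If `m₂ ⊔ m₃` is independent of `m₁`, and `m₂` of `m₃`, then `m₂` is independent of `m₁ ⊔ m₃`. -/
theorem indep_sup_of_indep [IsProbabilityMeasure P] {m₁ m₂ m₃ m : MeasurableSpace Ω}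
    (h₁ : m₁ ≤ mΩ) (hm : m ≤ mΩ) (h2m : m₂ ≤ m) (h3m : m₃ ≤ m) (h : Indep m m₁ P)
    (h' : Indep m₂ m₃ P) : Indep m₂ (m₁ ⊔ m₃) P := by
  refine IndepSets.indep (h2m.trans hm) (sup_le h₁ (h3m.trans hm))
    (@MeasurableSpace.isPiSystem_measurableSet Ω m₂) (isPiSystem_inter m₁ m₃)
    (@MeasurableSpace.generateFrom_measurableSet Ω m₂).symm (generateFrom_inter_eq_sup m₁ m₃) ?_
  rw [IndepSets_iff]
  rintro s _ hs ⟨u, v, hu, hv, rfl⟩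
  rw [Indep_iff] at h h'
  have e1 : s ∩ (u ∩ v) = (s ∩ v) ∩ u := by
    rw [Set.inter_assoc, Set.inter_comm v u]
  rw [e1, h _ _ ((h2m s hs).inter (h3m v hv)) hu, h' _ _ hs hv, Set.inter_comm u v,
    h _ _ (h3m v hv) hu, mul_assoc]

theorem measurable_processSigma (X : ℝ≥0 → Ω → ℝ) (t : ℝ≥0) : Measurable[processSigma X] (X t) :=
  (comap_measurable (X t)).mono (le_iSup (fun t => MeasurableSpace.comap (X t) inferInstance) t)
    le_rfl

theorem measurable_processSigmaUpTo (X : ℝ≥0 → Ω → ℝ) {s t : ℝ≥0} (h : s ≤ t) :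
    Measurable[processSigmaUpTo X t] (X s) :=
  (comap_measurable (X s)).mono
    (le_iSup (fun s : Set.Iic t => MeasurableSpace.comap (X s) inferInstance) ⟨s, h⟩) le_rfl

theorem processSigma_le {X : ℝ≥0 → Ω → ℝ} {m : MeasurableSpace Ω} (hX : ∀ t, Measurable (X t)) :
    processSigma X ≤ m := iSup_le fun t => (hX t).comap_le

theorem processSigmaUpTo_le {X : ℝ≥0 → Ω → ℝ} {m : MeasurableSpace Ω} {t : ℝ≥0}
    (hX : ∀ s ≤ t, Measurable (X s)) : processSigmaUpTo X t ≤ m :=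
  iSup_le fun s => (hX s s.2).comap_le

theorem processSigmaUpTo_mono (X : ℝ≥0 → Ω → ℝ) {s t : ℝ≥0} (h : s ≤ t) :
    processSigmaUpTo X s ≤ processSigmaUpTo X t :=
  processSigmaUpTo_le fun _ hr => measurable_processSigmaUpTo X (hr.trans h)

theorem processSigmaUpTo_le_processSigma (X : ℝ≥0 → Ω → ℝ) (t : ℝ≥0) :
    processSigmaUpTo X t ≤ processSigma X :=
  processSigmaUpTo_le fun s _ => measurable_processSigma X s

variable {W : ℝ≥0 → Ω → ℝ}

/-- The increment is independent of the Brownian past, and the whole Brownian path is independent of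
𝒢. Together these give independence from the enlarged past. -/
theorem indep_increment [IsProbabilityMeasure P] (hW : IsBrownianReal W P)
    (hWm : ∀ t, Measurable (W t)) (h𝒢 : 𝒢 ≤ mΩ) (hind : Indep (processSigma W) 𝒢 P) {a b : ℝ≥0}
    (hab : a ≤ b) : Indep (MeasurableSpace.comap (fun ω => W b ω - W a ω) inferInstance)
      (𝒢 ⊔ processSigmaUpTo W a) P := by
  refine indep_sup_of_indep h𝒢 (processSigma_le hWm) ?_ (processSigmaUpTo_le_processSigma W a) hind ?_
  · exact ((measurable_processSigma W b).sub (measurable_processSigma W a)).comap_le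
  · have h := hW.toIsPreBrownianReal.indepFun_shift a
    rw [IndepFun_iff_Indep] at h
    refine indep_of_indep_of_le_left (indep_of_indep_of_le_right h ?_) ?_
    · refine processSigmaUpTo_le fun s hs => ?_
      have h1 : Measurable fun x : Set.Iic a → ℝ => x ⟨s, hs⟩ := measurable_pi_apply _
      exact h1.comp (comap_measurable _)
    · refine Measurable.comap_le ?_
      have h1 : Measurable fun x : ℝ≥0 → ℝ => x (b - a) := measurable_pi_apply _
      have h2 := h1.comp (comap_measurable (fun ω t => W (a + t) ω - W a ω))
      simpa [Function.comp_def, add_tsub_cancel_of_le hab] using h2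

theorem lintegral_exp_increment (hW : IsBrownianReal W P) {a b : ℝ≥0} (hab : a ≤ b) (c : ℝ) :
    ∫⁻ ω, ENNReal.ofReal (Real.exp (c * (W b ω - W a ω) - c ^ 2 / 2 * (b - a))) ∂P = 1 := by
  have hlaw := hW.toIsPreBrownianReal.hasLaw_sub b a
  have hmgf := mgf_gaussianReal hlaw.map_eq c
  have hint : Integrable (fun ω => Real.exp (c * (W b ω - W a ω))) P := by
    have h1 := integrable_exp_mul_gaussianReal (μ := 0) (v := nndist b.1 a.1) c
    rw [← hlaw.map_eq, integrable_map_measure (by fun_prop) hlaw.aemeasurable] at h1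
    exact h1
  have hnd : ((nndist b.1 a.1 : ℝ≥0) : ℝ) = b - a := by
    rw [coe_nndist, Real.dist_eq, abs_of_nonneg]
    · rfl
    · exact sub_nonneg.2 hab
  rw [hnd] at hmgf
  have hmgf' : ∫ ω, Real.exp (c * (W b ω - W a ω)) ∂P = Real.exp (c ^ 2 / 2 * (b - a)) := by
    have : mgf (W b - W a) P c = ∫ ω, Real.exp (c * (W b ω - W a ω)) ∂P := rfl
    rw [← this, hmgf]
    congr 1
    ring
  have hsplit : ∀ ω, Real.exp (c * (W b ω - W a ω) - c ^ 2 / 2 * (b - a)) =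
      Real.exp (c * (W b ω - W a ω)) * Real.exp (-(c ^ 2 / 2 * (b - a))) := fun ω => by
    rw [← Real.exp_add]; rfl
  simp_rw [hsplit]
  rw [← ofReal_integral_eq_lintegral_ofReal (hint.mul_const _)
    (Eventually.of_forall fun ω => by positivity), integral_mul_const, hmgf', ← Real.exp_add]
  simp

namespace SimpleIntegrand

variable {G : ℝ≥0 → MeasurableSpace Ω}

/-- The integral of the square of a simple integrand over `[0, t]`. -/
def energy (H : SimpleIntegrand G) (t : ℝ≥0) (ω : Ω) : ℝ :=
  ∑ i ∈ Finset.range H.len, H.val i ω ^ 2 * ((min t (H.time (i + 1)) : ℝ≥0) - (min t (H.time i) : ℝ≥0))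

theorem measurable_val (H : SimpleIntegrand G) (hG : ∀ t, G t ≤ mΩ) (i : ℕ) : Measurable (H.val i) :=
  (H.meas i).mono (hG _) le_rfl

theorem measurable_integral (H : SimpleIntegrand G) (hG : ∀ t, G t ≤ mΩ)
    (hWm : ∀ t, Measurable (W t)) (t : ℝ≥0) : Measurable (H.integral W t) := by
  have := H.measurable_val hG
  unfold integral
  fun_prop

theorem measurable_energy (H : SimpleIntegrand G) (hG : ∀ t, G t ≤ mΩ) (t : ℝ≥0) :
    Measurable (H.energy t) := by
  have := H.measurable_val hG
  unfold energy
  fun_prop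

/-- The stochastic exponential of a simple integrand has mean one: conditionally on the past, each
factor is the normalised exponential of a Gaussian increment. Factors are removed one at a time, the
latest first. -/
theorem lintegral_exp_integral [IsProbabilityMeasure P] (H : SimpleIntegrand G)
    (hW : IsBrownianReal W P) (hWm : ∀ t, Measurable (W t)) (h𝒢 : 𝒢 ≤ mΩ)
    (hind : Indep (processSigma W) 𝒢 P) (hG : ∀ t, G t ≤ 𝒢 ⊔ processSigmaUpTo W t) (t : ℝ≥0)
    (c : ℝ) :
    ∫⁻ ω, ENNReal.ofReal (Real.exp (c * H.integral W t ω - c ^ 2 / 2 * H.energy t ω)) ∂P = 1 := by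
  set a : ℕ → ℝ≥0 := fun i => min t (H.time i) with ha
  have hamono : ∀ i, a i ≤ a (i + 1) := fun i => min_le_min_left _ (H.mono (Nat.le_succ i))
  set f : ℕ → Ω → ℝ := fun i ω =>
    (c * H.val i ω) * (W (a (i + 1)) ω - W (a i) ω) - (c * H.val i ω) ^ 2 / 2 * (a (i + 1) - a i) with hf
  have hGm : ∀ s, 𝒢 ⊔ processSigmaUpTo W s ≤ mΩ := fun s =>
    sup_le h𝒢 (processSigmaUpTo_le fun r _ => hWm r)
  have hmono : ∀ {r s : ℝ≥0}, r ≤ s → 𝒢 ⊔ processSigmaUpTo W r ≤ 𝒢 ⊔ processSigmaUpTo W s :=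
    fun h => sup_le_sup_left (processSigmaUpTo_mono W h) _
  have hWa : ∀ {r s : ℝ≥0}, r ≤ s → Measurable[𝒢 ⊔ processSigmaUpTo W s] (W r) := fun h =>
    (measurable_processSigmaUpTo W h).mono le_sup_right le_rfl
  -- An integrand value attached to a time beyond t need not be known at the truncated time, but
  -- then its interval is degenerate and contributes nothing.
  have hcase : ∀ i, Measurable[𝒢 ⊔ processSigmaUpTo W (a i)] (H.val i) ∨ a (i + 1) = a i := by
    intro i
    rcases le_total (H.time i) t with h | h
    · left
      have : a i = H.time i := min_eq_right h
      rw [this]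
      exact (H.meas i).mono (hG _) le_rfl
    · right
      simp only [ha]
      rw [min_eq_left h, min_eq_left (h.trans (H.mono (Nat.le_succ i)))]
  have hfm : ∀ i, Measurable[𝒢 ⊔ processSigmaUpTo W (a (i + 1))] (f i) := by
    intro i
    rcases hcase i with h | h
    · have h1 : Measurable[𝒢 ⊔ processSigmaUpTo W (a (i + 1))] (H.val i) :=
        h.mono (hmono (hamono i)) le_rfl
      have h2 := hWa (le_refl (a (i + 1)))
      have h3 := hWa (hamono i)
      simp only [hf]
      exact ((h1.const_mul c).mul (h2.sub h3)).sub ((((h1.const_mul c).pow_const 2).div_const 2).mul_const _)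
    · simp only [hf, h, sub_self, mul_zero]
      exact measurable_const
  have hind' : ∀ k, ∫⁻ ω, ENNReal.ofReal (Real.exp (∑ i ∈ Finset.range k, f i ω)) ∂P = 1 := by
    intro k
    induction k with
    | zero => simp
    | succ k ih =>
      rcases hcase k with h | h
      -- The first coordinate carries the new increment, the second everything known before it, so
      -- that the past can be frozen.
      · set F : Ω × Ω → ℝ≥0∞ := fun p =>
          ENNReal.ofReal (Real.exp (∑ i ∈ Finset.range k, f i p.2)) *
          ENNReal.ofReal (Real.exp ((c * H.val k p.2) * (W (a (k + 1)) p.1 - W (a k) p.1) -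
            (c * H.val k p.2) ^ 2 / 2 * (a (k + 1) - a k))) with hF
        have hI := indep_increment hW hWm h𝒢 hind (hamono k)
        have hm1 : MeasurableSpace.comap (fun ω => W (a (k + 1)) ω - W (a k) ω) inferInstance ≤ mΩ :=
          ((hWm _).sub (hWm _)).comap_le
        have hFm : Measurable[(MeasurableSpace.comap (fun ω => W (a (k + 1)) ω - W (a k) ω)
            inferInstance).prod (𝒢 ⊔ processSigmaUpTo W (a k))] F := by
          have e1 : Measurable[(MeasurableSpace.comap (fun ω => W (a (k + 1)) ω - W (a k) ω)
              inferInstance).prod (𝒢 ⊔ processSigmaUpTo W (a k))]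
              fun p : Ω × Ω => W (a (k + 1)) p.1 - W (a k) p.1 :=
            (comap_measurable (fun ω => W (a (k + 1)) ω - W (a k) ω)).comp
              (@measurable_fst _ _ (_) (_))
          have e2 : Measurable[(MeasurableSpace.comap (fun ω => W (a (k + 1)) ω - W (a k) ω)
              inferInstance).prod (𝒢 ⊔ processSigmaUpTo W (a k))]
              fun p : Ω × Ω => H.val k p.2 := h.comp (@measurable_snd _ _ (_) (_))
          have e3 : Measurable[(MeasurableSpace.comap (fun ω => W (a (k + 1)) ω - W (a k) ω)
              inferInstance).prod (𝒢 ⊔ processSigmaUpTo W (a k))]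
              fun p : Ω × Ω => ∑ i ∈ Finset.range k, f i p.2 := by
            refine Finset.measurable_fun_sum _ fun i hi => ?_
            have hik : a (i + 1) ≤ a k :=
              monotone_nat_of_le_succ hamono (Nat.succ_le_of_lt (Finset.mem_range.1 hi))
            exact ((hfm i).mono (hmono hik) le_rfl).comp (@measurable_snd _ _ (_) (_))
          exact (ENNReal.measurable_ofReal.comp (Real.measurable_exp.comp e3)).mul
            (ENNReal.measurable_ofReal.comp (Real.measurable_exp.comp
              (((e2.const_mul c).mul e1).sub ((((e2.const_mul c).pow_const 2).div_const 2).mul_const _))))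
        have := lintegral_diag_of_indep hm1 (hGm _) hI hFm
        calc ∫⁻ ω, ENNReal.ofReal (Real.exp (∑ i ∈ Finset.range (k + 1), f i ω)) ∂P
            = ∫⁻ ω, F (ω, ω) ∂P := by
              refine lintegral_congr fun ω => ?_
              simp only [hF]
              rw [← ENNReal.ofReal_mul (Real.exp_pos _).le, ← Real.exp_add,
                Finset.sum_range_succ]
          _ = ∫⁻ ω', ENNReal.ofReal (Real.exp (∑ i ∈ Finset.range k, f i ω')) * 1 ∂P := by
              rw [this]
              refine lintegral_congr fun ω' => ?_
              simp only [hF]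
              rw [lintegral_const_mul' _ _ ENNReal.ofReal_ne_top,
                lintegral_exp_increment hW (hamono k)]
          _ = 1 := by simpa using ih
      · have : ∀ ω, f k ω = 0 := fun ω => by simp [hf, h]
        simp_rw [Finset.sum_range_succ, this, add_zero]
        exact ih
  rw [← hind' H.len]
  refine lintegral_congr fun ω => ?_
  congr 2
  rw [integral, energy, Finset.mul_sum, Finset.mul_sum, ← Finset.sum_sub_distrib]
  refine Finset.sum_congr rfl fun i _ => ?_
  simp only [hf, ha]
  ring

/-- The intervals are pairwise disjoint, so the square of the sum has no cross terms. -/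
theorem lintegral_eval_sq (H : SimpleIntegrand G) (t : ℝ≥0) (ω : Ω) :
    ∫⁻ s in Set.Ioc (0 : ℝ) t, ENNReal.ofReal (H.eval s.toNNReal ω ^ 2) =
      ENNReal.ofReal (H.energy t ω) := by
  have hmono : ∀ i, (min t (H.time i) : ℝ≥0) ≤ min t (H.time (i + 1)) := fun i =>
    min_le_min_left _ (H.mono (Nat.le_succ i))
  have hsq : ∀ s : ℝ≥0, ENNReal.ofReal (H.eval s ω ^ 2) = ∑ i ∈ Finset.range H.len,
      (Set.Ioc (H.time i) (H.time (i + 1))).indicator (fun _ => ENNReal.ofReal (H.val i ω ^ 2)) s := by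
    intro s
    by_cases hex : ∃ i ∈ Finset.range H.len, s ∈ Set.Ioc (H.time i) (H.time (i + 1))
    · obtain ⟨i, hi, his⟩ := hex
      have hne : ∀ j, j ≠ i → s ∉ Set.Ioc (H.time j) (H.time (j + 1)) := by
        intro j hji hj
        rcases lt_or_gt_of_ne hji with h | h
        · have := H.mono (Nat.succ_le_of_lt h)
          exact absurd (hj.2.trans this) (not_le.2 his.1)
        · have := H.mono (Nat.succ_le_of_lt h)
          exact absurd (his.2.trans this) (not_le.2 hj.1)
      rw [eval, Finset.sum_eq_single_of_mem i hi, Finset.sum_eq_single_of_mem i hi,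
        Set.indicator_of_mem his, Set.indicator_of_mem his]
      · exact fun j _ hj => Set.indicator_of_notMem (hne j hj) _
      · exact fun j _ hj => Set.indicator_of_notMem (hne j hj) _
    · push Not at hex
      rw [eval, Finset.sum_eq_zero, Finset.sum_eq_zero]
      · simp
      · exact fun j hj => Set.indicator_of_notMem (hex j hj) _
      · exact fun j hj => Set.indicator_of_notMem (hex j hj) _
  have hset : ∀ i, Set.Ioc (0 : ℝ) t ∩ Real.toNNReal ⁻¹' Set.Ioc (H.time i) (H.time (i + 1)) =
      Set.Ioc ((min t (H.time i) : ℝ≥0) : ℝ) ((min t (H.time (i + 1)) : ℝ≥0) : ℝ) := by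
    intro i
    ext s
    simp only [Set.mem_inter_iff, Set.mem_Ioc, Set.mem_preimage, NNReal.coe_min,
      le_min_iff, min_lt_iff]
    rw [Real.lt_toNNReal_iff_coe_lt, Real.toNNReal_le_iff_le_coe]
    constructor
    · rintro ⟨⟨h1, h2⟩, h3, h4⟩
      exact ⟨Or.inr h3, h2, h4⟩
    · rintro ⟨h1, h2, h3⟩
      have h4 : (H.time i : ℝ) < s := h1.resolve_left (not_lt.2 h2)
      exact ⟨⟨lt_of_le_of_lt (H.time i).2 h4, h2⟩, h4, h3⟩
  have hmeas : ∀ i, MeasurableSet (Real.toNNReal ⁻¹' Set.Ioc (H.time i) (H.time (i + 1))) := fun i =>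
    measurable_real_toNNReal measurableSet_Ioc
  calc ∫⁻ s in Set.Ioc (0 : ℝ) t, ENNReal.ofReal (H.eval s.toNNReal ω ^ 2)
      = ∫⁻ s in Set.Ioc (0 : ℝ) t, ∑ i ∈ Finset.range H.len,
          (Real.toNNReal ⁻¹' Set.Ioc (H.time i) (H.time (i + 1))).indicator
            (fun _ => ENNReal.ofReal (H.val i ω ^ 2)) s := by
        refine lintegral_congr fun s => ?_
        rw [hsq]
        rfl
    _ = ∑ i ∈ Finset.range H.len, ENNReal.ofReal (H.val i ω ^ 2) *
          ENNReal.ofReal ((min t (H.time (i + 1)) : ℝ≥0) - (min t (H.time i) : ℝ≥0)) := by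
        rw [lintegral_finsetSum _ fun i _ => measurable_const.indicator (hmeas i)]
        refine Finset.sum_congr rfl fun i _ => ?_
        rw [lintegral_indicator_const (hmeas i), Measure.restrict_apply (hmeas i), Set.inter_comm,
          hset, Real.volume_Ioc]
    _ = _ := by
        rw [energy, ENNReal.ofReal_sum_of_nonneg]
        · exact Finset.sum_congr rfl fun i _ => (ENNReal.ofReal_mul (sq_nonneg _)).symm
        · intro i _
          refine mul_nonneg (sq_nonneg _) (sub_nonneg.2 ?_)
          exact_mod_cast hmono i

theorem continuous_integral (H : SimpleIntegrand G) {ω : Ω} (hW : Continuous (W · ω)) :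
    Continuous fun t => H.integral W t ω := by
  unfold integral
  refine continuous_finsetSum _ fun i _ => continuous_const.mul ?_
  exact (hW.comp (continuous_id.min continuous_const)).sub
    (hW.comp (continuous_id.min continuous_const))

end SimpleIntegrand

variable {G : ℝ≥0 → MeasurableSpace Ω} {H I : ℝ≥0 → Ω → ℝ}

theorem IsItoIntegral.ae_continuous (hI : IsItoIntegral P G W H I) (hW : IsBrownianReal W P) :
    ∀ᵐ ω ∂P, Continuous (I · ω) := by
  obtain ⟨Hn, -, hu⟩ := hI
  obtain ⟨ns, -, hns⟩ := hu.exists_seq_tendstoUniformlyOn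
  filter_upwards [hns, hW.cont] with ω hω hc
  exact continuous_of_tendstoUniformlyOn_Iic (fun k => (Hn (ns k)).continuous_integral hc) hω

theorem exists_seq_tendsto_zero_ae {D : ℕ → Ω → ℝ≥0∞}
    (h : ∀ ε > 0, Tendsto (fun n => P {ω | ε ≤ D n ω}) atTop (𝓝 0)) :
    ∃ ns : ℕ → ℕ, StrictMono ns ∧ ∀ᵐ ω ∂P, Tendsto (fun k => D (ns k) ω) atTop (𝓝 0) := by
  have hev : ∀ k : ℕ, ∀ᶠ n in atTop, P {ω | (1 / 2 : ℝ≥0∞) ^ k ≤ D n ω} ≤ (1 / 2 : ℝ≥0∞) ^ k :=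
    fun k => (h _ (ENNReal.pow_pos (by simp) k)).eventually_le_const (ENNReal.pow_pos (by simp) _)
  obtain ⟨ns, hns, hP⟩ := extraction_forall_of_eventually hev
  refine ⟨ns, hns, ?_⟩
  have hsum : ∑' k, P {ω | (1 / 2 : ℝ≥0∞) ^ k ≤ D (ns k) ω} ≠ ∞ := by
    refine ne_top_of_le_ne_top ?_ (ENNReal.tsum_le_tsum hP)
    rw [ENNReal.tsum_geometric]
    norm_num
  filter_upwards [ae_eventually_notMem hsum] with ω hω
  have hlim : Tendsto (fun k : ℕ => (1 / 2 : ℝ≥0∞) ^ k) atTop (𝓝 0) :=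
    ENNReal.tendsto_pow_atTop_nhds_zero_of_lt_one (by simp)
  refine tendsto_of_tendsto_of_tendsto_of_le_of_le' tendsto_const_nhds hlim
    (Eventually.of_forall fun _ => zero_le) ?_
  filter_upwards [hω] with k hk
  exact (not_le.1 hk).le

/-- Exponential bound for an Itô integral on the event that the quadratic variation is bounded. -/
theorem IsItoIntegral.hasExpMoment [IsProbabilityMeasure P] (hI : IsItoIntegral P G W H I)
    (hW : IsBrownianReal W P) (hWm : ∀ t, Measurable (W t)) (h𝒢 : 𝒢 ≤ mΩ)
    (hind : Indep (processSigma W) 𝒢 P) (hG : ∀ t, G t ≤ 𝒢 ⊔ processSigmaUpTo W t)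
    (hH : ∀ ω, Measurable fun s : ℝ => H s.toNNReal ω) (t : ℝ≥0) :
    AEMeasurable (I t) P ∧ ∀ (A : Set Ω) (N : ℝ≥0), MeasurableSet A →
      (∀ ω ∈ A, ∫⁻ s in Set.Ioc (0 : ℝ) t, ENNReal.ofReal (H s.toNNReal ω ^ 2) ≤ N) →
      HasExpMoment (I t) (P.restrict A) := by
  obtain ⟨Hn, hD, hu⟩ := hI
  have hGm : ∀ s, G s ≤ mΩ := fun s =>
    (hG s).trans (sup_le h𝒢 (processSigmaUpTo_le fun r _ => hWm r))
  obtain ⟨ns, hnsm, hns⟩ := hu.exists_seq_tendstoUniformlyOn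
  obtain ⟨ms, hmsm, hms⟩ := exists_seq_tendsto_zero_ae (P := P) (D := fun k ω =>
    ∫⁻ s in Set.Ioc (0 : ℝ) t, ENNReal.ofReal (((Hn (ns k)).eval s.toNNReal ω - H s.toNNReal ω) ^ 2))
    (fun ε hε => (hD t ε hε).comp hnsm.tendsto_atTop)
  have hlim : ∀ᵐ ω ∂P, Tendsto (fun k => (Hn (ns (ms k))).integral W t ω) atTop (𝓝 (I t ω)) := by
    filter_upwards [hns] with ω hω
    exact (tendsto_of_tendstoUniformlyOn_Iic hω t).comp hmsm.tendsto_atTop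
  have hmeas : AEMeasurable (I t) P := aemeasurable_of_tendsto_metrizable_ae atTop
    (fun k => ((Hn (ns (ms k))).measurable_integral hGm hWm t).aemeasurable) hlim
  refine ⟨hmeas, fun A N hA hAN => ?_⟩
  have hmain : ∀ c : ℝ, ∫⁻ ω in A, ENNReal.ofReal (Real.exp (c * I t ω)) ∂P < ∞ := by
    intro c
    -- On A the energies of the approximations are at most 2N up to a vanishing error, so their
    -- compensators c²/2 · energy stay below c²N in the limit. Fatou is then applied to stochastic
    -- exponentials of mean one.
    have hpt : ∀ᵐ ω ∂P, ω ∈ A → ENNReal.ofReal (Real.exp (c * I t ω - c ^ 2 * N)) ≤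
        liminf (fun k => ENNReal.ofReal (Real.exp (c * (Hn (ns (ms k))).integral W t ω -
          c ^ 2 / 2 * (Hn (ns (ms k))).energy t ω))) atTop := by
      filter_upwards [hlim, hms] with ω h1 h2 hωA
      set D : ℕ → ℝ≥0∞ := fun k => ∫⁻ s in Set.Ioc (0 : ℝ) t, ENNReal.ofReal
        (((Hn (ns (ms k))).eval s.toNNReal ω - H s.toNNReal ω) ^ 2) with hDdef
      have h2' : Tendsto (fun k => (D k).toReal) atTop (𝓝 0) := by
        have := (ENNReal.tendsto_toReal ENNReal.zero_ne_top).comp h2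
        simpa [Function.comp_def] using this
      have hDfin : ∀ᶠ k in atTop, D k < ∞ := h2.eventually_lt_const (by simp)
      -- From a² ≤ 2b² + 2(a - b)², integrated in time.
      have hen : ∀ᶠ k in atTop, (Hn (ns (ms k))).energy t ω ≤ 2 * N + 2 * (D k).toReal := by
        filter_upwards [hDfin] with k hk
        have h3 : ENNReal.ofReal ((Hn (ns (ms k))).energy t ω) ≤ 2 * N + 2 * D k := by
          rw [← SimpleIntegrand.lintegral_eval_sq]
          calc ∫⁻ s in Set.Ioc (0 : ℝ) t, ENNReal.ofReal ((Hn (ns (ms k))).eval s.toNNReal ω ^ 2)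
              ≤ ∫⁻ s in Set.Ioc (0 : ℝ) t, (2 * ENNReal.ofReal (H s.toNNReal ω ^ 2) +
                  2 * ENNReal.ofReal (((Hn (ns (ms k))).eval s.toNNReal ω - H s.toNNReal ω) ^ 2)) := by
                refine lintegral_mono fun s => ?_
                rw [← ENNReal.ofReal_ofNat 2, ← ENNReal.ofReal_mul (by norm_num),
                  ← ENNReal.ofReal_mul (by norm_num),
                  ← ENNReal.ofReal_add (by positivity) (by positivity)]
                refine ENNReal.ofReal_le_ofReal ?_
                nlinarith [sq_nonneg ((Hn (ns (ms k))).eval s.toNNReal ω - 2 * H s.toNNReal ω)]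
            _ = 2 * (∫⁻ s in Set.Ioc (0 : ℝ) t, ENNReal.ofReal (H s.toNNReal ω ^ 2)) + 2 * D k := by
                have hHω := hH ω
                rw [lintegral_add_left
                  (((hHω.pow_const 2).ennreal_ofReal).const_mul 2), lintegral_const_mul' _ _ (by simp),
                  lintegral_const_mul' _ _ (by simp)]
            _ ≤ 2 * N + 2 * D k := by
                gcongr
                exact hAN ω hωA
        have h4 : (2 * (N : ℝ≥0∞) + 2 * D k) = ENNReal.ofReal (2 * N + 2 * (D k).toReal) := by
          rw [ENNReal.ofReal_add (by positivity) (by positivity), ENNReal.ofReal_mul (by norm_num),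
            ENNReal.ofReal_mul (by norm_num), ENNReal.ofReal_toReal hk.ne]
          simp
        rw [h4] at h3
        exact (ENNReal.ofReal_le_ofReal_iff (by positivity)).1 h3
      have h5 : Tendsto (fun k => ENNReal.ofReal (Real.exp (c * (Hn (ns (ms k))).integral W t ω -
          c ^ 2 / 2 * (2 * N + 2 * (D k).toReal)))) atTop
          (𝓝 (ENNReal.ofReal (Real.exp (c * I t ω - c ^ 2 * N)))) := by
        refine ENNReal.tendsto_ofReal ((Real.continuous_exp.tendsto _).comp ?_)
        have := (h1.const_mul c).sub (((h2'.const_mul 2).const_add (2 * (N : ℝ))).const_mul (c ^ 2 / 2))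
        convert this using 2
        ring
      rw [← h5.liminf_eq]
      refine liminf_le_liminf ?_ (by isBoundedDefault) (by isBoundedDefault)
      filter_upwards [hen] with k hk
      gcongr
    have h6 : ∫⁻ ω in A, ENNReal.ofReal (Real.exp (c * I t ω - c ^ 2 * N)) ∂P ≤ 1 := by
      calc ∫⁻ ω in A, ENNReal.ofReal (Real.exp (c * I t ω - c ^ 2 * N)) ∂P
          ≤ ∫⁻ ω in A, liminf (fun k => ENNReal.ofReal (Real.exp
              (c * (Hn (ns (ms k))).integral W t ω -
                c ^ 2 / 2 * (Hn (ns (ms k))).energy t ω))) atTop ∂P :=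
            setLIntegral_mono_ae' hA hpt
        _ ≤ ∫⁻ ω, liminf (fun k => ENNReal.ofReal (Real.exp
              (c * (Hn (ns (ms k))).integral W t ω -
                c ^ 2 / 2 * (Hn (ns (ms k))).energy t ω))) atTop ∂P := setLIntegral_le_lintegral _ _
        _ ≤ liminf (fun k => ∫⁻ ω, ENNReal.ofReal (Real.exp
              (c * (Hn (ns (ms k))).integral W t ω -
                c ^ 2 / 2 * (Hn (ns (ms k))).energy t ω)) ∂P) atTop :=
            lintegral_liminf_le fun k => by
              have h1 := (Hn (ns (ms k))).measurable_integral hGm hWm t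
              have h2 := (Hn (ns (ms k))).measurable_energy hGm t
              fun_prop
        _ = 1 := by
            simp_rw [SimpleIntegrand.lintegral_exp_integral _ hW hWm h𝒢 hind hG]
            simp
    have h7 : ∀ ω, ENNReal.ofReal (Real.exp (c * I t ω)) = ENNReal.ofReal (Real.exp (c ^ 2 * N)) *
        ENNReal.ofReal (Real.exp (c * I t ω - c ^ 2 * N)) := fun ω => by
      rw [← ENNReal.ofReal_mul (Real.exp_pos _).le, ← Real.exp_add]
      congr 2
      ring
    simp_rw [h7]
    rw [lintegral_const_mul' _ _ ENNReal.ofReal_ne_top]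
    exact ENNReal.mul_lt_top ENNReal.ofReal_lt_top (h6.trans_lt ENNReal.one_lt_top)
  exact hasExpMoment_of_lintegral hmeas.restrict one_pos (hmain 1) (hmain (-1))

end Ito
end LevyMAP
end

/-! ### Jump times of the modulator and conditional moments of the triggered jumps -/

noncomputable section

namespace LevyMAP

theorem lintegral_pow_le_lintegral_pow {Ω : Type*} {mΩ : MeasurableSpace Ω} {P : Measure Ω}
    [IsProbabilityMeasure P] {f : Ω → ℝ≥0∞} (hf : AEMeasurable f P) {n : ℕ} (hn : 1 ≤ n) :
    (∫⁻ ω, f ω ∂P) ^ n ≤ ∫⁻ ω, f ω ^ n ∂P := by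
  have hn' : (1 : ℝ) ≤ n := by exact_mod_cast hn
  have h := eLpNorm'_le_eLpNorm'_of_exponent_le one_pos hn' P hf.aestronglyMeasurable
  simp only [eLpNorm', enorm_eq_self, ENNReal.rpow_one, div_one, ENNReal.rpow_natCast] at h
  calc (∫⁻ ω, f ω ∂P) ^ n ≤ ((∫⁻ ω, f ω ^ n ∂P) ^ (1 / (n : ℝ))) ^ n := by gcongr
    _ = _ := by
      rw [← ENNReal.rpow_natCast, ← ENNReal.rpow_mul, one_div,
        inv_mul_cancel₀ (by positivity), ENNReal.rpow_one]

theorem IsBrownianReal.hasExpMoment {Ω : Type*} {mΩ : MeasurableSpace Ω} {P : Measure Ω}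
    {B : ℝ≥0 → Ω → ℝ} (hB : IsBrownianReal B P) (t : ℝ≥0) : HasExpMoment (B t) P := by
  have hlaw := hB.toIsPreBrownianReal.hasLaw_eval t
  have hint : ∀ c : ℝ, ∫⁻ ω, ENNReal.ofReal (Real.exp (c * B t ω)) ∂P < ∞ := fun c => by
    have h1 := integrable_exp_mul_gaussianReal (μ := 0) (v := t) c
    rw [← hlaw.map_eq, integrable_map_measure (by fun_prop) hlaw.aemeasurable] at h1
    have h2 : Integrable (fun ω => Real.exp (c * B t ω)) P := h1
    have := h2.lintegral_lt_top
    exact this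
  exact hasExpMoment_of_lintegral hlaw.aemeasurable one_pos (hint 1) (hint (-1))

theorem measurable_ennreal_tsum {Ω : Type*} {m : MeasurableSpace Ω} {f : ℕ → Ω → ℝ≥0∞}
    (hf : ∀ j, Measurable (f j)) : Measurable fun ω => ∑' j, f j ω :=
  Measurable.tsum (L := .unconditional ℕ) hf

namespace ModulatedProcess

variable {Ω : Type*} {mΩ : MeasurableSpace Ω} {P : Measure Ω} (X : ModulatedProcess P)

theorem exists_tau (j : ℕ) :
    ∃ g, Measurable[processSigma X.Θ] g ∧ X.τ j =ᵐ[P] g :=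
  exists_measurable_ae_eq_ennreal ((X.τ_meas j).mono sup_nullSigma_le_eventually le_rfl)

/-- A version of the jump time `τ j` which is measurable with respect to the modulator. -/
def tau (j : ℕ) : Ω → ℝ≥0∞ := (X.exists_tau j).choose

/-- The jump of the modulator at `tau j`. -/
def jumpSize (j : ℕ) (ω : Ω) : ℝ := jump (fun t => X.Θ t ω) (X.tau j ω).toNNReal

/-- The `j`-th triggered jump if it happens up to time `T`. -/
def trigger (T : ℝ≥0) (j : ℕ) (ω : Ω) : ℝ :=
  if X.tau j ω ≤ T then X.U j ω (X.jumpSize j ω) else 0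

theorem measurable_tau (j : ℕ) : Measurable[processSigma X.Θ] (X.tau j) :=
  (X.exists_tau j).choose_spec.1

theorem tau_ae_eq : ∀ᵐ ω ∂P, ∀ j, X.tau j ω = X.τ j ω :=
  ae_all_iff.2 fun j => (X.exists_tau j).choose_spec.2.symm

theorem processSigma_Θ_le : processSigma X.Θ ≤ mΩ := processSigma_le X.Θ_meas

theorem measurable_jumpSize (j : ℕ) : Measurable[processSigma X.Θ] (X.jumpSize j) := by
  have h := @measurable_jump_of_cadlag Ω (processSigma X.Θ) X.Θ (measurable_processSigma X.Θ)
    X.Θ_cadlag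
  exact @Measurable.comp _ _ _ (processSigma X.Θ) (_) _ _ _ h
    (@Measurable.prodMk _ _ _ _ _ (processSigma X.Θ) _ _ (ENNReal.measurable_toNNReal.comp (X.measurable_tau j))
      (@measurable_id _ (processSigma X.Θ)))

theorem measurable_trigger (T : ℝ≥0) (j : ℕ) : Measurable (X.trigger T j) := by
  have h1 : Measurable fun p : Ω × ℝ => X.U j p.1 p.2 :=
    (X.U_jointly j).mono (sup_le_sup (MeasurableSpace.comap_mono (X.U_meas j).comap_le) le_rfl) le_rfl
  have h2 : Measurable (X.jumpSize j) := (X.measurable_jumpSize j).mono X.processSigma_Θ_le le_rfl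
  have h3 : Measurable (X.tau j) := (X.measurable_tau j).mono X.processSigma_Θ_le le_rfl
  exact Measurable.ite (h3 measurableSet_Iic) (h1.comp (measurable_id.prodMk h2)) measurable_const

theorem hasSum_trigger : ∀ᵐ ω ∂P, ∀ t : ℝ≥0, HasSum (fun j => X.trigger t j ω) (X.ξf t ω) := by
  filter_upwards [X.ξf_eq, X.tau_ae_eq] with ω h1 h2 t
  convert h1 t using 2 with j
  simp only [trigger, jumpSize, h2, Set.indicator_apply, Set.mem_ofPred_eq]

theorem tau_injective : ∀ᵐ ω ∂P, ∀ i j, X.tau i ω = X.tau j ω → X.tau i ω ≠ ∞ → i = j := by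
  filter_upwards [X.τ_inj, X.tau_ae_eq] with ω h1 h2 i j
  rw [h2, h2]
  exact h1 i j

theorem tau_spec : ∀ᵐ ω ∂P, ∀ j, X.tau j ω ≠ ∞ → 0 < X.tau j ω ∧ X.jumpSize j ω ≠ 0 := by
  filter_upwards [X.τ_range, X.tau_ae_eq] with ω h1 h2 j hj
  have h3 : X.jumpSize j ω ≠ 0 := by
    refine (h1 _).2 ⟨j, ?_⟩
    rw [h2] at hj ⊢
    exact (ENNReal.coe_toNNReal hj).symm
  -- The jump at time 0 is 0 by convention, so a jump time cannot be 0.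
  refine ⟨pos_iff_ne_zero.2 fun h0 => h3 ?_, h3⟩
  rw [jumpSize, h0]
  exact jump_zero _

theorem hasExpMoment_Θ [IsProbabilityMeasure P] {c : ℝ} (hc0 : 0 < c) (hc : ExpTail X.ν₁ c)
    (t : ℝ≥0) : HasExpMoment (X.Θ t) P := by
  obtain ⟨hJ, hJ'⟩ := X.J₁_spec.hasExpMoment X.levy₁ X.M₁_poisson hc0 hc t
  have hB : HasExpMoment (fun ω => X.σ₁ * X.B t ω) P := by
    obtain ⟨d, hd, h⟩ := IsBrownianReal.hasExpMoment X.B_brownian t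
    have hs : 0 < |X.σ₁| := abs_pos.2 X.σ₁_ne
    refine ⟨d / |X.σ₁|, by positivity, ?_⟩
    convert h using 3 with ω
    rw [abs_mul]
    field_simp
  have h1 := (hasExpMoment_const (Q := P) (X.μ₁ * t)).add hB (by fun_prop)
    ((X.B_meas t).const_mul _).aemeasurable
  have h2 := h1.add hJ' (((X.B_meas t).const_mul _).const_add _).aemeasurable hJ
  refine h2.mono (X.Θ_meas t).aemeasurable ?_
  filter_upwards [X.Θ_eq] with ω hω
  rw [hω t]

/-- Drift and Brownian part are continuous, so Θ and its compensated jump integral have the same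
jumps. This transfers what is known about the atoms of M₁ to Θ. -/
theorem tendsto_J₁_jump : ∀ᵐ ω ∂P, ∀ t : ℝ≥0,
    Tendsto (fun s => X.J₁ t ω - X.J₁ s ω) (𝓝[<] t) (𝓝 (jump (fun t => X.Θ t ω) t)) := by
  filter_upwards [X.Θ_eq, X.B_brownian.cont] with ω h1 hB t
  have h2 := (X.Θ_cadlag ω).tendsto_sub t
  have h3 : Tendsto (fun s : ℝ≥0 => X.μ₁ * (t - s : ℝ) + X.σ₁ * (X.B t ω - X.B s ω)) (𝓝[<] t)
      (𝓝 (X.μ₁ * (t - t : ℝ) + X.σ₁ * (X.B t ω - X.B t ω))) := by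
    refine Tendsto.mono_left ?_ nhdsWithin_le_nhds
    have hB' : Continuous fun s => X.B s ω := hB
    exact Continuous.tendsto (f := fun s : ℝ≥0 => X.μ₁ * (t - s : ℝ) + X.σ₁ * (X.B t ω - X.B s ω))
      (by fun_prop) t
  have h4 := h2.sub h3
  simp only [sub_self, mul_zero, add_zero, sub_zero] at h4
  refine h4.congr fun s => ?_
  rw [h1 t, h1 s]
  ring

/-- The moment `𝔼 |U(x)|ᵏ` of the triggered jump. -/
def jumpMoment (k : ℕ) (x : ℝ) : ℝ≥0∞ := ∫⁻ y, ENNReal.ofReal (|y| ^ k) ∂(X.jumpLaw x)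

theorem measurable_U_apply (j : ℕ) (x : ℝ) : Measurable fun ω => X.U j ω x :=
  (measurable_pi_apply x).comp (X.U_meas j)

theorem measurable_U_uncurry (j : ℕ) : Measurable fun p : Ω × ℝ => X.U j p.1 p.2 :=
  (X.U_jointly j).mono (sup_le_sup (MeasurableSpace.comap_mono (X.U_meas j).comap_le) le_rfl) le_rfl

theorem lintegral_jumpLaw (j : ℕ) (x : ℝ) {f : ℝ → ℝ≥0∞} (hf : Measurable f) :
    ∫⁻ ω, f (X.U j ω x) ∂P = ∫⁻ y, f y ∂(X.jumpLaw x) := by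
  have h := (X.U_ident j).comp (measurable_pi_apply x)
  have h' : IdentDistrib (fun ω => X.U j ω x) (fun ω => X.U 0 ω x) P P := h
  rw [jumpLaw, ← h'.map_eq, lintegral_map hf (X.measurable_U_apply j x)]

instance [IsProbabilityMeasure P] (x : ℝ) : IsProbabilityMeasure (X.jumpLaw x) :=
  Measure.isProbabilityMeasure_map (X.measurable_U_apply 0 x).aemeasurable

theorem measurable_lintegral_jumpLaw [IsProbabilityMeasure P] {f : ℝ → ℝ≥0∞} (hf : Measurable f) :
    Measurable fun x => ∫⁻ y, f y ∂(X.jumpLaw x) := by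
  simp_rw [← X.lintegral_jumpLaw 0 _ hf]
  exact Measurable.lintegral_prod_left' (f := fun p : Ω × ℝ => f (X.U 0 p.1 p.2))
    (hf.comp (X.measurable_U_uncurry 0))

theorem measurable_jumpMoment [IsProbabilityMeasure P] (k : ℕ) : Measurable (X.jumpMoment k) :=
  X.measurable_lintegral_jumpLaw (by fun_prop)

theorem jumpMoment_pow_le [IsProbabilityMeasure P] (k : ℕ) {r : ℕ} (hr : 1 ≤ r) (x : ℝ) :
    X.jumpMoment k x ^ r ≤ X.jumpMoment (k * r) x := by
  refine (lintegral_pow_le_lintegral_pow (by fun_prop) hr).trans_eq ?_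
  refine lintegral_congr fun y => ?_
  rw [← ENNReal.ofReal_pow (by positivity), pow_mul]

/-- The sum of the conditional moments of the triggered jumps up to time `T`. -/
def sumMoment (T : ℝ≥0) (k : ℕ) (ω : Ω) : ℝ≥0∞ :=
  ∑' j, if X.tau j ω ≤ T then X.jumpMoment k (X.jumpSize j ω) else 0

theorem measurable_sumMoment [IsProbabilityMeasure P] (T : ℝ≥0) (k : ℕ) :
    Measurable[processSigma X.Θ] (X.sumMoment T k) := by
  refine measurable_ennreal_tsum fun j => ?_
  refine Measurable.ite (X.measurable_tau j measurableSet_Iic) ?_ measurable_const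
  exact (X.measurable_jumpMoment k).comp (X.measurable_jumpSize j)

/-- The jumps of Θ are atoms of M₁ at distinct times, so the sum is at most the M₁-integral of
`jumpMoment k` over (0, T] × ℝ. Powers of that integrand are ν₁-integrable by Jensen and the moment
assumptions, and Poisson integrals of such functions have all moments. -/
theorem lintegral_sumMoment_pow_lt_top [IsProbabilityMeasure P] {c : ℝ} (hc0 : 0 < c)
    (hc : ExpTail X.ν₁ c)
    (hmom : ∀ k : ℕ, 1 ≤ k → ∫⁻ x, ∫⁻ y, ENNReal.ofReal (|y| ^ k) ∂(X.jumpLaw x) ∂X.ν₁ < ∞)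
    (T : ℝ≥0) {k : ℕ} (hk : 1 ≤ k) (p : ℕ) : ∫⁻ ω, X.sumMoment T k ω ^ p ∂P < ∞ := by
  have := X.levy₁.sigmaFinite
  set S : Set (ℝ × ℝ) := Set.Ioc (0 : ℝ) T ×ˢ Set.univ with hS
  have hSm : MeasurableSet S := measurableSet_Ioc.prod MeasurableSet.univ
  set f : ℝ × ℝ → ℝ≥0∞ := S.indicator fun p => X.jumpMoment k p.2 with hf
  have hfm : Measurable f := ((X.measurable_jumpMoment k).comp measurable_snd).indicator hSm
  have hfin : ∀ r ≥ 1, ∫⁻ q, f q ^ r ∂(volume.prod X.ν₁) < ∞ := by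
    intro r hr
    calc ∫⁻ q, f q ^ r ∂(volume.prod X.ν₁)
        ≤ ∫⁻ q, (Set.Ioc (0 : ℝ) T).indicator 1 q.1 * X.jumpMoment (k * r) q.2
            ∂(volume.prod X.ν₁) := by
          refine lintegral_mono fun q => ?_
          by_cases hq : q ∈ S
          · have hq1 : q.1 ∈ Set.Ioc (0 : ℝ) T := hq.1
            rw [hf, Set.indicator_of_mem hq, Set.indicator_of_mem hq1, Pi.one_apply, one_mul]
            exact X.jumpMoment_pow_le k hr _
          · rw [hf, Set.indicator_of_notMem hq, zero_pow (by lia)]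
            exact zero_le
      _ = (∫⁻ s, (Set.Ioc (0 : ℝ) T).indicator 1 s) * ∫⁻ x, X.jumpMoment (k * r) x ∂X.ν₁ :=
          lintegral_prod_mul (measurable_one.indicator measurableSet_Ioc).aemeasurable
            (X.measurable_jumpMoment _).aemeasurable
      _ < ∞ := by
          refine ENNReal.mul_lt_top ?_ (hmom _ (Nat.mul_pos hk hr))
          rw [lintegral_indicator_one measurableSet_Ioc]
          simp
  refine (lintegral_mono_ae ?_).trans_lt (X.M₁_poisson.lintegral_pow_lt_top hfm hfin p)
  filter_upwards [X.J₁_spec.comp_jump_le X.levy₁ X.M₁_poisson hc0 hc, X.tendsto_J₁_jump,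
    X.tau_spec, X.tau_injective] with ω h1 h2 h3 h4
  gcongr
  rw [hf, lintegral_indicator hSm]
  refine tsum_jump_le T _ _ h4 fun j hj => ?_
  have hj' : X.tau j ω ≠ ∞ := ne_top_of_le_ne_top ENNReal.coe_ne_top hj
  obtain ⟨h5, h6⟩ := h3 j hj'
  refine ⟨h5, h1 _ (X.measurable_jumpMoment k) (X.tau j ω).toNNReal ?_ _ h6 (h2 _)⟩
  exact ENNReal.toNNReal_pos h5.ne' hj'

end ModulatedProcess
end LevyMAP
end

/-! ### Moments of the total size of the triggered jumps -/

noncomputable section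

namespace LevyMAP

theorem measurable_comp_prodMk {α Ω : Type*} {mα : MeasurableSpace α} {m : MeasurableSpace Ω}
    {F : Ω × ℝ → ℝ} (hF : Measurable F) {g : α → Ω} {x : α → ℝ} (hg : Measurable g)
    (hx : Measurable x) : Measurable fun a => F (g a, x a) :=
  hF.comp (hg.prodMk hx)

namespace ModulatedProcess

variable {Ω : Type*} {𝓗 : MeasurableSpace Ω} {mΩ : MeasurableSpace Ω} {P : Measure Ω}
  (X : ModulatedProcess P)

/-- The jump size x is known to 𝓗, which is independent of U_j. Freezing it turns the inner
expectation into one under the law of U(x); the joint measurability of U_j makes this legitimate. -/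
theorem lintegral_mul_U [IsProbabilityMeasure P] {j : ℕ} (h𝓗 : 𝓗 ≤ mΩ)
    (hind : Indep (MeasurableSpace.comap (X.U j) inferInstance) 𝓗 P) {R : Ω → ℝ≥0∞}
    (hR : Measurable[𝓗] R) {x : Ω → ℝ} (hx : Measurable[𝓗] x) {f : ℝ → ℝ≥0∞} (hf : Measurable f) :
    ∫⁻ ω, R ω * f (X.U j ω (x ω)) ∂P = ∫⁻ ω, R ω * ∫⁻ y, f y ∂(X.jumpLaw (x ω)) ∂P := by
  have h2 : Measurable[(MeasurableSpace.comap (X.U j) inferInstance).prod 𝓗]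
      fun p : Ω × Ω => X.U j p.1 (x p.2) :=
    measurable_comp_prodMk (X.U_jointly j) (@measurable_fst _ _ (_) (_))
      (hx.comp (@measurable_snd _ _ (_) (_)))
  have hF : Measurable[(MeasurableSpace.comap (X.U j) inferInstance).prod 𝓗]
      fun p : Ω × Ω => R p.2 * f (X.U j p.1 (x p.2)) :=
    (hR.comp (@measurable_snd _ _ (_) (_))).mul (hf.comp h2)
  rw [lintegral_diag_of_indep (X.U_meas j).comap_le h𝓗 hind hF]
  refine lintegral_congr fun ω' => ?_
  simp only
  have h3 := X.measurable_U_apply j (x ω')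
  rw [lintegral_const_mul _ (by fun_prop), X.lintegral_jumpLaw j _ hf]

theorem comap_U_le (j : ℕ) : MeasurableSpace.comap (X.U j) inferInstance ≤ mΩ := (X.U_meas j).comap_le

/-- The σ-algebra generated by the modulator and the functions `U i` with `i ≠ j`. -/
abbrev others (j : ℕ) : MeasurableSpace Ω :=
  processSigma X.Θ ⊔ ⨆ i ∈ ({j}ᶜ : Set ℕ), MeasurableSpace.comap (X.U i) inferInstance

theorem others_le (j : ℕ) : X.others j ≤ mΩ :=
  sup_le X.processSigma_Θ_le (iSup₂_le fun i _ => X.comap_U_le i)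

theorem indep_others [IsProbabilityMeasure P] (j : ℕ) :
    Indep (MeasurableSpace.comap (X.U j) inferInstance) (X.others j) P := by
  refine indep_sup_of_indep X.processSigma_Θ_le (iSup_le X.comap_U_le)
    (le_iSup (fun i => MeasurableSpace.comap (X.U i) inferInstance) j)
    (iSup₂_le fun i _ => le_iSup (fun i => MeasurableSpace.comap (X.U i) inferInstance) i)
    (indep_of_indep_of_le_right X.U_indep (le_sup_left.trans le_sup_left)) ?_
  have := indep_iSup_of_disjoint X.comap_U_le X.U_iIndep (S := {j}) (T := {j}ᶜ)
    disjoint_compl_right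
  simpa using this

/-- The size of the `j`-th triggered jump if it happens up to time `T`. -/
def absTrigger (T : ℝ≥0) (j : ℕ) (ω : Ω) : ℝ≥0∞ := ENNReal.ofReal |X.trigger T j ω|

theorem measurable_absTrigger (T : ℝ≥0) (j : ℕ) : Measurable (X.absTrigger T j) := by
  have := X.measurable_trigger T j
  unfold absTrigger
  fun_prop

theorem measurable_trigger_others (T : ℝ≥0) {i j : ℕ} (hij : i ≠ j) :
    Measurable[X.others j] (X.trigger T i) := by
  have hle : MeasurableSpace.comap (X.U i) inferInstance ≤ X.others j :=
    le_sup_of_le_right (le_iSup₂_of_le i hij le_rfl)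
  have h2 : Measurable[X.others j] (X.jumpSize i) :=
    (X.measurable_jumpSize i).mono le_sup_left le_rfl
  have h3 : Measurable[X.others j] (X.tau i) := (X.measurable_tau i).mono le_sup_left le_rfl
  refine Measurable.ite (h3 measurableSet_Iic) ?_ measurable_const
  exact measurable_comp_prodMk (X.U_jointly i) ((@measurable_id _ (X.others j)).mono le_rfl hle) h2

theorem measurable_absTrigger_others (T : ℝ≥0) {i j : ℕ} (hij : i ≠ j) :
    Measurable[X.others j] (X.absTrigger T i) :=
  (ENNReal.continuous_ofReal.comp continuous_abs).measurable.comp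
    (X.measurable_trigger_others T hij)

/-- Given everything but U_j, a power of the j-th trigger can be replaced by its conditional moment.
Exponent 0 is excluded because the trigger vanishes after T while its power 0 would be 1. -/
theorem lintegral_mul_absTrigger_pow [IsProbabilityMeasure P] (T : ℝ≥0) (j : ℕ) {k : ℕ} (hk : k ≠ 0)
    {R : Ω → ℝ≥0∞} (hR : Measurable[X.others j] R) :
    ∫⁻ ω, R ω * X.absTrigger T j ω ^ k ∂P =
      ∫⁻ ω, R ω * (if X.tau j ω ≤ T then X.jumpMoment k (X.jumpSize j ω) else 0) ∂P := by
  have h2 : Measurable[X.others j] (X.jumpSize j) :=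
    (X.measurable_jumpSize j).mono le_sup_left le_rfl
  have h3 : Measurable[X.others j] (X.tau j) := (X.measurable_tau j).mono le_sup_left le_rfl
  have h4 : Measurable[X.others j] fun ω => R ω * (if X.tau j ω ≤ T then 1 else 0) :=
    hR.mul (Measurable.ite (h3 measurableSet_Iic) measurable_const measurable_const)
  have := X.lintegral_mul_U (X.others_le j) (X.indep_others j) h4 h2
    (f := fun y => ENNReal.ofReal (|y| ^ k)) (by fun_prop)
  calc ∫⁻ ω, R ω * X.absTrigger T j ω ^ k ∂P
      = ∫⁻ ω, R ω * (if X.tau j ω ≤ T then 1 else 0) *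
          ENNReal.ofReal (|X.U j ω (X.jumpSize j ω)| ^ k) ∂P := by
        refine lintegral_congr fun ω => ?_
        rw [absTrigger, trigger]
        split_ifs
        · rw [mul_one, ENNReal.ofReal_pow (abs_nonneg _)]
        · simp [hk]
    _ = _ := by
        rw [this]
        refine lintegral_congr fun ω => ?_
        split_ifs <;> simp [jumpMoment]

/-- Conditional analogue of the Poisson moment recursion: one factor is split off the power, its own
contribution is separated from the sum over the other indices, and independence of U_j from those
replaces the factor by its conditional moment. -/
theorem lintegral_mul_sum_pow_succ_le [IsProbabilityMeasure P] (T : ℝ≥0) (n r : ℕ) {R : Ω → ℝ≥0∞}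
    (hR : Measurable[processSigma X.Θ] R) :
    ∫⁻ ω, R ω * (∑ j ∈ Finset.range n, X.absTrigger T j ω) ^ (r + 1) ∂P ≤
      2 ^ r * (∫⁻ ω, R ω * X.sumMoment T (r + 1) ω ∂P +
        ∫⁻ ω, R ω * X.sumMoment T 1 ω * (∑ j ∈ Finset.range n, X.absTrigger T j ω) ^ r ∂P) := by
  set S : Ω → ℝ≥0∞ := fun ω => ∑ j ∈ Finset.range n, X.absTrigger T j ω with hS
  set S' : ℕ → Ω → ℝ≥0∞ := fun j ω => ∑ i ∈ (Finset.range n).erase j, X.absTrigger T i ω with hS'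
  set b : ℕ → ℕ → Ω → ℝ≥0∞ := fun k j ω =>
    if X.tau j ω ≤ T then X.jumpMoment k (X.jumpSize j ω) else 0 with hb
  have hw := X.measurable_absTrigger T
  have hSm : Measurable S := Finset.measurable_fun_sum _ fun i _ => hw i
  have hRm : Measurable R := hR.mono X.processSigma_Θ_le le_rfl
  have hS'm : ∀ j, Measurable[X.others j] (S' j) := fun j =>
    Finset.measurable_fun_sum _ fun i hi => X.measurable_absTrigger_others T (Finset.ne_of_mem_erase hi)
  have hbm : ∀ k j, Measurable (b k j) := fun k j =>
    Measurable.ite (((X.measurable_tau j).mono X.processSigma_Θ_le le_rfl) measurableSet_Iic)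
      ((X.measurable_jumpMoment k).comp ((X.measurable_jumpSize j).mono X.processSigma_Θ_le le_rfl))
      measurable_const
  have hRj : ∀ j, Measurable[X.others j] R := fun j => hR.mono le_sup_left le_rfl
  have hsum : ∀ k (Q : Ω → ℝ≥0∞), Measurable Q →
      ∑ j ∈ Finset.range n, ∫⁻ ω, Q ω * b k j ω ∂P ≤ ∫⁻ ω, Q ω * X.sumMoment T k ω ∂P := by
    intro k Q hQ
    rw [← lintegral_finsetSum _ fun j _ => hQ.fun_mul (hbm k j)]
    refine lintegral_mono fun ω => ?_
    rw [← Finset.mul_sum]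
    gcongr
    exact ENNReal.sum_le_tsum _
  calc ∫⁻ ω, R ω * S ω ^ (r + 1) ∂P
      ≤ ∫⁻ ω, ∑ j ∈ Finset.range n, 2 ^ r * (R ω * X.absTrigger T j ω ^ (r + 1) +
          R ω * S' j ω ^ r * X.absTrigger T j ω ^ 1) ∂P := by
        refine lintegral_mono fun ω => ?_
        rw [pow_succ', show S ω * S ω ^ r = ∑ j ∈ Finset.range n, X.absTrigger T j ω * S ω ^ r from
          Finset.sum_mul _ _ _, Finset.mul_sum]
        refine Finset.sum_le_sum fun j hj => ?_
        have h1 : S ω = X.absTrigger T j ω + S' j ω :=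
          (Finset.add_sum_erase _ (fun i => X.absTrigger T i ω) hj).symm
        have h2 := add_pow_le_two_pow (X.absTrigger T j ω) (S' j ω) r
        rw [h1]
        calc R ω * (X.absTrigger T j ω * (X.absTrigger T j ω + S' j ω) ^ r)
            ≤ R ω * (X.absTrigger T j ω * (2 ^ r * (X.absTrigger T j ω ^ r + S' j ω ^ r))) := by gcongr
          _ = _ := by ring
    _ = ∑ j ∈ Finset.range n, 2 ^ r * (∫⁻ ω, R ω * b (r + 1) j ω ∂P +
          ∫⁻ ω, R ω * S' j ω ^ r * b 1 j ω ∂P) := by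
        have hSj : ∀ j, Measurable (S' j) := fun j => (hS'm j).mono (X.others_le j) le_rfl
        rw [lintegral_finsetSum _ fun j _ => by fun_prop]
        refine Finset.sum_congr rfl fun j _ => ?_
        rw [lintegral_const_mul _ (by fun_prop), lintegral_add_left (by fun_prop),
          X.lintegral_mul_absTrigger_pow T j (Nat.succ_ne_zero r) (hRj j),
          X.lintegral_mul_absTrigger_pow T j one_ne_zero ((hRj j).fun_mul ((hS'm j).pow_const r))]
    _ ≤ 2 ^ r * (∑ j ∈ Finset.range n, ∫⁻ ω, R ω * b (r + 1) j ω ∂P +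
          ∑ j ∈ Finset.range n, ∫⁻ ω, R ω * S ω ^ r * b 1 j ω ∂P) := by
        rw [← Finset.mul_sum, Finset.sum_add_distrib]
        gcongr with j hj ω
        exact Finset.sum_le_sum_of_subset (Finset.erase_subset _ _)
    _ ≤ 2 ^ r * (∫⁻ ω, R ω * X.sumMoment T (r + 1) ω ∂P +
          ∫⁻ ω, R ω * S ω ^ r * X.sumMoment T 1 ω ∂P) := by
        gcongr
        · exact hsum _ _ hRm
        · exact hsum _ _ (hRm.mul (hSm.pow_const r))
    _ = _ := by
        congr 2
        refine lintegral_congr fun ω => ?_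
        ring

theorem lintegral_mul_pow_lt_top {f g : Ω → ℝ≥0∞} (hf : Measurable f)
    (h : ∀ p : ℕ, ∫⁻ ω, f ω ^ p ∂P < ∞) (h' : ∀ p : ℕ, ∫⁻ ω, g ω ^ p ∂P < ∞) (p : ℕ) :
    ∫⁻ ω, (f ω * g ω) ^ p ∂P < ∞ := by
  refine (lintegral_mono fun ω => ?_).trans_lt
    ((lintegral_add_left (hf.pow_const (2 * p)) fun ω => g ω ^ (2 * p)).trans_lt
      (ENNReal.add_lt_top.2 ⟨h _, h' _⟩))
  rw [mul_pow, pow_mul' , pow_mul']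
  rcases le_total (f ω ^ p) (g ω ^ p) with hle | hle
  · refine le_add_left ?_
    rw [sq]
    gcongr
  · refine le_add_right ?_
    rw [sq]
    gcongr

theorem lintegral_add_pow_lt_top {f g : Ω → ℝ≥0∞} (hf : Measurable f)
    (h : ∀ p : ℕ, ∫⁻ ω, f ω ^ p ∂P < ∞) (h' : ∀ p : ℕ, ∫⁻ ω, g ω ^ p ∂P < ∞) (p : ℕ) :
    ∫⁻ ω, (f ω + g ω) ^ p ∂P < ∞ := by
  refine (lintegral_mono fun ω => add_pow_le_two_pow _ _ p).trans_lt ?_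
  rw [lintegral_const_mul' _ _ (by simp), lintegral_add_left (hf.pow_const p)]
  exact ENNReal.mul_lt_top (ENNReal.pow_lt_top (by simp)) (ENNReal.add_lt_top.2 ⟨h _, h' _⟩)

/-- The total size of the triggered jumps up to time `T`. -/
def totalTrigger (T : ℝ≥0) (ω : Ω) : ℝ≥0∞ := ∑' j, X.absTrigger T j ω

theorem measurable_totalTrigger (T : ℝ≥0) : Measurable (X.totalTrigger T) :=
  measurable_ennreal_tsum fun j => X.measurable_absTrigger T j

theorem lintegral_totalTrigger_pow_lt_top [IsProbabilityMeasure P] {T : ℝ≥0}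
    (h : ∀ k p : ℕ, 1 ≤ k → ∫⁻ ω, X.sumMoment T k ω ^ p ∂P < ∞) (r : ℕ) :
    ∫⁻ ω, X.totalTrigger T ω ^ r ∂P < ∞ := by
  have hsm : ∀ k, Measurable (X.sumMoment T k) := fun k =>
    (X.measurable_sumMoment T k).mono X.processSigma_Θ_le le_rfl
  -- `Φ` majorises the conditional r-th moment of the partial sums given the modulator. Testing
  -- against arbitrary weights `R` expresses this without conditional expectations, and lets the
  -- induction absorb the factor `sumMoment T 1` into the weight.
  have key : ∀ r : ℕ, ∃ Φ : Ω → ℝ≥0∞, Measurable[processSigma X.Θ] Φ ∧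
      (∀ p : ℕ, ∫⁻ ω, Φ ω ^ p ∂P < ∞) ∧ ∀ (n : ℕ) (R : Ω → ℝ≥0∞), Measurable[processSigma X.Θ] R →
        ∫⁻ ω, R ω * (∑ j ∈ Finset.range n, X.absTrigger T j ω) ^ r ∂P ≤ ∫⁻ ω, R ω * Φ ω ∂P := by
    intro r
    induction r with
    | zero =>
      refine ⟨fun _ => 1, measurable_const, fun p => by simp, fun n R hR => ?_⟩
      simp
    | succ r ih =>
      obtain ⟨Φ, hΦ, hΦp, hle⟩ := ih
      have hΦ' : Measurable Φ := hΦ.mono X.processSigma_Θ_le le_rfl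
      refine ⟨fun ω => 2 ^ r * (X.sumMoment T (r + 1) ω + X.sumMoment T 1 ω * Φ ω),
        ((X.measurable_sumMoment T _).add ((X.measurable_sumMoment T _).mul hΦ)).const_mul _,
        fun p => ?_, fun n R hR => ?_⟩
      · refine lintegral_mul_pow_lt_top measurable_const (fun p => ?_)
          (lintegral_add_pow_lt_top (hsm _) (fun p => h _ p (by lia))
            (lintegral_mul_pow_lt_top (hsm _) (fun p => h _ p le_rfl) hΦp)) p
        simp only [lintegral_const, measure_univ, mul_one]
        exact ENNReal.pow_lt_top (ENNReal.pow_lt_top (by simp))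
      · have hR' : Measurable R := hR.mono X.processSigma_Θ_le le_rfl
        have h1 := hsm 1
        have h2 := hsm (r + 1)
        refine (X.lintegral_mul_sum_pow_succ_le T n r hR).trans ?_
        refine (mul_le_mul_right (add_le_add le_rfl (hle n _
          (hR.fun_mul (X.measurable_sumMoment T 1)))) _).trans_eq ?_
        rw [← lintegral_add_left (by fun_prop), ← lintegral_const_mul _ (by fun_prop)]
        refine lintegral_congr fun ω => ?_
        ring
  obtain ⟨Φ, -, hΦp, hle⟩ := key r
  have hlim : ∀ ω, Tendsto (fun n => (∑ j ∈ Finset.range n, X.absTrigger T j ω) ^ r) atTop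
      (𝓝 (X.totalTrigger T ω ^ r)) := fun ω =>
    (ENNReal.continuous_pow r).continuousAt.tendsto.comp ENNReal.summable.hasSum.tendsto_sum_nat
  have := hΦp 1
  calc ∫⁻ ω, X.totalTrigger T ω ^ r ∂P
      = ∫⁻ ω, liminf (fun n => (∑ j ∈ Finset.range n, X.absTrigger T j ω) ^ r) atTop ∂P :=
        lintegral_congr fun ω => (hlim ω).liminf_eq.symm
    _ ≤ liminf (fun n => ∫⁻ ω, (∑ j ∈ Finset.range n, X.absTrigger T j ω) ^ r ∂P) atTop := by
        have := X.measurable_absTrigger T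
        exact lintegral_liminf_le fun n => by fun_prop
    _ ≤ ∫⁻ ω, Φ ω ∂P := by
        refine liminf_le_of_le (by isBoundedDefault) fun b hb => ?_
        obtain ⟨n, hn⟩ := hb.exists
        refine hn.trans ?_
        simpa using hle n (fun _ => 1) measurable_const
    _ < ∞ := by simpa using this

end ModulatedProcess
end LevyMAP
end

/-! ### Jumps of the ordinate at the jump times of the modulator -/

noncomputable section

namespace LevyMAP

/-- A Poisson random measure does not charge a random time that is independent of it. -/
theorem IsPoissonRandomMeasure.apply_singleton_prod_eq_zero {Ω : Type*} {𝓗 : MeasurableSpace Ω}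
    {mΩ : MeasurableSpace Ω} {P : Measure Ω} [IsProbabilityMeasure P] {M : Ω → Measure (ℝ × ℝ)}
    {ν : Measure ℝ} [SFinite ν] (hM : IsPoissonRandomMeasure P M (volume.prod ν)) (h𝓗 : 𝓗 ≤ mΩ)
    (hind : Indep (MeasurableSpace.comap M inferInstance) 𝓗 P) {τ : Ω → ℝ} (hτ : Measurable[𝓗] τ)
    {C : Set ℝ} (hC : MeasurableSet C) (hνC : ν C ≠ ∞) :
    ∀ᵐ ω ∂P, 0 < τ ω → M ω ({τ ω} ×ˢ C) = 0 := by
  set cell : ℕ → ℕ → Set ℝ := fun k i => Set.Ioc ((i : ℝ) / (k + 1)) ((i + 1 : ℝ) / (k + 1)) with hcell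
  have hvol : ∀ k i, volume.prod ν (cell k i ×ˢ C) = ENNReal.ofReal (1 / (k + 1)) * ν C := by
    intro k i
    rw [Measure.prod_prod, Real.volume_Ioc]
    congr 2
    ring
  have hcm : ∀ k i, MeasurableSet (cell k i ×ˢ C) := fun k i => measurableSet_Ioc.prod hC
  -- `Y k` is the mass of M over the cell of mesh 1/(k + 1) that contains τ. It dominates the mass
  -- of the slice at τ, and by independence its mean is at most ν(C)/(k + 1).
  set Y : ℕ → Ω → ℝ≥0∞ := fun k ω =>
    ∑' i, (τ ⁻¹' cell k i).indicator 1 ω * M ω (cell k i ×ˢ C) with hY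
  have hYm : ∀ k, Measurable (Y k) := fun k => measurable_ennreal_tsum fun i =>
    (measurable_one.indicator (h𝓗 _ (hτ measurableSet_Ioc))).mul (hM.measurable_apply (hcm k i))
  have hdisj : ∀ k, Pairwise (Function.onFun Disjoint fun i => τ ⁻¹' cell k i) := by
    intro k
    have h1 : Monotone fun i : ℕ => (i : ℝ) / (k + 1) := fun a b hab => by
      simp only
      gcongr
    have h2 := h1.pairwise_disjoint_on_Ioc_succ
    intro i j hij
    refine Disjoint.preimage τ ?_
    have := h2 hij
    simpa [Function.onFun, hcell] using this
  have hYle : ∀ k, ∫⁻ ω, Y k ω ∂P ≤ ENNReal.ofReal (1 / (k + 1)) * ν C := by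
    intro k
    simp only [hY]
    rw [lintegral_tsum fun i => ((measurable_one.indicator
      (h𝓗 _ (hτ measurableSet_Ioc))).fun_mul (hM.measurable_apply (hcm k i))).aemeasurable]
    calc ∑' i, ∫⁻ ω, (τ ⁻¹' cell k i).indicator 1 ω * M ω (cell k i ×ˢ C) ∂P
        = ∑' i, P (τ ⁻¹' cell k i) * (ENNReal.ofReal (1 / (k + 1)) * ν C) := by
          refine tsum_congr fun i => ?_
          have hMi : Measurable[MeasurableSpace.comap M inferInstance] fun ω => M ω (cell k i ×ˢ C) :=
            (Measure.measurable_coe (hcm k i)).comp (comap_measurable M)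
          have h1i : Measurable[𝓗] ((τ ⁻¹' cell k i).indicator (1 : Ω → ℝ≥0∞)) :=
            Measurable.indicator (f := fun _ => 1) measurable_const (hτ measurableSet_Ioc)
          rw [lintegral_mul_eq_lintegral_mul_lintegral_of_independent_measurableSpace h𝓗
            hM.measurable.comap_le hind.symm h1i hMi,
            lintegral_indicator_one (h𝓗 _ (hτ measurableSet_Ioc)), hM.lintegral_apply (hcm k i),
            hvol]
          rw [hvol]
          exact ENNReal.mul_ne_top ENNReal.ofReal_ne_top hνC
      _ ≤ _ := by
          rw [ENNReal.tsum_mul_right,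
            ← measure_iUnion (hdisj k) fun i => h𝓗 _ (hτ measurableSet_Ioc)]
          exact mul_le_of_le_one_left' prob_le_one
  have hzero : ∀ᵐ ω ∂P, ⨅ k, Y k ω = 0 := by
    have h0 : ∫⁻ ω, ⨅ k, Y k ω ∂P = 0 := by
      have hlim : Tendsto (fun k : ℕ => ENNReal.ofReal (1 / ((k : ℝ) + 1)) * ν C) atTop (𝓝 0) := by
        have h1 := ENNReal.tendsto_ofReal (tendsto_one_div_add_atTop_nhds_zero_nat (𝕜 := ℝ))
        have h2 := ENNReal.Tendsto.mul_const h1 (Or.inr hνC)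
        simpa using h2
      refine le_antisymm (ge_of_tendsto' hlim fun k => ?_) zero_le
      exact (lintegral_mono fun ω => iInf_le _ k).trans (hYle k)
    exact (lintegral_eq_zero_iff (Measurable.iInf hYm)).1 h0
  filter_upwards [hzero] with ω hω hpos
  refine le_antisymm (hω ▸ le_iInf fun k => ?_) zero_le
  obtain ⟨i, hi⟩ : ∃ i, τ ω ∈ cell k i := by
    have hk : (0 : ℝ) < k + 1 := by positivity
    have hc : 0 < ⌈τ ω * (k + 1)⌉₊ := Nat.ceil_pos.2 (by positivity)
    refine ⟨⌈τ ω * (k + 1)⌉₊ - 1, ?_, ?_⟩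
    · rw [div_lt_iff₀ hk]
      exact Nat.lt_ceil.1 (by lia)
    · rw [le_div_iff₀ hk]
      have : ((⌈τ ω * (k + 1)⌉₊ - 1 : ℕ) : ℝ) + 1 = ⌈τ ω * (k + 1)⌉₊ := by
        exact_mod_cast Nat.sub_add_cancel hc
      rw [this]
      exact Nat.le_ceil _
  refine le_trans ?_ (ENNReal.le_tsum i)
  rw [Set.indicator_of_mem (show ω ∈ τ ⁻¹' cell k i from hi), Pi.one_apply, one_mul]
  exact measure_mono (Set.prod_mono (Set.singleton_subset_iff.2 hi) subset_rfl)

namespace ModulatedProcess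

variable {Ω : Type*} {mΩ : MeasurableSpace Ω} {P : Measure Ω} (X : ModulatedProcess P)

/-- M₂ is independent of Θ and so has no atom at a jump time of Θ; the drift and the Itô integral
are continuous. -/
theorem jump_ξL_tau [IsProbabilityMeasure P] {c : ℝ} (hc0 : 0 < c) (hc : ExpTail X.ν₂ c) :
    ∀ᵐ ω ∂P, ∀ j, X.tau j ω ≠ ∞ → jump (fun t => X.ξL t ω) (X.tau j ω).toNNReal = 0 := by
  have := X.levy₂.sigmaFinite
  have hM : ∀ᵐ ω ∂P, ∀ j n, 0 < (X.tau j ω).toReal →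
      X.M₂ ω ({(X.tau j ω).toReal} ×ˢ bigJumps n) = 0 := by
    rw [ae_all_iff]; intro j
    rw [ae_all_iff]; intro n
    exact X.M₂_poisson.apply_singleton_prod_eq_zero X.processSigma_Θ_le
      (indep_of_indep_of_le_right X.M₂_indep le_sup_left)
      (ENNReal.measurable_toReal.comp (X.measurable_tau j)) (measurableSet_bigJumps n)
      (X.levy₂.measure_bigJumps_lt_top n).ne
  filter_upwards [hM, X.J₂_spec.jump_eq_zero X.levy₂ X.M₂_poisson hc0 hc, X.tau_spec,
    X.I₂_spec.ae_continuous X.W_brownian, X.ξL_eq, X.μ₂_int] with ω h1 h2 h3 hI hξ hμ j hj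
  obtain ⟨h4, -⟩ := h3 j hj
  set t := (X.tau j ω).toNNReal with ht
  have ht0 : 0 < t := ENNReal.toNNReal_pos h4.ne' hj
  refine h2 t ht0 _ (fun n => h1 j n (ENNReal.toReal_pos h4.ne' hj)) ?_
  have hprim : ContinuousOn (fun u : ℝ => ∫ s in (0 : ℝ)..u, X.μ₂ (X.Θ s.toNNReal ω))
      (Set.uIcc (0 : ℝ) t) := by
    refine intervalIntegral.continuousOn_primitive_interval ?_
    rw [← intervalIntegrable_iff']
    exact hμ t
  have hprim' : Tendsto (fun s : ℝ≥0 => ∫ r in (0 : ℝ)..s, X.μ₂ (X.Θ r.toNNReal ω)) (𝓝[<] t)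
      (𝓝 (∫ r in (0 : ℝ)..t, X.μ₂ (X.Θ r.toNNReal ω))) := by
    refine (hprim t Set.right_mem_uIcc).tendsto.comp ?_
    refine tendsto_nhdsWithin_iff.2 ⟨?_, ?_⟩
    · exact (NNReal.continuous_coe.tendsto t).mono_left nhdsWithin_le_nhds
    · filter_upwards [self_mem_nhdsWithin] with s hs
      rw [Set.uIcc_of_le (NNReal.coe_nonneg t)]
      exact ⟨s.2, (NNReal.coe_lt_coe.2 hs).le⟩
  have hI' : Tendsto (fun s => X.I₂ s ω) (𝓝[<] t) (𝓝 (X.I₂ t ω)) :=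
    (hI.tendsto t).mono_left nhdsWithin_le_nhds
  have h5 := ((X.ξL_cadlag ω).tendsto_sub t).sub
    ((hprim'.const_sub (∫ r in (0 : ℝ)..t, X.μ₂ (X.Θ r.toNNReal ω))).add
      (hI'.const_sub (X.I₂ t ω)))
  simp only [sub_self, add_zero, sub_zero] at h5
  refine h5.congr fun s => ?_
  rw [hξ t, hξ s]
  ring

theorem tendsto_trigger_left {ω : Ω} {t : ℝ≥0} (j : ℕ) :
    Tendsto (fun s => X.trigger s j ω) (𝓝[<] t)
      (𝓝 (if X.tau j ω < t then X.U j ω (X.jumpSize j ω) else 0)) := by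
  by_cases h : X.tau j ω < t
  · rw [if_pos h]
    refine tendsto_const_nhds.congr' ?_
    have hj : X.tau j ω ≠ ∞ := (h.trans_le le_top).ne
    have h' : (X.tau j ω).toNNReal < t := by
      rwa [← ENNReal.coe_lt_coe, ENNReal.coe_toNNReal hj]
    filter_upwards [Ioo_mem_nhdsLT h'] with s hs
    have : X.tau j ω ≤ s := by
      rw [← ENNReal.coe_toNNReal hj]
      exact_mod_cast hs.1.le
    rw [trigger, if_pos this]
  · rw [if_neg h]
    refine tendsto_const_nhds.congr' ?_
    filter_upwards [self_mem_nhdsWithin] with s hs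
    have : ¬ X.tau j ω ≤ s := fun hle => h (hle.trans_lt (by exact_mod_cast hs))
    rw [trigger, if_neg this]

theorem abs_trigger_le {ω : Ω} {s t : ℝ≥0} (h : s ≤ t) (j : ℕ) :
    |X.trigger s j ω| ≤ |X.trigger t j ω| := by
  rw [trigger, trigger]
  split_ifs with h1 h2
  · rfl
  · exact absurd (h1.trans (by exact_mod_cast h)) h2
  · simp
  · rfl

theorem jump_ξf_tau : ∀ᵐ ω ∂P, ∀ j, X.tau j ω ≠ ∞ →
    jump (fun t => X.ξf t ω) (X.tau j ω).toNNReal = X.U j ω (X.jumpSize j ω) := by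
  filter_upwards [X.hasSum_trigger, X.tau_injective, X.tau_spec] with ω h1 h2 h3 j hj
  obtain ⟨h4, -⟩ := h3 j hj
  set t := (X.tau j ω).toNNReal with ht
  have htt : (t : ℝ≥0∞) = X.tau j ω := ENNReal.coe_toNNReal hj
  have ht0 : 0 < t := ENNReal.toNNReal_pos h4.ne' hj
  have := nhdsLT_neBot ht0
  refine tendsto_nhds_unique ((X.ξf_cadlag ω).tendsto_sub t) ?_
  have h5 : Tendsto (fun s => ∑' i, X.trigger s i ω) (𝓝[<] t)
      (𝓝 (∑' i, if X.tau i ω < t then X.U i ω (X.jumpSize i ω) else 0)) := by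
    refine tendsto_tsum_of_dominated_convergence (h1 t).summable.abs
      (fun i => X.tendsto_trigger_left i) ?_
    filter_upwards [self_mem_nhdsWithin] with s hs i
    exact X.abs_trigger_le (le_of_lt hs) i
  have h6 : Summable fun i => if X.tau i ω < t then X.U i ω (X.jumpSize i ω) else 0 := by
    refine (h1 t).summable.abs.of_norm_bounded fun i => ?_
    rw [trigger]
    split_ifs with h7 h8
    · rfl
    · exact absurd h7.le h8
    · simp
    · simp
  have h7 := h5.const_sub (X.ξf t ω)
  -- Finite jump times are distinct, so passing from τ_i ≤ t to τ_i < t removes the j-th term only.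
  have h8 : X.ξf t ω - ∑' i, (if X.tau i ω < t then X.U i ω (X.jumpSize i ω) else 0) =
      X.U j ω (X.jumpSize j ω) := by
    rw [← (h1 t).tsum_eq, ← (h1 t).summable.tsum_sub h6, tsum_eq_single j]
    · rw [trigger, if_pos htt.ge, if_neg (by rw [htt]; exact lt_irrefl _), sub_zero]
    · intro i hij
      have hne : X.tau i ω ≠ t := fun he => hij (h2 i j (he.trans htt) (by simp [he]))
      rw [trigger]
      rcases lt_or_gt_of_ne hne with h | h
      · rw [if_pos h.le, if_pos h, sub_self]
      · rw [if_neg (not_le.2 h), if_neg (not_lt.2 h.le), sub_self]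
  rw [h8] at h7
  refine h7.congr fun s => ?_
  rw [(h1 s).tsum_eq]

/-- Makes each triggered jump readable from the observed ordinate ξ, although its two parts are not
observed separately. -/
theorem tendsto_ξ_grid [IsProbabilityMeasure P] {c : ℝ} (hc0 : 0 < c) (hc : ExpTail X.ν₂ c) :
    ∀ᵐ ω ∂P, ∀ j, X.tau j ω ≠ ∞ → Tendsto (fun n => X.ξ (gridUp n (X.tau j ω).toNNReal) ω -
      X.ξ (gridDown n (X.tau j ω).toNNReal) ω) atTop (𝓝 (X.U j ω (X.jumpSize j ω))) := by
  filter_upwards [X.jump_ξf_tau, X.jump_ξL_tau hc0 hc] with ω h1 h2 j hj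
  have h3 := ((X.ξL_cadlag ω).tendsto_grid (X.tau j ω).toNNReal).add
    ((X.ξf_cadlag ω).tendsto_grid (X.tau j ω).toNNReal)
  rw [h1 j hj, h2 j hj, zero_add] at h3
  refine h3.congr fun n => ?_
  simp only [ξ]
  ring

theorem tendsto_ξf_grid : ∀ᵐ ω ∂P, ∀ j, X.tau j ω ≠ ∞ →
    Tendsto (fun n => X.ξf (gridUp n (X.tau j ω).toNNReal) ω -
      X.ξf (gridDown n (X.tau j ω).toNNReal) ω) atTop (𝓝 (X.U j ω (X.jumpSize j ω))) := by
  filter_upwards [X.jump_ξf_tau] with ω h1 j hj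
  rw [← h1 j hj]
  exact (X.ξf_cadlag ω).tendsto_grid _

end ModulatedProcess
end LevyMAP
end

/-! ### Moments of all orders and measurability with respect to ℱ -/

noncomputable section

namespace LevyMAP

section AllLp

variable {Ω : Type*} {m : MeasurableSpace Ω} {mΩ : MeasurableSpace Ω} {P : Measure Ω}

/-- `f` has moments of all orders. -/
def AllLp (f : Ω → ℝ) (P : Measure Ω) : Prop := ∀ k : ℕ, MemLp f k P

theorem AllLp.mul {f g : Ω → ℝ} (hf : AllLp f P) (hg : AllLp g P) :
    AllLp (fun ω => f ω * g ω) P := fun k => by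
  have : ENNReal.HolderTriple (2 * k : ℕ) (2 * k : ℕ) (k : ℕ) := ⟨by
    push_cast
    rw [ENNReal.mul_inv (by simp) (by simp), ← add_mul, ENNReal.inv_two_add_inv_two, one_mul]⟩
  exact (hg (2 * k)).mul (hf (2 * k))

theorem allLp_const [IsFiniteMeasure P] (c : ℝ) : AllLp (fun _ : Ω => c) P := fun _ =>
  memLp_const c

theorem AllLp.add {f g : Ω → ℝ} (hf : AllLp f P) (hg : AllLp g P) :
    AllLp (fun ω => f ω + g ω) P := fun k => (hf k).add (hg k)

theorem AllLp.sub {f g : Ω → ℝ} (hf : AllLp f P) (hg : AllLp g P) :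
    AllLp (fun ω => f ω - g ω) P := fun k => (hf k).sub (hg k)

theorem AllLp.pow [IsFiniteMeasure P] {f : Ω → ℝ} (hf : AllLp f P) (n : ℕ) :
    AllLp (fun ω => f ω ^ n) P := by
  induction n with
  | zero => simpa using allLp_const 1
  | succ n ih => simpa only [pow_succ] using ih.mul hf

theorem allLp_prod [IsFiniteMeasure P] {ι : Type*} (s : Finset ι) {f : ι → Ω → ℝ}
    (hf : ∀ i ∈ s, AllLp (f i) P) : AllLp (fun ω => ∏ i ∈ s, f i ω) P := by
  classical
  induction s using Finset.induction_on with
  | empty => simpa using allLp_const 1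
  | insert i s hi ih =>
    simp only [Finset.prod_insert hi]
    exact (hf i (Finset.mem_insert_self _ _)).mul
      (ih fun j hj => hf j (Finset.mem_insert_of_mem hj))

theorem AllLp.memLp_two {f : Ω → ℝ} (hf : AllLp f P) : MemLp f 2 P := by
  exact_mod_cast hf 2

theorem AllLp.memLp_four {f : Ω → ℝ} (hf : AllLp f P) : MemLp f 4 P := by
  exact_mod_cast hf 4

theorem AllLp.mono {f g : Ω → ℝ} (hg : AllLp g P) (hf : AEStronglyMeasurable f P)
    (h : ∀ᵐ ω ∂P, |f ω| ≤ |g ω|) : AllLp f P := fun k => (hg k).mono hf h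

theorem AllLp.integrable_mul {f Z : Ω → ℝ} (hf : AllLp f P) (hZ : MemLp Z 2 P) :
    Integrable (fun ω => Z ω * f ω) P :=
  hZ.integrable_mul hf.memLp_two

theorem allLp_toReal [IsFiniteMeasure P] {f : Ω → ℝ≥0∞} (hf : Measurable f)
    (h : ∀ r : ℕ, ∫⁻ ω, f ω ^ r ∂P < ∞) : AllLp (fun ω => (f ω).toReal) P := fun k => by
  rcases Nat.eq_zero_or_pos k with rfl | hk
  · simpa [memLp_zero_iff_aestronglyMeasurable] using hf.ennreal_toReal.aestronglyMeasurable
  refine ⟨hf.ennreal_toReal.aestronglyMeasurable, ?_⟩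
  rw [eLpNorm_lt_top_iff_lintegral_rpow_enorm_lt_top (by simp [hk.ne']) (by simp)]
  refine (lintegral_mono fun ω => ?_).trans_lt (h k)
  rw [ENNReal.toReal_natCast, ENNReal.rpow_natCast]
  gcongr
  rw [Real.enorm_of_nonneg ENNReal.toReal_nonneg]
  exact ENNReal.ofReal_toReal_le

theorem aestronglyMeasurable_of_tendsto {f : ℕ → Ω → ℝ} {g : Ω → ℝ}
    (hf : ∀ n, AEStronglyMeasurable[m] (f n) P)
    (h : ∀ᵐ ω ∂P, Tendsto (fun n => f n ω) atTop (𝓝 (g ω))) : AEStronglyMeasurable[m] g P := by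
  choose f' hf' hff' using hf
  refine ⟨_, @StronglyMeasurable.limUnder _ _ _ m _ _ atTop _ f' _ _ hf', ?_⟩
  filter_upwards [h, ae_all_iff.2 hff'] with ω h1 h2
  simp_rw [← h2]
  exact h1.limUnder_eq.symm

theorem aestronglyMeasurable_of_measurable {f : Ω → ℝ} (hf : Measurable[m] f) :
    AEStronglyMeasurable[m] f P :=
  ⟨f, hf.stronglyMeasurable, ae_eq_rfl⟩

theorem aestronglyMeasurable_sum {ι : Type*} (s : Finset ι) {f : ι → Ω → ℝ}
    (hf : ∀ i, AEStronglyMeasurable[m] (f i) P) :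
    AEStronglyMeasurable[m] (fun ω => ∑ i ∈ s, f i ω) P := by
  classical
  induction s using Finset.induction_on with
  | empty => simpa using aestronglyMeasurable_of_measurable measurable_const
  | insert i s hi ih =>
    simp only [Finset.sum_insert hi]
    exact (hf i).add ih

theorem aestronglyMeasurable_prod {ι : Type*} (s : Finset ι) {f : ι → Ω → ℝ}
    (hf : ∀ i, AEStronglyMeasurable[m] (f i) P) :
    AEStronglyMeasurable[m] (fun ω => ∏ i ∈ s, f i ω) P := by
  classical
  induction s using Finset.induction_on with
  | empty => simpa using aestronglyMeasurable_of_measurable measurable_const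
  | insert i s hi ih =>
    simp only [Finset.prod_insert hi]
    exact (hf i).mul ih

end AllLp

theorem measurable_grid_increment {Ω : Type*} {m : MeasurableSpace Ω} {ξ : ℝ≥0 → Ω → ℝ}
    (hξ : ∀ t, Measurable (ξ t)) {τ : Ω → ℝ≥0} (hτ : Measurable τ) (n : ℕ) :
    Measurable fun ω => ξ (gridUp n (τ ω)) ω - ξ (gridDown n (τ ω)) ω := by
  have h1 : Measurable fun ω => (τ ω, ω) := hτ.prodMk measurable_id
  have h2 := Measurable.comp (g := fun p : ℝ≥0 × Ω => ξ (gridUp n p.1) p.2)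
    (measurable_gridUp hξ n) h1
  have h3 := Measurable.comp (g := fun p : ℝ≥0 × Ω => ξ (gridDown n p.1) p.2)
    (measurable_gridDown hξ n) h1
  exact h2.fun_sub h3

namespace ModulatedProcess

variable {Ω : Type*} {mΩ : MeasurableSpace Ω} {P : Measure Ω} {X : ModulatedProcess P}

theorem MomentAssumptions.lintegral_totalTrigger_pow_lt_top [IsProbabilityMeasure P]
    (hX : X.MomentAssumptions) (T : ℝ≥0) (r : ℕ) : ∫⁻ ω, X.totalTrigger T ω ^ r ∂P < ∞ := by
  obtain ⟨c, hc0, hc1, -, -⟩ := hX.exponential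
  exact X.lintegral_totalTrigger_pow_lt_top
    (fun k p hk => X.lintegral_sumMoment_pow_lt_top hc0 hc1 hX.moments_ξf T hk p) r

theorem MomentAssumptions.allLp_totalTrigger [IsProbabilityMeasure P] (hX : X.MomentAssumptions)
    (T : ℝ≥0) : AllLp (fun ω => (X.totalTrigger T ω).toReal) P :=
  allLp_toReal (X.measurable_totalTrigger T) (hX.lintegral_totalTrigger_pow_lt_top T)

theorem MomentAssumptions.totalTrigger_lt_top [IsProbabilityMeasure P] (hX : X.MomentAssumptions)
    (T : ℝ≥0) : ∀ᵐ ω ∂P, X.totalTrigger T ω < ∞ := by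
  refine ae_lt_top (X.measurable_totalTrigger T) ?_
  simpa using (hX.lintegral_totalTrigger_pow_lt_top T 1).ne

theorem abs_trigger_le_totalTrigger {T : ℝ≥0} {ω : Ω} (h : X.totalTrigger T ω < ∞) (j : ℕ) :
    |X.trigger T j ω| ≤ (X.totalTrigger T ω).toReal := by
  rw [← ENNReal.ofReal_le_iff_le_toReal h.ne]
  exact ENNReal.le_tsum (f := fun j => X.absTrigger T j ω) j

theorem MomentAssumptions.abs_ξf_le [IsProbabilityMeasure P] (hX : X.MomentAssumptions)
    (T : ℝ≥0) : ∀ᵐ ω ∂P, ∀ t ≤ T, |X.ξf t ω| ≤ (X.totalTrigger T ω).toReal := by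
  filter_upwards [X.hasSum_trigger, hX.totalTrigger_lt_top T] with ω h1 h2 t ht
  have h3 : Summable fun j => ‖X.trigger t j ω‖ := (h1 t).summable.abs
  have h4 : Summable fun j => |X.trigger T j ω| := (h1 T).summable.abs
  have h5 : |X.ξf t ω| ≤ ∑' j, |X.trigger T j ω| := by
    rw [← (h1 t).tsum_eq]
    exact (norm_tsum_le_tsum_norm h3).trans (h3.tsum_le_tsum (fun j => X.abs_trigger_le ht j) h4)
  refine h5.trans_eq ?_
  simp only [totalTrigger, absTrigger]
  rw [ENNReal.tsum_toReal_eq fun j => ENNReal.ofReal_ne_top]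
  exact tsum_congr fun j => (ENNReal.toReal_ofReal (abs_nonneg _)).symm

theorem MomentAssumptions.allLp_Θ [IsProbabilityMeasure P] (hX : X.MomentAssumptions) (t : ℝ≥0) :
    AllLp (X.Θ t) P := by
  obtain ⟨c, hc0, hc1, -, -⟩ := hX.exponential
  exact (X.hasExpMoment_Θ hc0 hc1 t).memLp (X.Θ_meas t).aemeasurable

theorem MomentAssumptions.allLp_Θbar [IsProbabilityMeasure P] (hX : X.MomentAssumptions)
    (t : ℝ≥0) : AllLp (X.Θbar t) P := (hX.allLp_Θ t).sub (allLp_const _)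

theorem MomentAssumptions.allLp_ξLbar [IsProbabilityMeasure P] (hX : X.MomentAssumptions)
    (t : ℝ≥0) : AllLp (X.ξLbar t) P := by
  -- Conditional expectation preserves L^p only for p ≥ 1, so exponent 0 is reached by lowering the
  -- exponent afterwards.
  have h1 : ∀ k : ℕ, MemLp (X.ξLbar t) ((k + 1 : ℕ) : ℝ≥0∞) P := fun k =>
    (hX.moments_ξL t _).sub ((hX.moments_ξL t _).condExp (by simp))
  intro k
  exact (h1 k).mono_exponent (by simp)

theorem MomentAssumptions.allLp_ξf [IsProbabilityMeasure P] (hX : X.MomentAssumptions) (t : ℝ≥0) :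
    AllLp (X.ξf t) P := by
  refine (hX.allLp_totalTrigger t).mono (X.ξf_meas t).aestronglyMeasurable ?_
  filter_upwards [hX.abs_ξf_le t] with ω hω
  exact (hω t le_rfl).trans (le_abs_self _)

theorem MomentAssumptions.allLp_ξfbar [IsProbabilityMeasure P] (hX : X.MomentAssumptions)
    (t : ℝ≥0) : AllLp (X.ξfbar t) P := (hX.allLp_ξf t).sub (allLp_const _)

theorem MomentAssumptions.allLp_trigger [IsProbabilityMeasure P] (hX : X.MomentAssumptions)
    (T : ℝ≥0) (j : ℕ) : AllLp (X.trigger T j) P := by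
  refine (hX.allLp_totalTrigger T).mono (X.measurable_trigger T j).aestronglyMeasurable ?_
  filter_upwards [hX.totalTrigger_lt_top T] with ω hω
  exact (abs_trigger_le_totalTrigger hω j).trans (le_abs_self _)

variable (X)

theorem processSigma_Θ_le_Finf : processSigma X.Θ ≤ X.Finf :=
  iSup_le fun t => ((measurable_processSigmaUpTo X.Θ le_rfl).comap_le.trans
    (le_sup_left.trans le_sup_left)).trans (le_iSup X.F t)

theorem processSigma_ξ_le_Finf : processSigma X.ξ ≤ X.Finf :=
  iSup_le fun t => ((measurable_processSigmaUpTo X.ξ le_rfl).comap_le.trans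
    (le_sup_right.trans le_sup_left)).trans (le_iSup X.F t)

theorem ξ_meas (t : ℝ≥0) : Measurable (X.ξ t) := (X.ξL_meas t).add (X.ξf_meas t)

theorem nullSigma_le_measurable : nullSigma P ≤ mΩ :=
  MeasurableSpace.generateFrom_le fun _ h => h.1

theorem F_le (t : ℝ≥0) : X.F t ≤ mΩ :=
  sup_le (sup_le (processSigmaUpTo_le fun s _ => X.Θ_meas s)
    (processSigmaUpTo_le fun s _ => X.ξ_meas s)) nullSigma_le_measurable

theorem Finf_le : X.Finf ≤ mΩ := iSup_le X.F_le

theorem K_le_processSigma (t : ℝ≥0) : X.K t ≤ processSigma X.Θ :=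
  processSigmaUpTo_le_processSigma _ _

variable {X}

theorem MomentAssumptions.aestronglyMeasurable_trigger [IsProbabilityMeasure P]
    (hX : X.MomentAssumptions) (t : ℝ≥0) (j : ℕ) :
    AEStronglyMeasurable[X.Finf] (X.trigger t j) P := by
  obtain ⟨c, hc0, -, hc2, -⟩ := hX.exponential
  have hξ : ∀ t, Measurable[X.Finf] (X.ξ t) := fun t =>
    (measurable_processSigma X.ξ t).mono X.processSigma_ξ_le_Finf le_rfl
  have hτ : Measurable[X.Finf] (X.tau j) :=
    (X.measurable_tau j).mono X.processSigma_Θ_le_Finf le_rfl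
  have hg : ∀ n, Measurable[X.Finf] fun ω => if X.tau j ω ≤ t then
      X.ξ (gridUp n (X.tau j ω).toNNReal) ω - X.ξ (gridDown n (X.tau j ω).toNNReal) ω else 0 := by
    intro n
    exact Measurable.ite (hτ measurableSet_Iic)
      (measurable_grid_increment hξ (ENNReal.measurable_toNNReal.comp hτ) n) measurable_const
  refine aestronglyMeasurable_of_tendsto
    (fun n => aestronglyMeasurable_of_measurable (hg n)) ?_
  filter_upwards [X.tendsto_ξ_grid hc0 hc2] with ω hω
  simp only [trigger]
  by_cases h : X.tau j ω ≤ t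
  · simp only [if_pos h]
    exact hω j (ne_top_of_le_ne_top ENNReal.coe_ne_top h)
  · simp only [if_neg h]
    exact tendsto_const_nhds

/-- ξ^f is the sum of its triggers, and each trigger is a limit of increments of ξ around a time
known from Θ. The centred ξ^L is then recovered by subtraction. -/
theorem MomentAssumptions.aestronglyMeasurable_ξf [IsProbabilityMeasure P]
    (hX : X.MomentAssumptions) (t : ℝ≥0) : AEStronglyMeasurable[X.Finf] (X.ξf t) P := by
  refine aestronglyMeasurable_of_tendsto (f := fun n ω => ∑ j ∈ Finset.range n, X.trigger t j ω)
    (fun n => aestronglyMeasurable_sum _ fun j => hX.aestronglyMeasurable_trigger t j) ?_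
  filter_upwards [X.hasSum_trigger] with ω hω
  exact (hω t).tendsto_sum_nat

theorem MomentAssumptions.aestronglyMeasurable_ξfbar [IsProbabilityMeasure P]
    (hX : X.MomentAssumptions) (t : ℝ≥0) : AEStronglyMeasurable[X.Finf] (X.ξfbar t) P :=
  (hX.aestronglyMeasurable_ξf t).sub aestronglyMeasurable_const

theorem MomentAssumptions.aestronglyMeasurable_ξLbar [IsProbabilityMeasure P]
    (hX : X.MomentAssumptions) (t : ℝ≥0) : AEStronglyMeasurable[X.Finf] (X.ξLbar t) P := by
  have hξ : Measurable[X.Finf] (X.ξ t) :=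
    (measurable_processSigma X.ξ t).mono X.processSigma_ξ_le_Finf le_rfl
  have h1 : AEStronglyMeasurable[X.Finf] (X.ξ t) P :=
    aestronglyMeasurable_of_measurable hξ
  have h2 : AEStronglyMeasurable[X.Finf] (condExp (X.K t) P (X.ξL t)) P :=
    (stronglyMeasurable_condExp.mono
      ((X.K_le_processSigma t).trans X.processSigma_Θ_le_Finf)).aestronglyMeasurable
  refine ((h1.sub (hX.aestronglyMeasurable_ξf t)).sub h2).congr (Eventually.of_forall fun ω => ?_)
  simp [ξLbar, ξ]

theorem aestronglyMeasurable_Θbar (t : ℝ≥0) : AEStronglyMeasurable[X.Finf] (X.Θbar t) P := by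
  have h : Measurable[X.Finf] (X.Θbar t) :=
    ((measurable_processSigma X.Θ t).mono X.processSigma_Θ_le_Finf le_rfl).sub measurable_const
  exact aestronglyMeasurable_of_measurable h

end ModulatedProcess
end LevyMAP
end

/-! ### Exponential moments localised on events of the modulator -/

noncomputable section

namespace LevyMAP

theorem measurable_integral_Ioc {Ω : Type*} {m : MeasurableSpace Ω} {f : ℝ → Ω → ℝ}
    (hf : Measurable (Function.uncurry f)) (t : ℝ) : Measurable fun ω => ∫ s in (0 : ℝ)..t, f s ω := by
  simp_rw [intervalIntegral]
  exact (hf.stronglyMeasurable.integral_prod_left).measurable.sub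
    (hf.stronglyMeasurable.integral_prod_left).measurable

theorem measurable_lintegral_Ioc {Ω : Type*} {m : MeasurableSpace Ω} {f : ℝ → Ω → ℝ≥0∞}
    (hf : Measurable (Function.uncurry f)) (t : ℝ) :
    Measurable fun ω => ∫⁻ s in Set.Ioc (0 : ℝ) t, f s ω :=
  hf.lintegral_prod_left

theorem measurable_comp_cadlag {Ω : Type*} {m : MeasurableSpace Ω} {X : ℝ≥0 → Ω → ℝ}
    (hX : ∀ t, Measurable (X t)) (hc : ∀ ω, IsCadlagPath (fun t => X t ω)) {φ : ℝ → ℝ}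
    (hφ : Measurable φ) : Measurable fun p : ℝ × Ω => φ (X p.1.toNNReal p.2) := by
  have h1 : Measurable fun p : ℝ × Ω => (p.1.toNNReal, p.2) :=
    (measurable_real_toNNReal.comp measurable_fst).prodMk measurable_snd
  have h2 := Measurable.comp (g := fun p : ℝ≥0 × Ω => X p.1 p.2)
    (measurable_uncurry_of_cadlag hX hc) h1
  exact hφ.comp h2

namespace ModulatedProcess

variable {Ω : Type*} {mΩ : MeasurableSpace Ω} {P : Measure Ω} (X : ModulatedProcess P)

/-- `V` has exponential moments on an increasing sequence of events of the modulator that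
exhausts the probability space. -/
def LocExp (V : Ω → ℝ) : Prop :=
  ∃ A : ℕ → Set Ω, (∀ N, MeasurableSet[processSigma X.Θ] (A N)) ∧ Monotone A ∧
    (∀ᵐ ω ∂P, ∃ N, ω ∈ A N) ∧ ∀ N, HasExpMoment V (P.restrict (A N))

variable {X}

theorem exists_common_locExp {ι : Type*} (s : Finset ι) {V : ι → Ω → ℝ}
    (h : ∀ i ∈ s, X.LocExp (V i)) :
    ∃ A : ℕ → Set Ω, (∀ N, MeasurableSet[processSigma X.Θ] (A N)) ∧ Monotone A ∧
      (∀ᵐ ω ∂P, ∃ N, ω ∈ A N) ∧ ∀ N, ∀ i ∈ s, HasExpMoment (V i) (P.restrict (A N)) := by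
  classical
  induction s using Finset.induction_on with
  | empty =>
    exact ⟨fun _ => Set.univ, fun _ => @MeasurableSet.univ _ (_), monotone_const,
      Eventually.of_forall fun ω => ⟨0, trivial⟩, fun N i hi => absurd hi (Finset.notMem_empty i)⟩
  | insert i s hi ih =>
    obtain ⟨A, hA, hAm, hAe, hAV⟩ := ih fun j hj => h j (Finset.mem_insert_of_mem hj)
    obtain ⟨B, hB, hBm, hBe, hBV⟩ := h i (Finset.mem_insert_self i s)
    refine ⟨fun N => A N ∩ B N, fun N => (hA N).inter (hB N),
      fun a b hab => Set.inter_subset_inter (hAm hab) (hBm hab), ?_, fun N j hj => ?_⟩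
    · filter_upwards [hAe, hBe] with ω ⟨N, hN⟩ ⟨N', hN'⟩
      exact ⟨max N N', hAm (le_max_left _ _) hN, hBm (le_max_right _ _) hN'⟩
    · rcases Finset.mem_insert.1 hj with rfl | hj
      · exact (hBV N).mono_measure (Measure.restrict_mono Set.inter_subset_right le_rfl)
      · exact (hAV N j hj).mono_measure (Measure.restrict_mono Set.inter_subset_left le_rfl)

theorem MomentAssumptions.locExp_Θ [IsProbabilityMeasure P] (hX : X.MomentAssumptions) (t : ℝ≥0) :
    X.LocExp (X.Θ t) := by
  obtain ⟨c, hc0, hc1, -, -⟩ := hX.exponential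
  exact ⟨fun _ => Set.univ, fun _ => @MeasurableSet.univ _ (_), monotone_const,
    Eventually.of_forall fun ω => ⟨0, trivial⟩,
    fun N => (X.hasExpMoment_Θ hc0 hc1 t).mono_measure Measure.restrict_le_self⟩

theorem lintegral_exp_lt_top {μ : Measure ℝ} [IsFiniteMeasure μ] {c : ℝ} (hc : 0 ≤ c)
    (h : ∫⁻ y in {y : ℝ | 1 ≤ |y|}, ENNReal.ofReal (Real.exp (c * |y|)) ∂μ < ∞) :
    ∫⁻ y, ENNReal.ofReal (Real.exp (c * |y|)) ∂μ < ∞ := by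
  have hm : MeasurableSet {y : ℝ | 1 ≤ |y|} := measurableSet_le measurable_const (by fun_prop)
  rw [← lintegral_add_compl _ hm]
  refine ENNReal.add_lt_top.2 ⟨h, ?_⟩
  refine (setLIntegral_mono' (g := fun _ => ENNReal.ofReal (Real.exp c)) hm.compl
    fun y hy => ?_).trans_lt ?_
  · have hy' : |y| ≤ 1 := (not_le.1 (Set.mem_ofPred.not.1 hy)).le
    gcongr
    exact mul_le_of_le_one_right hc hy'
  · rw [setLIntegral_const]
    exact ENNReal.mul_lt_top ENNReal.ofReal_lt_top (measure_lt_top _ _)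

/-- The exponential moment of U(x) is finite for every x but need not be bounded in x. The
localising events bound it at x = ΔΘ, and conditioning on the modulator does the rest. -/
theorem MomentAssumptions.locExp_trigger [IsProbabilityMeasure P] (hX : X.MomentAssumptions)
    (T : ℝ≥0) (j : ℕ) : X.LocExp (X.trigger T j) := by
  obtain ⟨c, hc0, -, -, hc3⟩ := hX.exponential
  set ψ : ℝ → ℝ≥0∞ := fun x => ∫⁻ y, ENNReal.ofReal (Real.exp (c * |y|)) ∂(X.jumpLaw x) with hψ
  have hψm : Measurable ψ := X.measurable_lintegral_jumpLaw (by fun_prop)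
  have hψx : Measurable[processSigma X.Θ] fun ω => ψ (X.jumpSize j ω) :=
    hψm.comp (X.measurable_jumpSize j)
  have hAm : ∀ N : ℕ, MeasurableSet[processSigma X.Θ] {ω | ψ (X.jumpSize j ω) ≤ N} := fun N =>
    hψx measurableSet_Iic
  refine ⟨fun N => {ω | ψ (X.jumpSize j ω) ≤ N}, hAm,
    fun a b hab ω hω => le_trans (Set.mem_ofPred.1 hω) (by exact_mod_cast hab),
    Eventually.of_forall fun ω => ?_, fun N => ?_⟩
  · have h1 : ψ (X.jumpSize j ω) < ∞ := lintegral_exp_lt_top hc0.le (hc3 _)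
    obtain ⟨N, hN⟩ := ENNReal.exists_nat_gt h1.ne
    exact ⟨N, hN.le⟩
  · have hA' := X.processSigma_Θ_le _ (hAm N)
    have h1 : Measurable[processSigma X.Θ] ({ω | ψ (X.jumpSize j ω) ≤ N}.indicator
        (fun _ => (1 : ℝ≥0∞))) := measurable_const.indicator (hAm N)
    have h2 := X.lintegral_mul_U X.processSigma_Θ_le
      (indep_of_indep_of_le_right (X.indep_others j) le_sup_left) h1 (X.measurable_jumpSize j)
      (f := fun y => ENNReal.ofReal (Real.exp (c * |y|))) (by fun_prop)
    have h3 := X.measurable_trigger T j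
    refine ⟨c, hc0, Measurable.aestronglyMeasurable (by fun_prop), ?_⟩
    rw [hasFiniteIntegral_iff_ofReal (Eventually.of_forall fun _ => (Real.exp_pos _).le),
      ← lintegral_indicator hA']
    calc ∫⁻ ω, {ω | ψ (X.jumpSize j ω) ≤ N}.indicator
          (fun ω => ENNReal.ofReal (Real.exp (c * |X.trigger T j ω|))) ω ∂P
        ≤ ∫⁻ ω, 1 + {ω | ψ (X.jumpSize j ω) ≤ N}.indicator (fun _ => (1 : ℝ≥0∞)) ω *
            ENNReal.ofReal (Real.exp (c * |X.U j ω (X.jumpSize j ω)|)) ∂P := by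
          refine lintegral_mono fun ω => ?_
          by_cases hω : ω ∈ {ω | ψ (X.jumpSize j ω) ≤ N}
          · simp only [Set.indicator_of_mem hω, one_mul, trigger]
            split_ifs
            · exact le_add_self
            · simp
          · simp only [Set.indicator_of_notMem hω, zero_mul, add_zero, zero_le]
      _ ≤ 1 + ∫⁻ ω, N ∂P := by
          rw [lintegral_add_left measurable_const, h2]
          simp only [lintegral_const, measure_univ, mul_one]
          refine add_le_add le_rfl ((lintegral_mono (g := fun _ => (N : ℝ≥0∞)) fun ω => ?_).trans_eq
            (by simp))
          by_cases hω : ω ∈ {ω | ψ (X.jumpSize j ω) ≤ N}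
          · simp only [Set.indicator_of_mem hω, one_mul]
            exact hω
          · simp only [Set.indicator_of_notMem hω, zero_mul, zero_le]
      _ < ∞ := by simp

/-- The centred ξ^L equals a + I₂ + J₂, where a collects the modulator-measurable terms. On the
events where |a| and the quadratic variation of I₂ are at most N, all three terms have exponential
moments. -/
theorem MomentAssumptions.locExp_ξLbar [IsProbabilityMeasure P] (hX : X.MomentAssumptions)
    (t : ℝ≥0) : X.LocExp (X.ξLbar t) := by
  obtain ⟨c, hc0, -, hc2, -⟩ := hX.exponential
  have hΘm := measurable_processSigma X.Θ
  set a : Ω → ℝ := fun ω => X.x₀ + (∫ s in (0 : ℝ)..t, X.μ₂ (X.Θ s.toNNReal ω)) -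
    condExp (X.K t) P (X.ξL t) ω with ha
  have ham : Measurable[processSigma X.Θ] a := by
    refine Measurable.fun_sub (measurable_const.fun_add ?_) ?_
    · exact measurable_integral_Ioc (measurable_comp_cadlag hΘm X.Θ_cadlag X.μ₂_meas) t
    · exact stronglyMeasurable_condExp.measurable.mono (X.K_le_processSigma t) le_rfl
  set q : Ω → ℝ≥0∞ := fun ω => ∫⁻ s in Set.Ioc (0 : ℝ) t,
    ENNReal.ofReal (X.σ₂ (X.Θ s.toNNReal ω) ^ 2) with hq
  have hqm : Measurable[processSigma X.Θ] q := by
    have h1 := measurable_comp_cadlag hΘm X.Θ_cadlag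
      (φ := fun x => X.σ₂ x ^ 2) (X.σ₂_meas.pow_const 2)
    exact measurable_lintegral_Ioc
      (f := fun s ω => ENNReal.ofReal (X.σ₂ (X.Θ s.toNNReal ω) ^ 2)) h1.ennreal_ofReal t
  have hqfin : ∀ᵐ ω ∂P, q ω < ∞ := by
    filter_upwards [X.σ₂_int] with ω hω
    have h1 := (hω t).1
    exact h1.lintegral_lt_top
  have hA1 : ∀ N : ℕ, MeasurableSet[processSigma X.Θ] {ω | a ω ∈ Set.Icc (-(N : ℝ)) N} := fun N =>
    ham measurableSet_Icc
  have hA2 : ∀ N : ℕ, MeasurableSet[processSigma X.Θ] {ω | q ω ≤ N} := fun N =>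
    hqm measurableSet_Iic
  obtain ⟨hJm, hJ⟩ := X.J₂_spec.hasExpMoment X.levy₂ X.M₂_poisson hc0 hc2 t
  have hH : ∀ ω, Measurable fun s : ℝ => X.σ₂ (X.Θ s.toNNReal ω) := fun ω =>
    (measurable_comp_cadlag X.Θ_meas X.Θ_cadlag X.σ₂_meas).comp measurable_prodMk_right
  obtain ⟨hIm, hI⟩ := X.I₂_spec.hasExpMoment X.W_brownian X.W_meas X.processSigma_Θ_le X.W_indep
    (fun t => sup_le_sup_right (processSigmaUpTo_le_processSigma X.Θ t) _) hH t
  refine ⟨fun N => {ω | a ω ∈ Set.Icc (-(N : ℝ)) N} ∩ {ω | q ω ≤ N},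
    fun N => (hA1 N).inter (hA2 N), fun N N' h => ?_, ?_, fun N => ?_⟩
  · have h' : (N : ℝ) ≤ N' := by exact_mod_cast h
    refine Set.inter_subset_inter (fun ω hω => ?_) fun ω hω => ?_
    · exact Set.Icc_subset_Icc (neg_le_neg h') h' hω
    · exact le_trans (Set.mem_ofPred.1 hω) (by exact_mod_cast h)
  · filter_upwards [hqfin] with ω hω
    obtain ⟨N, hN⟩ := ENNReal.exists_nat_gt hω.ne
    obtain ⟨N', hN'⟩ := exists_nat_ge |a ω|
    refine ⟨max N N', ?_, ?_⟩
    · refine abs_le.1 (hN'.trans ?_)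
      exact_mod_cast le_max_right _ _
    · exact hN.le.trans (by exact_mod_cast le_max_left _ _)
  · set A := {ω | a ω ∈ Set.Icc (-(N : ℝ)) N} ∩ {ω | q ω ≤ N} with hAdef
    have hAm : MeasurableSet A := X.processSigma_Θ_le _ ((hA1 N).inter (hA2 N))
    have ham' : Measurable a := ham.mono X.processSigma_Θ_le le_rfl
    have hea : HasExpMoment a (P.restrict A) := by
      refine (hasExpMoment_const (N : ℝ)).mono ham'.aemeasurable ?_
      filter_upwards [ae_restrict_mem hAm] with ω hω
      rw [abs_of_nonneg (Nat.cast_nonneg N : (0 : ℝ) ≤ N)]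
      exact abs_le.2 hω.1
    have heI := hI A N hAm fun ω hω => hω.2
    have heJ := hJ.mono_measure (Measure.restrict_le_self (s := A))
    have h1 := hea.add heI ham'.aemeasurable hIm.restrict
    have h2 := h1.add heJ (ham'.aemeasurable.add hIm.restrict) hJm.restrict
    refine h2.mono ?_ ?_
    · exact ((X.ξL_meas t).sub (stronglyMeasurable_condExp.measurable.mono
        ((X.K_le_processSigma t).trans X.processSigma_Θ_le) le_rfl)).aemeasurable
    · filter_upwards [ae_restrict_of_ae X.ξL_eq] with ω hω
      refine le_of_eq ?_
      simp only [ξLbar, ha]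
      rw [hω t]
      congr 1
      ring

end ModulatedProcess
end LevyMAP
end

/-! ### Density by orthogonality and approximation by finitely many times -/

noncomputable section

namespace LevyMAP

section Hilbert

variable {Ω : Type*} {m m' : MeasurableSpace Ω} {mΩ : MeasurableSpace Ω} {P : Measure Ω}

/-- A subspace of `L²(m)` whose orthogonal complement in `L²(m)` is trivial is dense in `L²(m)`. -/
theorem topologicalClosure_eq_lpMeas (hm : m ≤ mΩ) {K : Submodule ℝ (Lp ℝ 2 P)}
    (hK : K ≤ lpMeas ℝ ℝ m 2 P)
    (h : ∀ f : Lp ℝ 2 P, AEStronglyMeasurable[m] f P → (∀ g ∈ K, inner ℝ g f = 0) → f =ᵐ[P] 0) :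
    K.topologicalClosure = lpMeas ℝ ℝ m 2 P := by
  have hle : K.topologicalClosure ≤ lpMeas ℝ ℝ m 2 P := by
    refine K.topologicalClosure_minimal hK ?_
    exact isClosed_aestronglyMeasurable hm
  refine le_antisymm hle fun z hz => ?_
  have : CompleteSpace K.topologicalClosure :=
    K.isClosed_topologicalClosure.isComplete.completeSpace_coe
  obtain ⟨y, hy, w, hw, rfl⟩ := K.topologicalClosure.exists_add_mem_mem_orthogonal z
  have hwm : w ∈ lpMeas ℝ ℝ m 2 P := by
    have := Submodule.sub_mem _ hz (hle hy)
    rwa [add_sub_cancel_left] at this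
  have hw0 : w = 0 := by
    refine Lp.ext ((h w (mem_lpMeas_iff_aestronglyMeasurable.1 hwm) fun g hg => ?_).trans
      (Lp.coeFn_zero _ _ _).symm)
    exact (Submodule.mem_orthogonal _ _).1 hw g (K.le_topologicalClosure hg)
  rw [hw0, add_zero]
  exact hy

theorem aestronglyMeasurable_of_le_eventually (h : m ≤ eventuallyMeasurableSpace m' (ae P))
    {Z : Ω → ℝ} (hZ : AEStronglyMeasurable[m] Z P) : AEStronglyMeasurable[m'] Z P := by
  obtain ⟨Z', hZ', hZZ'⟩ := hZ
  obtain ⟨Z'', hZ'', h2⟩ := exists_measurable_ae_eq_real (hZ'.measurable.mono h le_rfl)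
  exact (aestronglyMeasurable_of_measurable hZ'').congr (hZZ'.trans h2).symm

theorem ae_eq_zero_of_setIntegral_eq_zero [IsFiniteMeasure P] (hm : m ≤ mΩ) {Z : Ω → ℝ}
    (hZ : AEStronglyMeasurable[m] Z P) (hi : Integrable Z P)
    (h : ∀ D, MeasurableSet[m] D → ∫ ω in D, Z ω ∂P = 0) : Z =ᵐ[P] 0 :=
  ae_eq_of_forall_setIntegral_eq_of_sigmaFinite' hm (fun _ _ _ => hi.integrableOn)
    (fun _ _ _ => (integrable_zero _ _ _).integrableOn)
    (fun D hD _ => by simpa using h D hD) hZ aestronglyMeasurable_zero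

theorem indicatorConstLp_mem_lpMeas [IsFiniteMeasure P] {D : Set Ω} (hD : MeasurableSet[m] D)
    (hD' : MeasurableSet D) :
    indicatorConstLp 2 hD' (measure_ne_top P D) (1 : ℝ) ∈ lpMeas ℝ ℝ m 2 P := by
  rw [mem_lpMeas_iff_aestronglyMeasurable]
  exact (aestronglyMeasurable_of_measurable (f := D.indicator fun _ => (1 : ℝ))
    (measurable_const.indicator hD)).congr indicatorConstLp_coeFn.symm

end Hilbert

namespace ModulatedProcess

variable {Ω : Type*} {mΩ : MeasurableSpace Ω} {P : Measure Ω} (X : ModulatedProcess P)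

/-- The centred processes `Θ̄`, `ξ̄^L` and `ξ̄^f`. -/
def bar (i : Fin 3) (t : ℝ≥0) : Ω → ℝ := ![X.Θbar t, X.ξLbar t, X.ξfbar t] i

theorem measurable_bar (i : Fin 3) (t : ℝ≥0) : Measurable (X.bar i t) := by
  fin_cases i
  · exact (X.Θ_meas t).sub_const _
  · exact (X.ξL_meas t).sub (stronglyMeasurable_condExp.measurable.mono
      ((X.K_le_processSigma t).trans X.processSigma_Θ_le) le_rfl)
  · exact (X.ξf_meas t).sub_const _

/-- The σ-algebra generated by the centred processes up to time `t`. -/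
abbrev barSigma (t : ℝ≥0) : MeasurableSpace Ω :=
  ⨆ p : Set.Iic t × Fin 3, MeasurableSpace.comap (X.bar p.2 p.1) inferInstance

theorem measurable_bar_barSigma {s t : ℝ≥0} (h : s ≤ t) (i : Fin 3) :
    Measurable[X.barSigma t] (X.bar i s) :=
  (comap_measurable _).mono (le_iSup (fun p : Set.Iic t × Fin 3 =>
    MeasurableSpace.comap (X.bar p.2 p.1) inferInstance) (⟨s, h⟩, i)) le_rfl

theorem barSigma_le (t : ℝ≥0) : X.barSigma t ≤ mΩ :=
  iSup_le fun p => (X.measurable_bar p.2 p.1).comap_le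

/-- Centring loses no information: 𝔼[ξ^L_s | 𝒦_s] is a function of Θ up to s, and the other two
corrections are constants. -/
theorem F_le_barSigma (t : ℝ≥0) : X.F t ≤ X.barSigma t ⊔ nullSigma P := by
  have hΘ : ∀ s ≤ t, Measurable[X.barSigma t] (X.Θ s) := fun s hs => by
    have h := (X.measurable_bar_barSigma hs 0).add_const (∫ ω', X.Θ s ω' ∂P)
    have e : (fun ω => X.bar 0 s ω + ∫ ω', X.Θ s ω' ∂P) = X.Θ s := by
      ext ω
      simp [bar, Θbar]
    rwa [e] at h
  refine sup_le_sup_right (sup_le (processSigmaUpTo_le hΘ) (processSigmaUpTo_le fun s hs => ?_)) _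
  have hK : Measurable[X.barSigma t] (condExp (X.K s) P (X.ξL s)) :=
    stronglyMeasurable_condExp.measurable.mono
      (processSigmaUpTo_le fun r hr => hΘ r (hr.trans hs)) le_rfl
  have h := ((X.measurable_bar_barSigma hs 1).fun_add hK).fun_add
    ((X.measurable_bar_barSigma hs 2).add_const (s * ∫ x, ∫ y, y ∂(X.jumpLaw x) ∂X.ν₁))
  have e : (fun ω => X.bar 1 s ω + condExp (X.K s) P (X.ξL s) ω +
      (X.bar 2 s ω + s * ∫ x, ∫ y, y ∂(X.jumpLaw x) ∂X.ν₁)) = X.ξ s := by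
    ext ω
    simp [bar, ξLbar, ξfbar, ξ]
  rwa [e] at h

/-- The σ-algebra generated by the centred processes at finitely many times. -/
abbrev finSigma {t : ℝ≥0} (S : Finset (Set.Iic t)) : MeasurableSpace Ω :=
  ⨆ r ∈ S, ⨆ i : Fin 3, MeasurableSpace.comap (X.bar i r) inferInstance

theorem finSigma_mono {t : ℝ≥0} {S S' : Finset (Set.Iic t)} (h : S ⊆ S') :
    X.finSigma S ≤ X.finSigma S' :=
  biSup_mono fun _ hr => h hr

theorem finSigma_le_barSigma {t : ℝ≥0} (S : Finset (Set.Iic t)) : X.finSigma S ≤ X.barSigma t :=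
  iSup₂_le fun r _ => iSup_le fun i => (X.measurable_bar_barSigma r.2 i).comap_le

theorem finSigma_le_marginalSigma {t : ℝ≥0} (S : Finset (Set.Iic t)) :
    X.finSigma S ≤ X.marginalSigma fun i => (S.orderEmbOfFin rfl i : ℝ≥0) := by
  refine iSup₂_le fun r hr => iSup_le fun i => ?_
  obtain ⟨k, hk⟩ : r ∈ Set.range (S.orderEmbOfFin rfl) := by
    rw [Finset.range_orderEmbOfFin]
    exact hr
  subst hk
  fin_cases i
  · exact le_sup_of_le_left (le_sup_of_le_left (le_iSup (fun k =>
      MeasurableSpace.comap (X.Θbar (S.orderEmbOfFin rfl k)) inferInstance) k))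
  · exact le_sup_of_le_left (le_sup_of_le_right (le_iSup (fun k =>
      MeasurableSpace.comap (X.ξLbar (S.orderEmbOfFin rfl k)) inferInstance) k))
  · exact le_sup_of_le_right (le_iSup (fun k =>
      MeasurableSpace.comap (X.ξfbar (S.orderEmbOfFin rfl k)) inferInstance) k)

theorem measurableSet_finSigma {t : ℝ≥0} [DecidableEq (Set.Iic t)]
    (s : Finset (Set.Iic t × Fin 3)) {A : Set.Iic t × Fin 3 → Set Ω}
    (hA : ∀ p ∈ s, MeasurableSet[MeasurableSpace.comap (X.bar p.2 p.1) inferInstance] (A p)) :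
    MeasurableSet[X.finSigma (s.image Prod.fst)] (⋂ p ∈ s, A p) := by
  refine MeasurableSet.biInter s.countable_toSet fun p hp => ?_
  have hp' : p.1 ∈ s.image Prod.fst := Finset.mem_image_of_mem _ hp
  have hle : MeasurableSpace.comap (X.bar p.2 p.1) inferInstance ≤ X.finSigma (s.image Prod.fst) :=
    le_iSup₂_of_le p.1 hp' (le_iSup (fun i =>
      MeasurableSpace.comap (X.bar i p.1) inferInstance) p.2)
  exact hle _ (hA p hp)

theorem closure_iSup_finSigma [IsProbabilityMeasure P] (t : ℝ≥0) :
    (⨆ S : Finset (Set.Iic t), lpMeas ℝ ℝ (X.finSigma S) 2 P).topologicalClosure =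
      lpMeas ℝ ℝ (X.barSigma t) 2 P := by
  classical
  refine topologicalClosure_eq_lpMeas (X.barSigma_le t) (iSup_le fun S f hf => ?_) fun f hf h => ?_
  · rw [mem_lpMeas_iff_aestronglyMeasurable] at hf ⊢
    exact hf.mono (X.finSigma_le_barSigma S)
  have hi : Integrable f P := (Lp.memLp f).integrable (by norm_num)
  refine ae_eq_zero_of_setIntegral_eq_zero (X.barSigma_le t) hf hi fun D hD => ?_
  refine setIntegral_eq_zero_of_iSup hi (fun p : Set.Iic t × Fin 3 =>
    MeasurableSpace.comap (X.bar p.2 p.1) inferInstance)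
    (fun p => (X.measurable_bar p.2 p.1).comap_le) (fun s A hA => ?_) hD
  have hAS := X.measurableSet_finSigma s hA
  have hAm : MeasurableSet (⋂ p ∈ s, A p) :=
    (X.finSigma_le_barSigma _).trans (X.barSigma_le t) _ hAS
  rw [← L2.inner_indicatorConstLp_one (𝕜 := ℝ) hAm (measure_ne_top P _) f]
  exact h _ (Submodule.mem_iSup_of_mem _ (indicatorConstLp_mem_lpMeas hAS hAm))

theorem exists_marginal_approx [IsProbabilityMeasure P] {t : ℝ≥0} {Z : Ω → ℝ} (hZ : MemLp Z 2 P)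
    (hZF : AEStronglyMeasurable[X.F t] Z P) {ε : ℝ} (hε : 0 < ε) :
    ∃ (m : ℕ) (s : Fin m → ℝ≥0) (Zε : Ω → ℝ), Monotone s ∧ (∀ i, s i ≤ t) ∧
      StronglyMeasurable[X.marginalSigma s] Zε ∧ MemLp Zε 2 P ∧
      ∫ ω, (Z ω - Zε ω) ^ 2 ∂P < ε := by
  have hZm : AEStronglyMeasurable[X.barSigma t] Z P := aestronglyMeasurable_of_le_eventually
    ((X.F_le_barSigma t).trans sup_nullSigma_le_eventually) hZF
  have hmem : hZ.toLp Z ∈ lpMeas ℝ ℝ (X.barSigma t) 2 P := by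
    rw [mem_lpMeas_iff_aestronglyMeasurable]
    exact hZm.congr hZ.coeFn_toLp.symm
  rw [← X.closure_iSup_finSigma t] at hmem
  obtain ⟨g, hg, hdist⟩ := Metric.mem_closure_iff.1 hmem (√ε) (Real.sqrt_pos.2 hε)
  -- The subspaces increase with the set of times, so an element of their supremum already belongs
  -- to a single finite set of times.
  have hdir : Directed (· ≤ ·) fun S : Finset (Set.Iic t) => lpMeas ℝ ℝ (X.finSigma S) 2 P := by
    classical
    refine Monotone.directed_le fun S S' h f hf => ?_
    rw [mem_lpMeas_iff_aestronglyMeasurable] at hf ⊢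
    exact hf.mono (X.finSigma_mono h)
  obtain ⟨S, hS⟩ := (Submodule.mem_iSup_of_directed _ hdir).1 hg
  obtain ⟨Zε, hZε, hgZ⟩ := mem_lpMeas_iff_aestronglyMeasurable.1 hS
  refine ⟨S.card, fun i => (S.orderEmbOfFin rfl i : ℝ≥0), Zε, fun i j hij =>
    (S.orderEmbOfFin rfl).monotone hij, fun i => (S.orderEmbOfFin rfl i).2,
    hZε.mono (X.finSigma_le_marginalSigma S), (memLp_congr_ae hgZ).1 (Lp.memLp g), ?_⟩
  have h1 : ∫ ω, (Z ω - Zε ω) ^ 2 ∂P = ‖hZ.toLp Z - g‖ ^ 2 := by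
    rw [← real_inner_self_eq_norm_sq, L2.inner_def]
    refine integral_congr_ae ?_
    filter_upwards [hgZ, hZ.coeFn_toLp, Lp.coeFn_sub (hZ.toLp Z) g] with ω h1 h2 h3
    rw [h3, Pi.sub_apply, h2, h1, real_inner_self_eq_norm_sq, Real.norm_eq_abs, sq_abs]
  rw [h1, ← dist_eq_norm]
  calc dist (hZ.toLp Z) g ^ 2 < √ε ^ 2 := by gcongr
    _ = ε := Real.sq_sqrt hε.le

end ModulatedProcess
end LevyMAP
end

/-! ### The algebra generated by the centred processes -/

noncomputable section

namespace LevyMAP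
namespace ModulatedProcess

variable {Ω : Type*} {mΩ : MeasurableSpace Ω} {P : Measure Ω} (X : ModulatedProcess P)

/-- The algebra of functions generated by the centred processes. -/
def barAlgebra : Subalgebra ℝ (Ω → ℝ) :=
  Algebra.adjoin ℝ (Set.range fun p : Fin 3 × ℝ≥0 => X.bar p.1 p.2)

theorem bar_mem_barAlgebra (i : Fin 3) (t : ℝ≥0) : X.bar i t ∈ X.barAlgebra :=
  Algebra.subset_adjoin ⟨(i, t), rfl⟩

theorem const_mem_barAlgebra (c : ℝ) : (fun _ => c) ∈ X.barAlgebra :=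
  X.barAlgebra.algebraMap_mem c

theorem Θ_mem_barAlgebra (t : ℝ≥0) : X.Θ t ∈ X.barAlgebra := by
  convert! X.barAlgebra.add_mem (X.bar_mem_barAlgebra 0 t)
    (X.const_mem_barAlgebra (∫ ω', X.Θ t ω' ∂P)) using 1
  ext ω
  simp [bar, Θbar]

theorem ξf_mem_barAlgebra (t : ℝ≥0) : X.ξf t ∈ X.barAlgebra := by
  convert! X.barAlgebra.add_mem (X.bar_mem_barAlgebra 2 t)
    (X.const_mem_barAlgebra (t * ∫ x, ∫ y, y ∂(X.jumpLaw x) ∂X.ν₁)) using 1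
  ext ω
  simp [bar, ξfbar]

/-- The monomial with exponents `g i` in the process `bar i`. -/
def finsuppMonomial (g : Fin 3 → ℝ≥0 →₀ ℕ) (ω : Ω) : ℝ :=
  ∏ i, (g i).prod fun t k => X.bar i t ω ^ k

/-- All times occurring in the three factors are collected and sorted; exponent 0 fills the places
where a process is not evaluated. -/
theorem finsuppMonomial_mem_monomials (g : Fin 3 → ℝ≥0 →₀ ℕ) :
    X.finsuppMonomial g ∈ X.monomials := by
  set S : Finset ℝ≥0 := Finset.univ.biUnion fun i => (g i).support with hS
  have h : ∀ i ω, (g i).prod (fun t k => X.bar i t ω ^ k) =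
      ∏ k, X.bar i (S.orderEmbOfFin rfl k) ω ^ g i (S.orderEmbOfFin rfl k) := by
    intro i ω
    rw [Finsupp.prod_of_support_subset (s := S) _
      (Finset.subset_biUnion_of_mem (fun i => (g i).support) (Finset.mem_univ i)) _
      (fun _ _ => pow_zero _)]
    exact (congrArg (fun U => ∏ t ∈ U, X.bar i t ω ^ g i t)
      (Finset.map_orderEmbOfFin_univ S rfl).symm).trans (Finset.prod_map _ _ _)
  refine ⟨S.card, S.orderEmbOfFin rfl, fun k => g 0 (S.orderEmbOfFin rfl k),
    fun k => g 1 (S.orderEmbOfFin rfl k), fun k => g 2 (S.orderEmbOfFin rfl k),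
    (S.orderEmbOfFin rfl).strictMono, ?_⟩
  ext ω
  simp only [finsuppMonomial, h, Fin.prod_univ_three]
  rfl

theorem mem_monomials_of_mem_closure {Y : Ω → ℝ}
    (hY : Y ∈ Submonoid.closure (Set.range fun p : Fin 3 × ℝ≥0 => X.bar p.1 p.2)) :
    Y ∈ X.monomials := by
  suffices ∃ g, Y = X.finsuppMonomial g by
    obtain ⟨g, rfl⟩ := this
    exact X.finsuppMonomial_mem_monomials g
  induction hY using Submonoid.closure_induction with
  | mem Y hY =>
    obtain ⟨⟨i, t⟩, rfl⟩ := hY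
    refine ⟨Pi.single i (Finsupp.single t 1), ?_⟩
    ext ω
    rw [finsuppMonomial, Finset.prod_eq_single i]
    · simp
    · intro k _ hk
      simp [Pi.single_eq_of_ne hk]
    · simp
  | one => exact ⟨0, by ext ω; simp [finsuppMonomial]⟩
  | mul Y Y' _ _ h h' =>
    obtain ⟨g, rfl⟩ := h
    obtain ⟨g', rfl⟩ := h'
    refine ⟨g + g', ?_⟩
    ext ω
    simp only [finsuppMonomial, Pi.mul_apply, ← Finset.prod_mul_distrib, Pi.add_apply]
    refine Finset.prod_congr rfl fun i _ => ?_
    rw [Finsupp.prod_add_index' (fun _ => pow_zero _) fun _ _ _ => pow_add _ _ _]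

variable {X}

theorem MomentAssumptions.allLp_bar [IsProbabilityMeasure P] (hX : X.MomentAssumptions) (i : Fin 3)
    (t : ℝ≥0) : AllLp (X.bar i t) P := by
  fin_cases i
  · exact hX.allLp_Θbar t
  · exact hX.allLp_ξLbar t
  · exact hX.allLp_ξfbar t

theorem MomentAssumptions.allLp_of_mem_barAlgebra [IsProbabilityMeasure P]
    (hX : X.MomentAssumptions) {Y : Ω → ℝ} (hY : Y ∈ X.barAlgebra) : AllLp Y P := by
  induction hY using Algebra.adjoin_induction with
  | mem Y hY =>
    obtain ⟨p, rfl⟩ := hY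
    exact hX.allLp_bar _ _
  | algebraMap c => exact allLp_const c
  | add Y Y' _ _ h h' => exact h.add h'
  | mul Y Y' _ _ h h' => exact h.mul h'

theorem MomentAssumptions.allLp_of_mem_monomials [IsProbabilityMeasure P]
    (hX : X.MomentAssumptions) {Y : Ω → ℝ} (hY : Y ∈ X.monomials) : AllLp Y P := by
  obtain ⟨m, t, g, p, b, -, rfl⟩ := hY
  exact ((allLp_prod _ fun i _ => (hX.allLp_Θbar _).pow _).mul
    (allLp_prod _ fun i _ => (hX.allLp_ξLbar _).pow _)).mul
    (allLp_prod _ fun i _ => (hX.allLp_ξfbar _).pow _)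

theorem MomentAssumptions.aestronglyMeasurable_monomials [IsProbabilityMeasure P]
    (hX : X.MomentAssumptions) {Y : Ω → ℝ} (hY : Y ∈ X.monomials) :
    AEStronglyMeasurable[X.Finf] Y P := by
  obtain ⟨m, t, g, p, b, -, rfl⟩ := hY
  exact ((aestronglyMeasurable_prod _ fun i => (aestronglyMeasurable_Θbar _).pow _).mul
    (aestronglyMeasurable_prod _ fun i => (hX.aestronglyMeasurable_ξLbar _).pow _)).mul
    (aestronglyMeasurable_prod _ fun i => (hX.aestronglyMeasurable_ξfbar _).pow _)

/-- The algebra is the linear span of the multiplicative closure of its generators, and that closure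
consists of monomials. Having all moments makes the pairing with Z linear on it. -/
theorem MomentAssumptions.integral_mul_eq_zero [IsProbabilityMeasure P] (hX : X.MomentAssumptions)
    {Z : Ω → ℝ} (hZ : MemLp Z 2 P) (h : ∀ Y ∈ X.monomials, ∫ ω, Z ω * Y ω ∂P = 0) {Y : Ω → ℝ}
    (hY : Y ∈ X.barAlgebra) : ∫ ω, Z ω * Y ω ∂P = 0 := by
  have hspan : Y ∈ Submodule.span ℝ
      (Submonoid.closure (Set.range fun p : Fin 3 × ℝ≥0 => X.bar p.1 p.2) : Set (Ω → ℝ)) := by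
    rw [← Algebra.adjoin_eq_span]
    exact hY
  have hint : ∀ Y ∈ Submodule.span ℝ
      (Submonoid.closure (Set.range fun p : Fin 3 × ℝ≥0 => X.bar p.1 p.2) : Set (Ω → ℝ)),
      Integrable (fun ω => Z ω * Y ω) P := by
    intro Y hY
    rw [← Algebra.adjoin_eq_span] at hY
    exact (hX.allLp_of_mem_barAlgebra hY).integrable_mul hZ
  clear hY
  induction hspan using Submodule.span_induction with
  | mem Y hY => exact h Y (X.mem_monomials_of_mem_closure hY)
  | zero => simp
  | add Y Y' hY1 hY2 h1 h2 =>
    simp only [Pi.add_apply, mul_add]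
    rw [integral_add (hint _ hY1) (hint _ hY2), h1, h2, add_zero]
  | smul c Y hY1 h1 =>
    simp only [Pi.smul_apply, smul_eq_mul, mul_left_comm _ c]
    rw [integral_const_mul, h1, mul_zero]

end ModulatedProcess
end LevyMAP
end

/-! ### Orthogonality after multiplication by triggered jumps and events of the modulator -/

noncomputable section

namespace LevyMAP
namespace ModulatedProcess

variable {Ω : Type*} {mΩ : MeasurableSpace Ω} {P : Measure Ω} (X : ModulatedProcess P)

/-- `Q` has moments of all orders, and `Z` is orthogonal to all products of `Q` with elements of the
algebra of the centred processes and indicators of events of the modulator. -/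
def Killed (Z Q : Ω → ℝ) : Prop :=
  AllLp Q P ∧ ∀ Y ∈ X.barAlgebra, ∀ C, MeasurableSet[processSigma X.Θ] C →
    ∫ ω in C, Z ω * (Y ω * Q ω) ∂P = 0

variable {X} [IsProbabilityMeasure P] {Z Q : Ω → ℝ}

/-- Θ has genuine exponential moments, so determinacy with weight ZY converts orthogonality to
polynomials in Θ into orthogonality to indicators of finite-dimensional events of Θ, and a π-system
argument gives all of σ(Θ). -/
theorem MomentAssumptions.killed_one (hX : X.MomentAssumptions) (hZ : MemLp Z 2 P)
    (h : ∀ Y ∈ X.barAlgebra, ∫ ω, Z ω * Y ω ∂P = 0) : X.Killed Z fun _ => 1 := by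
  refine ⟨allLp_const 1, fun Y hY C hC => ?_⟩
  have hYL := hX.allLp_of_mem_barAlgebra hY
  simp only [mul_one]
  refine setIntegral_eq_zero_of_iSup (hYL.integrable_mul hZ) _ (fun t => (X.Θ_meas t).comap_le)
    (fun s f hf => ?_) hC
  have hf' : ∀ i ∈ s, ∃ D, MeasurableSet D ∧ X.Θ i ⁻¹' D = f i := hf
  choose! D hD hDf using hf'
  rw [← Set.iInter₂_congr hDf]
  obtain ⟨c, hc0, hc1, -, -⟩ := hX.exponential
  refine setIntegral_biInter_eq_zero_of_moments hZ hYL.memLp_four X.Θ_meas s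
    (fun t _ => X.hasExpMoment_Θ hc0 hc1 t) (fun k => ?_) hD
  have hmem : (Y * ∏ i ∈ s, X.Θ i ^ k i) ∈ X.barAlgebra :=
    X.barAlgebra.mul_mem hY (Subalgebra.prod_mem _ fun i _ =>
      Subalgebra.pow_mem _ (X.Θ_mem_barAlgebra i) _)
  rw [← h _ hmem]
  refine integral_congr_ae (Eventually.of_forall fun ω => ?_)
  simp [mul_assoc]

theorem MomentAssumptions.killed_mul_mem (hX : X.MomentAssumptions) (h : X.Killed Z Q) {V : Ω → ℝ} (hV : V ∈ X.barAlgebra) :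
    X.Killed Z fun ω => Q ω * V ω := by
  refine ⟨h.1.mul (hX.allLp_of_mem_barAlgebra hV), fun Y hY C hC => ?_⟩
  rw [← h.2 _ (X.barAlgebra.mul_mem hY hV) C hC]
  refine integral_congr_ae (Eventually.of_forall fun ω => ?_)
  simp only [Pi.mul_apply]
  ring

theorem MomentAssumptions.killed_mul_trigger (hX : X.MomentAssumptions) (hZ : MemLp Z 2 P)
    (h : X.Killed Z Q) (T j : ℕ) :
    X.Killed Z fun ω => Q ω * X.trigger T j ω := by
  refine ⟨h.1.mul (hX.allLp_trigger _ _), fun Y hY C hC => ?_⟩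
  have hYL := hX.allLp_of_mem_barAlgebra hY
  have hCm := X.processSigma_Θ_le _ hC
  -- On `E n k` the time τ_j is at most T and lies in the k-th grid cell. As this event belongs to
  -- the modulator, the increment of ξ^f across the random cell becomes a finite sum of modulator
  -- indicators times elements of the algebra.
  set E : ℕ → ℕ → Set Ω := fun n k =>
    {ω | X.tau j ω ≤ (T : ℝ≥0)} ∩ {ω | ⌈(X.tau j ω).toNNReal * (n + 1)⌉₊ = k} with hE
  have hEm : ∀ n k, MeasurableSet[processSigma X.Θ] (E n k) := by
    intro n k
    refine (X.measurable_tau j measurableSet_Iic).inter ?_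
    have h1 : Measurable[processSigma X.Θ] fun ω => ⌈(X.tau j ω).toNNReal * (n + 1)⌉₊ :=
      Nat.measurable_ceil.comp ((ENNReal.measurable_toNNReal.comp (X.measurable_tau j)).mul_const _)
    exact h1 (measurableSet_singleton k)
  set δ : ℕ → ℕ → Ω → ℝ := fun n k ω =>
    X.ξf (k / (n + 1)) ω - X.ξf ((k - 1 : ℕ) / (n + 1)) ω with hδ
  set D : ℕ → Ω → ℝ := fun n ω =>
    ∑ k ∈ Finset.range (T * (n + 1) + 1), (E n k).indicator (δ n k) ω with hD
  have hDeq : ∀ n ω, D n ω = if X.tau j ω ≤ (T : ℝ≥0) then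
      X.ξf (gridUp n (X.tau j ω).toNNReal) ω - X.ξf (gridDown n (X.tau j ω).toNNReal) ω else 0 := by
    intro n ω
    split_ifs with hτ
    · have hτ' : (X.tau j ω).toNNReal ≤ T := ENNReal.toNNReal_mono ENNReal.coe_ne_top hτ
      have hmem : ⌈(X.tau j ω).toNNReal * (n + 1)⌉₊ ∈ Finset.range (T * (n + 1) + 1) := by
        rw [Finset.mem_range, Nat.lt_succ_iff]
        refine Nat.ceil_le.2 ?_
        push_cast
        gcongr
      rw [hD]
      simp only
      rw [Finset.sum_eq_single_of_mem _ hmem fun k _ hk =>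
        Set.indicator_of_notMem (fun hω => hk hω.2.symm) _]
      rw [Set.indicator_of_mem (show ω ∈ E n _ from ⟨hτ, rfl⟩)]
      rfl
    · exact Finset.sum_eq_zero fun k _ => Set.indicator_of_notMem (fun hω => hτ hω.1) _
  have hint : ∀ n k, Integrable (fun ω => Z ω * (Y ω * (Q ω * δ n k ω))) P := fun n k =>
    (hYL.mul (h.1.mul ((hX.allLp_ξf _).sub (hX.allLp_ξf _)))).integrable_mul hZ
  have hzero : ∀ n, ∫ ω in C, Z ω * (Y ω * (Q ω * D n ω)) ∂P = 0 := by
    intro n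
    have e1 : ∀ ω, Z ω * (Y ω * (Q ω * D n ω)) = ∑ k ∈ Finset.range (T * (n + 1) + 1),
        (E n k).indicator (fun ω => Z ω * (Y ω * (Q ω * δ n k ω))) ω := by
      intro ω
      rw [hD]
      simp only [Finset.mul_sum]
      refine Finset.sum_congr rfl fun k _ => ?_
      by_cases hω : ω ∈ E n k
      · simp only [Set.indicator_of_mem hω]
      · simp only [Set.indicator_of_notMem hω, mul_zero]
    simp_rw [e1]
    rw [integral_finsetSum _ fun k _ =>
      ((hint n k).indicator (X.processSigma_Θ_le _ (hEm n k))).integrableOn]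
    refine Finset.sum_eq_zero fun k _ => ?_
    rw [setIntegral_indicator (X.processSigma_Θ_le _ (hEm n k))]
    have hmem : Y * (X.ξf (k / (n + 1)) - X.ξf ((k - 1 : ℕ) / (n + 1))) ∈ X.barAlgebra :=
      X.barAlgebra.mul_mem hY (X.barAlgebra.sub_mem (X.ξf_mem_barAlgebra _) (X.ξf_mem_barAlgebra _))
    rw [← h.2 _ hmem _ (hC.inter (hEm n k))]
    refine integral_congr_ae (Eventually.of_forall fun ω => ?_)
    simp only [hδ, Pi.mul_apply, Pi.sub_apply]
    ring
  set S : Ω → ℝ := fun ω => (X.totalTrigger T ω).toReal with hS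
  have hSL : AllLp S P := hX.allLp_totalTrigger T
  have hbound : Integrable (fun ω => Z ω * (Y ω * (Q ω * (2 * S ω)))) P :=
    (hYL.mul (h.1.mul ((allLp_const 2).mul hSL))).integrable_mul hZ
  have hDm : ∀ n, AEStronglyMeasurable (fun ω => Z ω * (Y ω * (Q ω * D n ω))) P := fun n =>
    hZ.1.mul ((hYL 0).1.mul ((h.1 0).1.mul (aestronglyMeasurable_sum _ fun k =>
      ((X.ξf_meas _).sub (X.ξf_meas _)).aestronglyMeasurable.indicator
        (X.processSigma_Θ_le _ (hEm n k)))))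
  have hlim : Tendsto (fun n => ∫ ω in C, Z ω * (Y ω * (Q ω * D n ω)) ∂P) atTop
      (𝓝 (∫ ω in C, Z ω * (Y ω * (Q ω * X.trigger T j ω)) ∂P)) := by
    refine tendsto_integral_of_dominated_convergence
      (fun ω => |Z ω * (Y ω * (Q ω * (2 * S ω)))|) (fun n => (hDm n).restrict)
      hbound.abs.integrableOn (fun n => ?_) ?_
    · filter_upwards [ae_restrict_of_ae (hX.abs_ξf_le T)] with ω hω
      -- Both grid points stay in [0, T] because T is an integer, and there |ξ^f| is at most the
      -- total size of the triggers, which has all moments.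
      have hDb : |D n ω| ≤ |2 * S ω| := by
        refine le_trans ?_ (le_abs_self _)
        rw [hDeq]
        split_ifs with hτ
        · have hτ' : (X.tau j ω).toNNReal ≤ (T : ℝ≥0) := ENNReal.toNNReal_mono ENNReal.coe_ne_top hτ
          have h1 := hω _ (gridUp_le_natCast hτ' (n := n))
          have h2 := hω _ ((gridDown_le n _).trans hτ')
          calc _ ≤ _ := abs_sub _ _
            _ ≤ 2 * S ω := by linarith
        · rw [abs_zero]
          exact mul_nonneg zero_le_two ENNReal.toReal_nonneg
      simp only [Real.norm_eq_abs, abs_mul] at hDb ⊢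
      gcongr
    · filter_upwards [ae_restrict_of_ae X.tendsto_ξf_grid] with ω hω
      refine ((Tendsto.const_mul _ ?_).const_mul _).const_mul _
      simp only [hDeq, trigger]
      split_ifs with hτ
      · exact hω j (ne_top_of_le_ne_top ENNReal.coe_ne_top hτ)
      · exact tendsto_const_nhds
  simp_rw [hzero] at hlim
  exact (tendsto_nhds_unique hlim tendsto_const_nhds)

end ModulatedProcess
end LevyMAP
end

/-! ### Generators with local exponential moments, and totality -/

noncomputable section

namespace LevyMAP
namespace ModulatedProcess

variable {Ω : Type*} {mΩ : MeasurableSpace Ω} {P : Measure Ω} (X : ModulatedProcess P)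

/-- The modulator, the centred process `ξ̄^L` and the individual triggered jumps. -/
def gen : ℝ≥0 ⊕ ℝ≥0 ⊕ ℕ × ℕ → Ω → ℝ :=
  Sum.elim X.Θ (Sum.elim X.ξLbar fun p => X.trigger p.1 p.2)

theorem measurable_gen (i) : Measurable (X.gen i) := by
  rcases i with t | t | ⟨T, j⟩
  · exact X.Θ_meas t
  · exact X.measurable_bar 1 t
  · exact X.measurable_trigger T j

/-- The σ-algebra generated by `gen`. -/
abbrev genSigma : MeasurableSpace Ω := ⨆ i, MeasurableSpace.comap (X.gen i) inferInstance

theorem genSigma_le : X.genSigma ≤ mΩ := iSup_le fun i => (X.measurable_gen i).comap_le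

theorem measurable_gen_genSigma (i) : Measurable[X.genSigma] (X.gen i) :=
  (comap_measurable _).mono (le_iSup (fun i => MeasurableSpace.comap (X.gen i) inferInstance) i)
    le_rfl

theorem aestronglyMeasurable_ξf_genSigma (t : ℝ≥0) :
    AEStronglyMeasurable[X.genSigma] (X.ξf t) P := by
  have hτ : ∀ j, Measurable[X.genSigma] (X.tau j) := fun j =>
    (X.measurable_tau j).mono (processSigma_le fun s => X.measurable_gen_genSigma (Sum.inl s)) le_rfl
  obtain ⟨T, hT⟩ := exists_nat_ge t
  have htr : ∀ j, Measurable[X.genSigma] (X.trigger t j) := fun j => by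
    have h1 : Measurable[X.genSigma] fun ω => if X.tau j ω ≤ t then X.trigger T j ω else 0 :=
      Measurable.ite (hτ j measurableSet_Iic)
        (X.measurable_gen_genSigma (Sum.inr (Sum.inr (T, j)))) measurable_const
    convert! h1 using 2 with ω
    simp only [trigger]
    split_ifs with h2 h3
    · rfl
    · exact absurd (h2.trans (by exact_mod_cast hT)) h3
    · rfl
  refine aestronglyMeasurable_of_tendsto (f := fun n ω => ∑ j ∈ Finset.range n, X.trigger t j ω)
    (fun n => aestronglyMeasurable_sum _ fun j => aestronglyMeasurable_of_measurable (htr j)) ?_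
  filter_upwards [X.hasSum_trigger] with ω hω
  exact (hω t).tendsto_sum_nat

/-- Replacing ξ^f by its individual triggers loses nothing up to null sets: their sum gives back
ξ^f, and adding the centred ξ^L and its modulator-measurable conditional mean gives ξ. -/
theorem Finf_le_genSigma : X.Finf ≤ eventuallyMeasurableSpace X.genSigma (ae P) := by
  have hΘ : ∀ t, Measurable[X.genSigma] (X.Θ t) := fun s => X.measurable_gen_genSigma (Sum.inl s)
  refine iSup_le fun t => sup_le (sup_le ?_ (processSigmaUpTo_le fun s _ => ?_))
    (le_sup_right.trans sup_nullSigma_le_eventually)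
  · exact (processSigmaUpTo_le fun s _ => hΘ s).trans le_eventuallyMeasurableSpace
  obtain ⟨f, hf, hff⟩ := X.aestronglyMeasurable_ξf_genSigma s
  have hK : Measurable[X.genSigma] (condExp (X.K s) P (X.ξL s)) :=
    stronglyMeasurable_condExp.measurable.mono (processSigmaUpTo_le fun r _ => hΘ r) le_rfl
  refine measurable_eventually_of_ae_eq (((X.measurable_gen_genSigma (Sum.inr (Sum.inl s))).fun_add
    hK).fun_add hf.measurable) ?_
  filter_upwards [hff] with ω hω
  rw [← hω]
  simp [gen, ξLbar, ξ]

variable {X} [IsProbabilityMeasure P] {Z Q : Ω → ℝ}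

theorem MomentAssumptions.locExp_gen (hX : X.MomentAssumptions) (i) : X.LocExp (X.gen i) := by
  rcases i with t | t | ⟨T, j⟩
  · exact hX.locExp_Θ t
  · exact hX.locExp_ξLbar t
  · exact hX.locExp_trigger T j

theorem MomentAssumptions.killed_mul_gen (hX : X.MomentAssumptions) (hZ : MemLp Z 2 P)
    (h : X.Killed Z Q) (i) : X.Killed Z fun ω => Q ω * X.gen i ω := by
  rcases i with t | t | ⟨T, j⟩
  · exact hX.killed_mul_mem h (X.Θ_mem_barAlgebra t)
  · exact hX.killed_mul_mem h (X.bar_mem_barAlgebra 1 t)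
  · exact hX.killed_mul_trigger hZ h T j

theorem MomentAssumptions.killed_prod_gen (hX : X.MomentAssumptions) (hZ : MemLp Z 2 P)
    (h : ∀ Y ∈ X.barAlgebra, ∫ ω, Z ω * Y ω ∂P = 0) (s : Finset (ℝ≥0 ⊕ ℝ≥0 ⊕ ℕ × ℕ))
    (k : ℝ≥0 ⊕ ℝ≥0 ⊕ ℕ × ℕ → ℕ) : X.Killed Z fun ω => ∏ i ∈ s, X.gen i ω ^ k i := by
  have hpow : ∀ (Q : Ω → ℝ) (i) (n : ℕ), X.Killed Z Q → X.Killed Z fun ω => Q ω * X.gen i ω ^ n := by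
    intro Q i n hQ
    induction n with
    | zero => simpa using hQ
    | succ n ih =>
      simp only [pow_succ, ← mul_assoc]
      exact hX.killed_mul_gen hZ ih i
  classical
  induction s using Finset.induction_on with
  | empty => simpa using hX.killed_one hZ h
  | insert i s hi ih =>
    simp only [Finset.prod_insert hi]
    simp only [mul_comm (X.gen i _ ^ k i)]
    exact hpow _ i (k i) ih

/-- On each localising event A N the finitely many generators have exponential moments, and Z is
orthogonal there to all their monomials because A N belongs to the modulator. Determinacy under P
restricted to A N gives 0, and A N exhausts Ω. -/
theorem MomentAssumptions.setIntegral_gen_eq_zero (hX : X.MomentAssumptions) (hZ : MemLp Z 2 P)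
    (h : ∀ Y ∈ X.barAlgebra, ∫ ω, Z ω * Y ω ∂P = 0) (s : Finset (ℝ≥0 ⊕ ℝ≥0 ⊕ ℕ × ℕ))
    {D : ℝ≥0 ⊕ ℝ≥0 ⊕ ℕ × ℕ → Set ℝ} (hD : ∀ i ∈ s, MeasurableSet (D i)) :
    ∫ ω in ⋂ i ∈ s, X.gen i ⁻¹' D i, Z ω ∂P = 0 := by
  obtain ⟨A, hA, hAmono, hAae, hAV⟩ := exists_common_locExp s fun i _ => hX.locExp_gen i
  have hAm : ∀ N, MeasurableSet (A N) := fun N => X.processSigma_Θ_le _ (hA N)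
  set E : Set Ω := ⋂ i ∈ s, X.gen i ⁻¹' D i with hE
  have hEm : MeasurableSet E := MeasurableSet.biInter s.countable_toSet fun i hi =>
    X.measurable_gen i (hD i hi)
  have hzero : ∀ N, ∫ ω in A N ∩ E, Z ω ∂P = 0 := by
    intro N
    have h1 := setIntegral_biInter_eq_zero_of_moments (Q := P.restrict (A N)) (G := fun _ => 1)
      (hZ.restrict _) (memLp_const 1) X.measurable_gen s (hAV N) (fun k => by
        have h2 := (hX.killed_prod_gen hZ h s k).2 1 X.barAlgebra.one_mem (A N) (hA N)
        simpa using h2) hD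
    rw [Measure.restrict_restrict hEm, Set.inter_comm] at h1
    simpa using h1
  have hi : Integrable Z P := hZ.integrable (by norm_num)
  have hlim := tendsto_setIntegral_of_monotone (μ := P) (f := Z) (s := fun N => A N ∩ E)
    (fun N => (hAm N).inter hEm) (fun a b hab => Set.inter_subset_inter_left _ (hAmono hab))
    hi.integrableOn
  simp_rw [hzero] at hlim
  rw [← tendsto_nhds_unique hlim tendsto_const_nhds]
  refine setIntegral_congr_set ?_
  filter_upwards [hAae] with ω hω
  refine propext ⟨fun hE' => Set.mem_iUnion.2 ?_, fun hE' => ?_⟩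
  · obtain ⟨N, hN⟩ := hω
    exact ⟨N, hN, hE'⟩
  · obtain ⟨N, -, hN⟩ := Set.mem_iUnion.1 hE'
    exact hN

theorem MomentAssumptions.ae_eq_zero_of_orthogonal (hX : X.MomentAssumptions) (hZ : MemLp Z 2 P)
    (hZF : AEStronglyMeasurable[X.Finf] Z P) (h : ∀ Y ∈ X.monomials, ∫ ω, Z ω * Y ω ∂P = 0) :
    Z =ᵐ[P] 0 := by
  have h' : ∀ Y ∈ X.barAlgebra, ∫ ω, Z ω * Y ω ∂P = 0 := fun Y hY =>
    hX.integral_mul_eq_zero hZ h hY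
  have hi : Integrable Z P := hZ.integrable (by norm_num)
  refine ae_eq_zero_of_setIntegral_eq_zero X.genSigma_le
    (aestronglyMeasurable_of_le_eventually X.Finf_le_genSigma hZF) hi fun D hD => ?_
  refine setIntegral_eq_zero_of_iSup hi
    (fun i => MeasurableSpace.comap (X.gen i) inferInstance)
    (fun i => (X.measurable_gen i).comap_le) (fun s f hf => ?_) hD
  have hf' : ∀ i ∈ s, ∃ D, MeasurableSet D ∧ X.gen i ⁻¹' D = f i := hf
  choose! D hD hDf using hf'
  rw [← Set.iInter₂_congr hDf]
  exact hX.setIntegral_gen_eq_zero hZ h' s hD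

theorem MomentAssumptions.closure_span_monomials (hX : X.MomentAssumptions) :
    (Submodule.span ℝ {f : Lp ℝ 2 P | ∃ Y ∈ X.monomials, f =ᵐ[P] Y}).topologicalClosure =
      lpMeas ℝ ℝ X.Finf 2 P := by
  refine topologicalClosure_eq_lpMeas X.Finf_le (Submodule.span_le.2 ?_) fun f hf h => ?_
  · rintro f ⟨Y, hY, hfY⟩
    rw [SetLike.mem_coe, mem_lpMeas_iff_aestronglyMeasurable]
    exact (hX.aestronglyMeasurable_monomials hY).congr hfY.symm
  · refine hX.ae_eq_zero_of_orthogonal (Lp.memLp f) hf fun Y hY => ?_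
    have hYL := (hX.allLp_of_mem_monomials hY).memLp_two
    have h1 := h (hYL.toLp Y) (Submodule.subset_span ⟨Y, hY, hYL.coeFn_toLp⟩)
    rw [L2.inner_def] at h1
    rw [← h1]
    refine integral_congr_ae ?_
    filter_upwards [hYL.coeFn_toLp] with ω hω
    rw [hω]
    simp

end ModulatedProcess
end LevyMAP
end

theorem mainTheorem4 {Ω : Type*} [mΩ : MeasurableSpace Ω] (P : Measure Ω) [IsProbabilityMeasure P]
    (X : LevyMAP.ModulatedProcess P) (hX : X.MomentAssumptions) :
    (∀ (t : ℝ≥0) (Z : Ω → ℝ), MemLp Z 2 P → AEStronglyMeasurable[X.F t] Z P →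
      ∀ ε : ℝ, 0 < ε →
        ∃ (m : ℕ) (s : Fin m → ℝ≥0) (Zε : Ω → ℝ), Monotone s ∧ (∀ i, s i ≤ t) ∧
          StronglyMeasurable[X.marginalSigma s] Zε ∧ MemLp Zε 2 P ∧
          ∫ ω, (Z ω - Zε ω) ^ 2 ∂P < ε) ∧
    (∀ Y ∈ X.monomials, MemLp Y 2 P) ∧
    (Submodule.span ℝ {f : Lp ℝ 2 P | ∃ Y ∈ X.monomials, f =ᵐ[P] Y}).topologicalClosure =
      lpMeas ℝ ℝ X.Finf 2 P :=
  ⟨fun _ _ hZ hZF _ hε => X.exists_marginal_approx hZ hZF hε,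
    fun _ hY => (hX.allLp_of_mem_monomials hY).memLp_two, hX.closure_span_monomials⟩
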